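/- Let $k$ be a finite field with $q$ elements, $\overline{k}$ an algebraic closure, $L=\overline{k}((t))$, $\mathcal{O}_L=\overline{k}[[t]]$, and let $\sigma$ be the Frobenius of $L$ raising coefficients to the $q$-th power. Let $h\ge 1$ and $m\ge 0$ be coprime integers and let $\mu=(\mu_1\le\dots\le\mu_h)\in\mathbb{N}^h$ with $\sum_i\mu_i=m$. Let $e_0,\dots,e_{h-1}$ be the standard basis of $N=L^h$, put $e_{i+h}=te_i$ for $i\in\mathbb{Z}$, let $M_0=\mathcal{O}_L^h$, and let $b\in GL_h(L)$ be given by $b(e_i)=e_{i+m}$. Let $X$ be the affine Grassmannian of $GL_h$ over $\overline{k}$; its $\overline{k}$-points are the lattices $M=gM_0\subset N$, $g\in GL_h(L)$, and $\mathrm{vol}(M)=v_t(\det g)$. Let $X_\mu(b)^0$ be the locally closed reduced subscheme of $X$ whose $\overline{k}$-points are the lattices $M=gM_0$ with $\mathrm{vol}(M)=0$ and $g^{-1}b\sigma(g)\in GL_h(\mathcal{O}_L)\,t^\mu\, GL_h(\mathcal{O}_L)$. For $v=\sum_i\alpha_ie_i\in N\setminus\{0\}$, $\alpha_i\in\overline{k}$,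 let $I(v)=\min\{i\mid\alpha_i\ne0\}$. For a lattice $M$ let $A(M)=\{I(v)\mid v\in M\setminus\{0\}\}$ and, for $a\in A(M)$, let $\varphi(M)(a)=\max\{n\in\mathbb{N}\mid\exists v\in M,\ I(v)=a,\ t^{-n}b\sigma(v)\in M\}$ (and $-\infty$ if there is no such $n$); for $a\notin A(M)$ let $\varphi(M)(a)=-\infty$. An extended semi-module for $\mu$ is a pair $(A,\varphi)$, where $A\subset\mathbb{Z}$ is bounded below with $A+m\subset A$, $A+h\subset A$ and $\sum_{a\in A\setminus(h+A)}a=\frac{h(h-1)}2$, and $\varphi:\mathbb{Z}\to\mathbb{N}\cup\{-\infty\}$ satisfies: (1) $\varphi(a)=-\infty$ if and only if $a\notin A$; (2) $\varphi(a+h)\ge\varphi(a)+1$ for all $a$; (3) $\varphi(a)\le\max\{n\mid a+m-nh\in A\}$ for all $a\in A$, with equality if $c\in A$ for all $c\ge a$; (4) $A$ is the disjoint union of $h$ sequences $(a^l_j)_{j\in\mathbb{N}}$, $l=1,\dots,h$, such that $\varphi(a^l_{j+1})=\varphi(a^l_j)+1$; $a^l_{j+1}=a^l_j+h$ if $\varphi(a^l_j+h)=\varphi(a^l_j)+1$,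 and $a^l_{j+1}>a^l_j+h$ otherwise; and $(\varphi(a^l_0))_l$ is a permutation of $\mu$. For an extended semi-module $(A,\varphi)$ for $\mu$ let $\mathcal{S}_{A,\varphi}$ be the set of lattices $M\subset N$ with $A(M)=A$ and $\varphi(M)=\varphi$. Lemma. There are only finitely many extended semi-modules $(A,\varphi)$ for $\mu$. The sets $\mathcal{S}_{A,\varphi}$ are contained in $X_\mu(b)^0$, are pairwise disjoint, and their union is $X_\mu(b)^0$. Each $\mathcal{S}_{A,\varphi}$ is the set of $\overline{k}$-points of a locally closed reduced subscheme of $X_\mu(b)^0$, and $X_\mu(b)^0$ is the disjoint union of these subschemes. In particular $\dim X_\mu(b)^0=\max_{(A,\varphi)}\dim\mathcal{S}_{A,\varphi}$. -/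

import Mathlib

open CategoryTheory AlgebraicGeometry

attribute [local instance] MvPolynomial.gradedAlgebra

noncomputable section

namespace AffineDL

/-! ### Extended semi-modules -/

/-- `A` is a semi-module for `m`, `h`: bounded below and stable under `+ m` and `+ h`. -/
structure IsSemimodule (m h : ℕ) (A : Set ℤ) : Prop where
  bddBelow : BddBelow A
  add_m_mem : ∀ a ∈ A, a + m ∈ A
  add_h_mem : ∀ a ∈ A, a + h ∈ A

/-- `A` is normalized: the elements of `B = A \ (h + A)` sum to `h (h - 1) / 2`.
(For a semi-module `A` the set `B` is finite.) -/
def IsNormalized (h : ℕ) (A : Set ℤ) : Prop :=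
  ∑ᶠ a ∈ A \ ((fun a : ℤ => (h : ℤ) + a) '' A), a = (h : ℤ) * (h - 1) / 2

/-- `(A, φ)` is an extended semi-module for `μ`; the value `-∞` is `⊥`. -/
structure IsExtendedSemimodule (m h : ℕ) (μ : Fin h → ℕ) (A : Set ℤ) (φ : ℤ → WithBot ℕ) :
    Prop where
  semimodule : IsSemimodule m h A
  normalized : IsNormalized h A
  eq_bot_iff : ∀ a, φ a = ⊥ ↔ a ∉ A
  add_one_le : ∀ a, φ a + 1 ≤ φ (a + h)
  le_max : ∀ a ∈ A, ∃ n : ℕ, IsGreatest {n : ℕ | a + m - n * h ∈ A} n ∧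
    φ a ≤ n ∧ ((∀ b, a ≤ b → b ∈ A) → φ a = n)
  /-- `A` is the disjoint union of the sequences `s l 0, s l 1, …`, where `l` runs through `h`
  indices. -/
  decomposition : ∃ s : Fin h → ℕ → ℤ,
    Set.BijOn (fun p : Fin h × ℕ => s p.1 p.2) Set.univ A ∧
    (∀ l j, φ (s l (j + 1)) = φ (s l j) + 1) ∧
    (∀ l j, φ (s l j + h) = φ (s l j) + 1 → s l (j + 1) = s l j + h) ∧
    (∀ l j, φ (s l j + h) ≠ φ (s l j) + 1 → s l j + h < s l (j + 1)) ∧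
    ∃ π : Equiv.Perm (Fin h), ∀ l, φ (s l 0) = (μ (π l) : WithBot ℕ)

/-! ### Lattices in `N = L ^ h`, `L = K((t))` -/

/-- Shorthand for `N = L ^ h`. -/
abbrev NSpace (K : Type*) [Field K] (h : ℕ) : Type _ := Fin h → LaurentSeries K

/-- The vector `e_i` for `i : ℤ`: `e_0, …, e_{h-1}` is the standard basis and
`e_{i+h} = t e_i`. -/
def eVec (K : Type*) [Field K] (h : ℕ) (i : ℤ) : NSpace K h :=
  fun r => if ((r : ℕ) : ℤ) = i % h then HahnSeries.single (i / h) (1 : K) else 0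

/-- The coefficient `α_i` in `v = ∑ α_i e_i`. -/
def eCoeff {K : Type*} [Field K] {h : ℕ} [NeZero h] (v : NSpace K h) (i : ℤ) : K :=
  (v (Fin.ofNat h (i % h).toNat)).coeff (i / h)

/-- `I(v) = min {i | α_i ≠ 0}` (used for `v ≠ 0` only). -/
def leadIndex {K : Type*} [Field K] {h : ℕ} [NeZero h] (v : NSpace K h) : ℤ :=
  sInf {i : ℤ | eCoeff v i ≠ 0}

/-- The Frobenius `σ` of `L = K((t))`, raising coefficients to the power `q = #k`. -/
def sigmaL (k K : Type*) [Field k] [Fintype k] [Field K] [Algebra k K] (f : LaurentSeries K) :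
    LaurentSeries K :=
  HahnSeries.map f (FiniteField.frobeniusAlgHom k K)

/-- The matrix `b` with `b e_i = e_{i+m}`. -/
def bMatrix (K : Type*) [Field K] (m h : ℕ) : Matrix (Fin h) (Fin h) (LaurentSeries K) :=
  Matrix.of fun r c => eVec K h (((c : ℕ) : ℤ) + m) r

/-- The map `bσ` on `N`. -/
def bSigma (k : Type*) {K : Type*} [Field k] [Fintype k] [Field K] [Algebra k K] (m : ℕ) {h : ℕ}
    (v : NSpace K h) : NSpace K h :=
  (bMatrix K m h).mulVec fun r => sigmaL k K (v r)

/-- Shorthand for the type of `O_L`-submodules of `N`, `O_L = K[[t]]`. -/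
abbrev OSubmodule (K : Type*) [Field K] (h : ℕ) : Type _ :=
  Submodule (PowerSeries K) (NSpace K h)

/-- The lattice `g M_0`, where `M_0 = O_L ^ h`: the `O_L`-span of the columns of `g`. -/
def latticeOf {K : Type*} [Field K] {h : ℕ}
    (g : Matrix.GeneralLinearGroup (Fin h) (LaurentSeries K)) : OSubmodule K h :=
  Submodule.span (PowerSeries K) (Set.range g.val.col)

/-- The connected component of the affine Grassmannian (as a set of lattices) of lattices of
volume `0`. -/
def grassmannian0 (K : Type*) [Field K] (h : ℕ) : Set (OSubmodule K h) :=
  {M | ∃ g : Matrix.GeneralLinearGroup (Fin h) (LaurentSeries K),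
    latticeOf g = M ∧ g.val.det.order = 0}

/-- The set of `K`-valued points of `X_μ(b)`: lattices `M = g M_0` such that
`g⁻¹ b σ(g) ∈ GL_h(O_L) t^μ GL_h(O_L)`. -/
def adlv (k K : Type*) [Field k] [Fintype k] [Field K] [Algebra k K] (m : ℕ) {h : ℕ}
    (μ : Fin h → ℕ) : Set (OSubmodule K h) :=
  {M | ∃ g : Matrix.GeneralLinearGroup (Fin h) (LaurentSeries K), latticeOf g = M ∧
    ∃ k₁ k₂ : Matrix.GeneralLinearGroup (Fin h) (PowerSeries K),
      (g⁻¹).val * bMatrix K m h * g.val.map (sigmaL k K) =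
        k₁.val.map (HahnSeries.ofPowerSeries ℤ K) *
          Matrix.diagonal (fun i => HahnSeries.single (μ i : ℤ) (1 : K)) *
          k₂.val.map (HahnSeries.ofPowerSeries ℤ K)}

/-- The set of `K`-valued points of `X_μ(b)^0`. -/
def adlv0 (k K : Type*) [Field k] [Fintype k] [Field K] [Algebra k K] (m : ℕ) {h : ℕ}
    (μ : Fin h → ℕ) : Set (OSubmodule K h) :=
  adlv k K m μ ∩ grassmannian0 K h

/-- `A(M) = {I(v) | v ∈ M \ {0}}`. -/
def latticeA {K : Type*} [Field K] {h : ℕ} [NeZero h] (M : OSubmodule K h) : Set ℤ :=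
  {a | ∃ v ∈ M, v ≠ 0 ∧ leadIndex v = a}

open Classical in
/-- `φ(M)(a) = max {n | ∃ v ∈ M, I(v) = a, t^{-n} bσ(v) ∈ M}` for `a ∈ A(M)`, and `-∞` for
`a ∉ A(M)`. The supremum is taken in `ℕ ∪ {-∞}`; for a lattice `M` the set is bounded above, so
the supremum is a maximum if the set is nonempty, and it is `-∞` otherwise. -/
def latticePhi (k : Type*) {K : Type*} [Field k] [Fintype k] [Field K] [Algebra k K] (m : ℕ)
    {h : ℕ} [NeZero h] (M : OSubmodule K h) (a : ℤ) : WithBot ℕ :=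
  if a ∈ latticeA M then
    sSup {x : WithBot ℕ | ∃ n : ℕ, x = n ∧ ∃ v ∈ M, v ≠ 0 ∧ leadIndex v = a ∧
      HahnSeries.single (-(n : ℤ)) (1 : K) • bSigma k m v ∈ M}
  else ⊥

/-- `S_{A,φ}`: all lattices `M` in `N` with `A(M) = A` and `φ(M) = φ`. -/
def stratum (k K : Type*) [Field k] [Fintype k] [Field K] [Algebra k K] (m h : ℕ) [NeZero h]
    (A : Set ℤ) (φ : ℤ → WithBot ℕ) : Set (OSubmodule K h) :=
  {M | M.IsLattice (LaurentSeries K) ∧ latticeA M = A ∧ latticePhi k m M = φ}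

/-! ### Subschemes of the affine Grassmannian

The component of volume `0` of the affine Grassmannian is the increasing union over `n` of the
projective schemes of lattices `M` with `t^n M_0 ⊆ M ⊆ t^{-n} M_0`. The `n`-th one is embedded, by
Plücker coordinates of the `n h`-dimensional subspace `M / t^n M_0` of the `2 n h`-dimensional space
`t^{-n} M_0 / t^n M_0`, as a closed subscheme of a projective space. So its locally closed reduced
subschemes are the reduced schemes with an immersion into that projective space all of whose closed
points come from such lattices, and they are determined by these sets of lattices. -/

/-- The lattice `t^c M_0`. -/
def tLattice (K : Type*) [Field K] (h : ℕ) (c : ℤ) : OSubmodule K h :=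
  Submodule.span (PowerSeries K) (Set.range fun j : Fin h => eVec K h (c * h + ((j : ℕ) : ℤ)))

/-- The lattices between `t^n M_0` and `t^{-n} M_0`. -/
def window (K : Type*) [Field K] (h n : ℕ) : Set (OSubmodule K h) :=
  {M | tLattice K h n ≤ M ∧ M ≤ tLattice K h (-(n : ℤ))}

/-- Coordinates on `t^{-n} M_0 / t^n M_0`: the coefficients of `e_i` for `-n h ≤ i < n h`. -/
def windowCoords {K : Type*} [Field K] {h : ℕ} [NeZero h] (n : ℕ) (v : NSpace K h) :
    Fin (2 * (n * h)) → K :=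
  fun j => eCoeff v (((j : ℕ) : ℤ) - n * h)

/-- The rows of `w` are a basis of `M / t^n M_0` inside `t^{-n} M_0 / t^n M_0`. -/
def IsFrame {K : Type*} [Field K] {h : ℕ} [NeZero h] (n : ℕ) (M : OSubmodule K h)
    (w : Matrix (Fin (n * h)) (Fin (2 * (n * h))) K) : Prop :=
  LinearIndependent K w.row ∧
    (Submodule.span K (Set.range w.row) : Set (Fin (2 * (n * h)) → K)) =
      windowCoords n '' (M : Set (NSpace K h))

/-- Indices of Plücker coordinates: the `d`-element subsets of `{0, …, 2 d - 1}`, given by their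
increasing enumerations. -/
abbrev PluckerIndex (d : ℕ) : Type := Fin d ↪o Fin (2 * d)

/-- The maximal minors. -/
def pluckerCoords {K : Type*} [Field K] {d : ℕ} (w : Matrix (Fin d) (Fin (2 * d)) K)
    (J : PluckerIndex d) : K :=
  (w.submatrix id J).det

/-- The projective space over `K` with homogeneous coordinates indexed by `PluckerIndex d`. -/
def pluckerSpace (K : Type*) [Field K] (d : ℕ) : Scheme :=
  Proj (MvPolynomial.homogeneousSubmodule (PluckerIndex d) K)

/-- `x` is the closed point of the projective space that is given by the Plücker coordinates of `M`:
its homogeneous ideal consists of the polynomials vanishing on the line through the vector of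
Plücker coordinates of `M`. -/
def IsPluckerPoint {K : Type*} [Field K] {h : ℕ} [NeZero h] (n : ℕ) (M : OSubmodule K h)
    (x : pluckerSpace K (n * h)) : Prop :=
  ∃ w, IsFrame n M w ∧ ∀ f : MvPolynomial (PluckerIndex (n * h)) K,
    f ∈ ProjectiveSpectrum.asHomogeneousIdeal
        (show ProjectiveSpectrum (MvPolynomial.homogeneousSubmodule (PluckerIndex (n * h)) K) from x) ↔
      ∀ c : K, MvPolynomial.eval (c • pluckerCoords w) f = 0

/-- The morphism `ι` (an immersion of a reduced scheme into projective space) makes `Z` the locally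
closed reduced subscheme of the affine Grassmannian whose set of `K`-valued points is `S`. -/
structure IsReducedSubscheme {K : Type*} [Field K] {h : ℕ} [NeZero h] (n : ℕ)
    (S : Set (OSubmodule K h)) {Z : Scheme} (ι : Z ⟶ pluckerSpace K (n * h)) : Prop where
  isReduced : IsReduced Z
  isImmersion : IsImmersion ι
  subset_window : S ⊆ window K h n
  closedPoints_eq : Set.range ι ∩ closedPoints (pluckerSpace K (n * h)) =
    {x | ∃ M ∈ S, IsPluckerPoint n M x}

end AffineDL

end

/-!
The strata are described by numbers that are visibly ranks of matrices in Plücker coordinates.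

For a lattice `M` and `e : ℕ` let `L_e(M)` (`level`) be the space of all `v ∈ M` with
`t ^ (-e) bσ(v) ∈ M`. By definition `φ(M)(a) ≥ e` means that `a` is a leading index of `L_e(M)`
(`le_latticePhi_iff`). The basic tool is `ncard_leadSet_diff`: for `K`-subspaces of `N`, the
number of leading indices lost on passing to the kernel of a linear map is the rank of the map. So
leading indices count dimensions; for example the volume of `M` is `0` if and only if `A(M)` is
normalized (`isNormalized_leadSet_iff`).

If `M = g M_0` and `g⁻¹ b σ(g)` has elementary divisors `ν`, then `M / L_e(M)` has length
`∑ (e - ν i)` (truncated subtraction, `levelCodim_of_relativePosition`), and by the Cartan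
decomposition these numbers determine `ν` (`mem_adlv_of_levelCodim`). For an extended semi-module
`(A, φ)` the sequences of the decomposition show that `∑ (e - μ i)` elements of `A` have level less
than `e`; hence the strata lie in `X_μ(b)^0` (`stratum_subset_adlv0`). Conversely, for
`M ∈ X_μ(b)^0` the numbers of elements of each level are known, and multiplication by `t` embeds
`L_e / L_{e+1}` into `L_{e+1} / L_{e+2}`, which yields inequalities between the numbers of elements
`≥ x` of level `e` and of elements `≥ x + h` of level `e + 1`. By Hall's theorem these inequalities
suffice to arrange `A(M)` in sequences (`exists_decomposition`), so that `(A(M), φ(M))` is an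
extended semi-module (`isExtendedSemimodule_of_mem_adlv0`). A normalized semi-module lies between
two explicit half-lines, because `m` and `h` are coprime; this gives finiteness
(`finite_isExtendedSemimodule`) and a bound for the lattices in `X_μ(b)^0`.

For the scheme structures, closed points of the projective space are identified with lines
(`closedPoints_projectiveSpectrum`), and the Grassmannian is described by its charts, on which
the minors of the universal frame are regular functions. The codimension `filCodim e a M` of
`L_e(M) ∩ fil a` in `M` is the rank of a matrix of such functions (`filCodim_eq_rank`). These ranks
cut out `X_μ(b)^0`, and finitely many of them separate the strata from each other; so all these
sets are locally closed (`isLocallyClosed_pluckerSet_stratum`). A locally closed subset of a scheme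
carries a reduced subscheme structure, and in Jacobson spaces inclusions, disjointness and covers by
locally closed sets can be checked on closed points.

Finally, given a chain of irreducible closed subsets of `X_μ(b)^0`, some stratum contains a
nonempty open part of the largest one. In a Noetherian Jacobson ring a chain of primes can be moved
into a given open subset with its first term fixed, by Krull's principal ideal theorem and prime
avoidance (`hasChain_notMem`). So the dimension of that stratum is at least the length of the
chain.
-/

noncomputable section

set_option linter.unusedSectionVars false

namespace AffineDL

/-! ### Coordinates on `N` -/

section Coordinates

variable {K : Type*} [Field K] {h : ℕ} [NeZero h]

lemma natCast_h_pos : (0 : ℤ) < h := by exact_mod_cast Nat.pos_of_ne_zero (NeZero.ne h)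

lemma eCoeff_mul_add (v : NSpace K h) (c : ℤ) (r : Fin h) :
    eCoeff v (c * h + (r : ℕ)) = (v r).coeff c := by
  have hh := natCast_h_pos (h := h)
  have hr : ((r : ℕ) : ℤ) < h := by exact_mod_cast r.2
  have h0 : (0 : ℤ) ≤ ((r : ℕ) : ℤ) := by positivity
  have h1 : (c * h + (r : ℕ)) % (h : ℤ) = (r : ℕ) := by
    rw [add_comm, Int.add_mul_emod_self_right, Int.emod_eq_of_lt h0 hr]
  have h2 : (c * h + (r : ℕ)) / (h : ℤ) = c := by
    rw [add_comm, Int.add_mul_ediv_right _ _ hh.ne', Int.ediv_eq_zero_of_lt h0 hr, zero_add]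
  unfold eCoeff
  rw [h1, h2]
  congr 2
  simp

variable (h) in
lemma exists_index (i : ℤ) : ∃ (c : ℤ) (r : Fin h), i = c * h + (r : ℕ) := by
  have hh := natCast_h_pos (h := h)
  have h0 := Int.emod_nonneg i hh.ne'
  refine ⟨i / h, ⟨(i % h).toNat, ?_⟩, ?_⟩
  · have := Int.emod_lt_of_pos i hh
    omega
  · have := Int.mul_ediv_add_emod i h
    simp only [Int.toNat_of_nonneg h0]
    linarith [mul_comm (i / (h : ℤ)) h]

lemma eCoeff_eq (v : NSpace K h) (i : ℤ) :
    eCoeff v i = (v (Fin.ofNat h (i % h).toNat)).coeff (i / h) := rfl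

@[simp] lemma eCoeff_zero (i : ℤ) : eCoeff (0 : NSpace K h) i = 0 := by simp [eCoeff]

@[simp] lemma eCoeff_add (v w : NSpace K h) (i : ℤ) :
    eCoeff (v + w) i = eCoeff v i + eCoeff w i := by simp [eCoeff]

@[simp] lemma eCoeff_sub (v w : NSpace K h) (i : ℤ) :
    eCoeff (v - w) i = eCoeff v i - eCoeff w i := by simp [eCoeff]

@[simp] lemma eCoeff_smul (c : K) (v : NSpace K h) (i : ℤ) :
    eCoeff (c • v) i = c * eCoeff v i := by simp [eCoeff]

lemma eCoeff_ext {v w : NSpace K h} (hvw : ∀ i, eCoeff v i = eCoeff w i) : v = w := by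
  funext r
  ext c
  rw [← eCoeff_mul_add, ← eCoeff_mul_add, hvw]

/-- The coefficient of `e_i` as a linear form. -/
def eCoeffₗ (i : ℤ) : NSpace K h →ₗ[K] K where
  toFun v := eCoeff v i
  map_add' v w := eCoeff_add v w i
  map_smul' c v := eCoeff_smul c v i

@[simp] lemma eCoeff_sum {ι : Type*} (s : Finset ι) (f : ι → NSpace K h) (i : ℤ) :
    eCoeff (∑ j ∈ s, f j) i = ∑ j ∈ s, eCoeff (f j) i := map_sum (eCoeffₗ i) f s

/-- Every family of coefficients that vanishes below some index is the family of coefficients of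
a vector. -/
lemma exists_eCoeff (f : ℤ → K) (a : ℤ) (hf : ∀ i < a, f i = 0) :
    ∃ v : NSpace K h, ∀ i, eCoeff v i = f i := by
  have hh := natCast_h_pos (h := h)
  have hbdd : ∀ r : Fin h, BddBelow (Function.support fun c : ℤ => f (c * h + (r : ℕ))) := by
    refine fun r => ⟨a / h - 1, fun c hc => ?_⟩
    by_contra hlt
    push Not at hlt
    refine hc (hf _ ?_)
    have hr : ((r : ℕ) : ℤ) < h := by exact_mod_cast r.2
    have h1 := Int.mul_ediv_add_emod a h
    have h2 := Int.emod_nonneg a hh.ne'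
    have h3 : (c + 1) * h ≤ (a / h - 1) * h := by
      apply mul_le_mul_of_nonneg_right _ hh.le
      omega
    nlinarith
  refine ⟨fun r => HahnSeries.ofSuppBddBelow _ (hbdd r), fun i => ?_⟩
  obtain ⟨c, r, rfl⟩ := exists_index h i
  rw [eCoeff_mul_add, HahnSeries.coeff_ofSuppBddBelow]

lemma exists_forall_lt_eCoeff_eq_zero (v : NSpace K h) : ∃ a : ℤ, ∀ i < a, eCoeff v i = 0 := by
  have hh := natCast_h_pos (h := h)
  have : ∀ r : Fin h, ∃ c : ℤ, ∀ i < c, (v r).coeff i = 0 := fun r =>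
    ⟨(v r).order, fun i hi => HahnSeries.coeff_eq_zero_of_lt_order hi⟩
  choose c hc using this
  obtain ⟨B, hB⟩ := (Set.finite_range c).bddBelow
  refine ⟨B * h, fun i hi => ?_⟩
  obtain ⟨d, r, rfl⟩ := exists_index h i
  rw [eCoeff_mul_add]
  apply hc
  refine lt_of_lt_of_le ?_ (hB ⟨r, rfl⟩)
  have : (0 : ℤ) ≤ ((r : ℕ) : ℤ) := by positivity
  have h3 : d * h < B * h := by linarith
  exact lt_of_mul_lt_mul_right h3 hh.le

/-- Multiplication by `t ^ c` shifts the coefficients by `c h`. -/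
lemma eCoeff_single_smul (c : ℤ) (v : NSpace K h) (i : ℤ) :
    eCoeff (HahnSeries.single c (1 : K) • v) i = eCoeff v (i - c * h) := by
  obtain ⟨d, r, rfl⟩ := exists_index h i
  rw [show d * h + ((r : ℕ) : ℤ) - c * h = (d - c) * h + (r : ℕ) by ring, eCoeff_mul_add,
    eCoeff_mul_add, Pi.smul_apply, smul_eq_mul, HahnSeries.coeff_single_mul, one_mul]

lemma powerSeries_smul_apply (f : PowerSeries K) (v : NSpace K h) (r : Fin h) :
    (f • v) r = HahnSeries.ofPowerSeries ℤ K f * v r := by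
  rw [Pi.smul_apply, Algebra.smul_def]; rfl

lemma X_pow_smul (j : ℕ) (v : NSpace K h) :
    (PowerSeries.X ^ j : PowerSeries K) • v = HahnSeries.single (j : ℤ) (1 : K) • v := by
  funext r
  rw [powerSeries_smul_apply, HahnSeries.ofPowerSeries_X_pow, Pi.smul_apply, smul_eq_mul]

lemma eCoeff_X_pow_smul (j : ℕ) (v : NSpace K h) (i : ℤ) :
    eCoeff ((PowerSeries.X ^ j : PowerSeries K) • v) i = eCoeff v (i - j * h) := by
  rw [X_pow_smul, eCoeff_single_smul]

lemma eCoeff_X_smul (v : NSpace K h) (i : ℤ) :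
    eCoeff ((PowerSeries.X : PowerSeries K) • v) i = eCoeff v (i - h) := by
  have := eCoeff_X_pow_smul 1 v i
  simpa using this

lemma C_smul (c : K) (v : NSpace K h) : (PowerSeries.C c : PowerSeries K) • v = c • v := by
  funext r
  rw [powerSeries_smul_apply, HahnSeries.ofPowerSeries_C, Pi.smul_apply]
  exact HahnSeries.C_mul_eq_smul

instance : IsScalarTower K (PowerSeries K) (NSpace K h) where
  smul_assoc c f v := by
    rw [← C_smul, PowerSeries.smul_eq_C_mul, mul_smul]

lemma eCoeff_eq_zero_of_powerSeries_smul (f : PowerSeries K) {v : NSpace K h} {a : ℤ}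
    (hv : ∀ i < a, eCoeff v i = 0) : ∀ i < a, eCoeff (f • v) i = 0 := by
  intro i hi
  obtain ⟨d, r, rfl⟩ := exists_index h i
  rw [eCoeff_mul_add, powerSeries_smul_apply, HahnSeries.coeff_mul]
  refine Finset.sum_eq_zero fun x hx => ?_
  rw [Finset.mem_antidiagonal] at hx
  obtain ⟨h1, h2, h3⟩ := hx
  have hx1 : 0 ≤ x.1 := by
    by_contra hlt
    apply h1
    rw [PowerSeries.coeff_coe, if_pos (by omega)]
  have hh := natCast_h_pos (h := h)
  have : (v r).coeff x.2 = 0 := by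
    rw [← eCoeff_mul_add]
    apply hv
    refine lt_of_le_of_lt ?_ hi
    have : x.2 * (h : ℤ) ≤ d * h := mul_le_mul_of_nonneg_right (by omega) hh.le
    linarith
  rw [this, mul_zero]

variable (K h) in
/-- The `O_L`-submodule of all vectors with vanishing coefficients of `e_i` for `i < a`. -/
def fil (a : ℤ) : OSubmodule K h where
  carrier := {v | ∀ i < a, eCoeff v i = 0}
  add_mem' {v w} hv hw i hi := by rw [eCoeff_add, hv i hi, hw i hi, add_zero]
  zero_mem' i _ := eCoeff_zero i
  smul_mem' f _ hv := eCoeff_eq_zero_of_powerSeries_smul f hv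

lemma mem_fil {a : ℤ} {v : NSpace K h} : v ∈ fil K h a ↔ ∀ i < a, eCoeff v i = 0 := Iff.rfl

lemma fil_anti {a b : ℤ} (hab : a ≤ b) : fil K h b ≤ fil K h a :=
  fun _ hv i hi => hv i (hi.trans_le hab)

lemma eCoeff_eVec (j i : ℤ) : eCoeff (eVec K h j) i = if i = j then 1 else 0 := by
  have hh := natCast_h_pos (h := h)
  obtain ⟨d, r, rfl⟩ := exists_index h i
  obtain ⟨c, s, rfl⟩ := exists_index h j
  have key : ∀ (c : ℤ) (s : Fin h), (c * h + ((s : ℕ) : ℤ)) % (h : ℤ) = (s : ℕ) ∧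
      (c * h + ((s : ℕ) : ℤ)) / (h : ℤ) = c := by
    intro c s
    have hr : ((s : ℕ) : ℤ) < h := by exact_mod_cast s.2
    have h0 : (0 : ℤ) ≤ ((s : ℕ) : ℤ) := by positivity
    constructor
    · rw [add_comm, Int.add_mul_emod_self_right, Int.emod_eq_of_lt h0 hr]
    · rw [add_comm, Int.add_mul_ediv_right _ _ hh.ne', Int.ediv_eq_zero_of_lt h0 hr, zero_add]
  rw [eCoeff_mul_add, eVec, (key c s).1, (key c s).2]
  by_cases hrs : r = s
  · subst hrs
    simp only [if_true, HahnSeries.coeff_single]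
    simp only [add_left_inj, mul_left_inj' hh.ne']
    congr
  · rw [if_neg (by exact_mod_cast fun e => hrs (Fin.ext e)), HahnSeries.coeff_zero, if_neg]
    intro e
    have := (key d r).1
    rw [e, (key c s).1] at this
    exact hrs (Fin.ext (by exact_mod_cast this.symm))

lemma tLattice_eq_fil (c : ℤ) : tLattice K h c = fil K h (c * h) := by
  apply le_antisymm
  · rw [tLattice, Submodule.span_le]
    rintro _ ⟨j, rfl⟩ i hi
    rw [eCoeff_eVec, if_neg]
    have : (0 : ℤ) ≤ ((j : ℕ) : ℤ) := by positivity
    omega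
  · intro v hv
    have hc : ∀ r : Fin h, ∃ f : PowerSeries K,
        v r = HahnSeries.single c (1 : K) * HahnSeries.ofPowerSeries ℤ K f := by
      intro r
      refine ⟨PowerSeries.mk fun n => (v r).coeff (c + n), ?_⟩
      ext d
      rw [HahnSeries.coeff_single_mul, one_mul, PowerSeries.coeff_coe]
      split_ifs with hd
      · rw [← eCoeff_mul_add]
        apply hv
        have hr : ((r : ℕ) : ℤ) < h := by exact_mod_cast r.2
        have : (d + 1) * (h : ℤ) ≤ c * h :=
          mul_le_mul_of_nonneg_right (by omega) natCast_h_pos.le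
        linarith
      · rw [PowerSeries.coeff_mk]
        congr 1
        omega
    choose f hf using hc
    have : v = ∑ j : Fin h, f j • eVec K h (c * h + ((j : ℕ) : ℤ)) := by
      funext r
      rw [Finset.sum_apply, Finset.sum_eq_single r]
      · rw [powerSeries_smul_apply, hf r, mul_comm]
        congr 1
        ext d
        rw [← eCoeff_mul_add, eCoeff_eVec, HahnSeries.coeff_single]
        simp only [add_left_inj, mul_left_inj' (natCast_h_pos (h := h)).ne']
        congr
      · intro s _ hs
        rw [powerSeries_smul_apply]
        convert mul_zero _
        ext d
        rw [← eCoeff_mul_add, eCoeff_eVec, if_neg, HahnSeries.coeff_zero]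
        intro e
        have h1 : (r : ℕ) = (s : ℕ) := by
          have e' := congrArg (· % (h : ℤ)) e
          have hr : ((r : ℕ) : ℤ) < h := by exact_mod_cast r.2
          have hs : ((s : ℕ) : ℤ) < h := by exact_mod_cast s.2
          simp only [add_comm (_ * _), Int.add_mul_emod_self_right] at e'
          rw [Int.emod_eq_of_lt (by positivity) hr, Int.emod_eq_of_lt (by positivity) hs] at e'
          exact_mod_cast e'
        exact hs (Fin.ext h1.symm)
      · simp
    rw [this]
    exact Submodule.sum_mem _ fun j _ =>
      Submodule.smul_mem _ _ (Submodule.subset_span ⟨j, rfl⟩)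

end Coordinates

section Frobenius

variable {k K : Type*} [Field k] [Fintype k] [Field K] [Algebra k K] {h : ℕ} [NeZero h]

lemma sigmaL_coeff (f : LaurentSeries K) (i : ℤ) :
    (sigmaL k K f).coeff i = f.coeff i ^ Fintype.card k := by
  rfl

lemma add_pow_card (x y : K) :
    (x + y) ^ Fintype.card k = x ^ Fintype.card k + y ^ Fintype.card k :=
  map_add (FiniteField.frobeniusAlgHom k K) x y

lemma sum_pow_card {ι : Type*} (s : Finset ι) (f : ι → K) :
    (∑ i ∈ s, f i) ^ Fintype.card k = ∑ i ∈ s, f i ^ Fintype.card k :=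
  map_sum (FiniteField.frobeniusAlgHom k K) f s

lemma sub_pow_card (x y : K) :
    (x - y) ^ Fintype.card k = x ^ Fintype.card k - y ^ Fintype.card k :=
  map_sub (FiniteField.frobeniusAlgHom k K) x y

variable (k) in
lemma exists_pow_card_eq [IsAlgClosed K] (x : K) : ∃ y : K, y ^ Fintype.card k = x :=
  IsAlgClosed.exists_pow_nat_eq x Fintype.card_pos

lemma eCoeff_bMatrix_mulVec (m : ℕ) (v : NSpace K h) (i : ℤ) :
    eCoeff ((bMatrix K m h).mulVec v) i = eCoeff v (i - m) := by
  obtain ⟨d, r, rfl⟩ := exists_index h i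
  obtain ⟨c, s, hcs⟩ := exists_index h (d * h + ((r : ℕ) : ℤ) - m)
  rw [eCoeff_mul_add, hcs, eCoeff_mul_add, Matrix.mulVec, dotProduct,
    HahnSeries.coeff_sum, Finset.sum_eq_single s]
  · have : bMatrix K m h r s = HahnSeries.single (d - c) (1 : K) := by
      ext j
      rw [bMatrix, Matrix.of_apply, ← eCoeff_mul_add, eCoeff_eVec, HahnSeries.coeff_single]
      have hh := natCast_h_pos (h := h)
      congr 1
      rw [eq_iff_iff]
      constructor
      · intro e
        have : j * (h : ℤ) = (d - c) * h := by linarith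
        exact mul_right_cancel₀ hh.ne' this
      · rintro rfl
        linarith
    rw [this, HahnSeries.coeff_single_mul, one_mul]
    congr 1
    ring
  · intro x _ hx
    have : bMatrix K m h r x = 0 := by
      ext j
      rw [bMatrix, Matrix.of_apply, ← eCoeff_mul_add, eCoeff_eVec, if_neg, HahnSeries.coeff_zero]
      intro e
      have e2 : ((x : ℕ) : ℤ) = (s : ℕ) + (c - d + j) * h := by linarith
      have e' := congrArg (· % (h : ℤ)) e2
      have hr : ((x : ℕ) : ℤ) < h := by exact_mod_cast x.2
      have hs : ((s : ℕ) : ℤ) < h := by exact_mod_cast s.2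
      simp only [Int.add_mul_emod_self_right] at e'
      rw [Int.emod_eq_of_lt (by positivity) hr, Int.emod_eq_of_lt (by positivity) hs] at e'
      exact hx (Fin.ext (by exact_mod_cast e'))
    rw [this, zero_mul, HahnSeries.coeff_zero]
  · simp

/-- The operator `bσ` raises coefficients to the `q`-th power and shifts them by `m`. -/
lemma eCoeff_bSigma (m : ℕ) (v : NSpace K h) (i : ℤ) :
    eCoeff (bSigma k m v) i = eCoeff v (i - m) ^ Fintype.card k := by
  rw [bSigma, eCoeff_bMatrix_mulVec, eCoeff_eq, sigmaL_coeff]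
  rfl

/-- The operator `t ^ (-e) bσ` in coordinates. -/
lemma eCoeff_single_smul_bSigma (m e : ℕ) (v : NSpace K h) (i : ℤ) :
    eCoeff (HahnSeries.single (-(e : ℤ)) (1 : K) • bSigma k m v) i =
      eCoeff v (i + e * h - m) ^ Fintype.card k := by
  rw [eCoeff_single_smul, eCoeff_bSigma]
  congr 2
  ring

end Frobenius

/-! ### Leading indices and dimensions -/

section Lead

variable {K : Type*} [Field K] {h : ℕ} [NeZero h]

/-- `e_a` is the first basis vector that occurs in `v`. -/
def IsLead (v : NSpace K h) (a : ℤ) : Prop := eCoeff v a ≠ 0 ∧ ∀ i < a, eCoeff v i = 0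

lemma IsLead.ne_zero {v : NSpace K h} {a : ℤ} (hv : IsLead v a) : v ≠ 0 := by
  rintro rfl
  exact hv.1 (eCoeff_zero a)

lemma exists_isLead {v : NSpace K h} (hv : v ≠ 0) : ∃ a, IsLead v a := by
  obtain ⟨B, hB⟩ := exists_forall_lt_eCoeff_eq_zero v
  have hex : ∃ i, eCoeff v i ≠ 0 := by
    by_contra hcon
    push Not at hcon
    exact hv (eCoeff_ext fun i => by rw [hcon i, eCoeff_zero])
  obtain ⟨a, ha, hmin⟩ := Int.exists_least_of_bdd (P := fun i => eCoeff v i ≠ 0)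
    ⟨B, fun i hi => by by_contra hlt; exact hi (hB i (by omega))⟩ hex
  exact ⟨a, ha, fun i hi => by by_contra hne; exact absurd (hmin i hne) (by omega)⟩

lemma IsLead.leadIndex_eq {v : NSpace K h} {a : ℤ} (hv : IsLead v a) : leadIndex v = a := by
  have : IsLeast {i : ℤ | eCoeff v i ≠ 0} a :=
    ⟨hv.1, fun i hi => by by_contra hlt; exact hi (hv.2 i (by omega))⟩
  exact this.csInf_eq

lemma ne_zero_and_leadIndex_eq_iff {v : NSpace K h} {a : ℤ} :
    v ≠ 0 ∧ leadIndex v = a ↔ IsLead v a := by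
  constructor
  · rintro ⟨hv, rfl⟩
    obtain ⟨a, ha⟩ := exists_isLead hv
    rwa [ha.leadIndex_eq]
  · exact fun hv => ⟨hv.ne_zero, hv.leadIndex_eq⟩

lemma isLead_X_smul {v : NSpace K h} {a : ℤ} :
    IsLead ((PowerSeries.X : PowerSeries K) • v) (a + h) ↔ IsLead v a := by
  simp only [IsLead, eCoeff_X_smul, add_sub_cancel_right]
  refine and_congr_right fun _ => ⟨fun H i hi => ?_, fun H i hi => H _ (by omega)⟩
  have := H (i + h) (by omega)
  rwa [add_sub_cancel_right] at this

/-- The set of leading indices of the vectors in `S`. -/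
def leadSet (S : Set (NSpace K h)) : Set ℤ := {a | ∃ v ∈ S, IsLead v a}

lemma leadSet_mono {S T : Set (NSpace K h)} (hST : S ⊆ T) : leadSet S ⊆ leadSet T :=
  fun _ ⟨v, hv, ha⟩ => ⟨v, hST hv, ha⟩

lemma latticeA_eq (M : OSubmodule K h) : latticeA M = leadSet (M : Set (NSpace K h)) := by
  ext a
  simp only [latticeA, leadSet, Set.mem_ofPred_eq, ne_zero_and_leadIndex_eq_iff, SetLike.mem_coe]

lemma exists_isLead_eVec (a : ℤ) : IsLead (eVec K h a) a :=
  ⟨by simp [eCoeff_eVec], fun i hi => by rw [eCoeff_eVec, if_neg hi.ne]⟩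

lemma leadSet_fil (a : ℤ) : leadSet (fil K h a : Set (NSpace K h)) = Set.Ici a := by
  ext b
  constructor
  · rintro ⟨v, hv, hb⟩
    by_contra hlt
    exact hb.1 (hv b (by simpa using hlt))
  · intro hb
    exact ⟨eVec K h b, fun i hi => (exists_isLead_eVec b).2 i (hi.trans_le hb),
      exists_isLead_eVec b⟩

/-- The elements of `V` whose image under `f` vanishes. -/
def kerSet {E : Type*} [AddCommGroup E] [Module K E] (V : Submodule K (NSpace K h))
    (f : V →ₗ[K] E) : Set (NSpace K h) := {v | ∃ hv : v ∈ V, f ⟨v, hv⟩ = 0}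

/-- Cancelling the leading coefficient of `v` by a vector with the same leading index. -/
lemma exists_eCoeff_sub_smul_eq_zero {v u : NSpace K h} {b : ℤ} (hv : ∀ i < b, eCoeff v i = 0)
    (hu : IsLead u b) : ∃ c : K, ∀ i < b + 1, eCoeff (v - c • u) i = 0 := by
  refine ⟨eCoeff v b / eCoeff u b, fun i hi => ?_⟩
  rw [eCoeff_sub, eCoeff_smul]
  rcases (Int.lt_add_one_iff.mp hi).lt_or_eq with hlt | rfl
  · rw [hv i hlt, hu.2 i hlt, mul_zero, sub_zero]
  · rw [div_mul_cancel₀ _ hu.1, sub_self]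

/-- The number of leading indices that are lost on passing to the kernel of a linear map is the
rank of the map: vectors with these leading indices are a basis of `V` modulo the kernel. -/
lemma ncard_leadSet_diff {E : Type*} [AddCommGroup E] [Module K E] (V : Submodule K (NSpace K h))
    (f : V →ₗ[K] E) {a R : ℤ} (hV : ∀ v ∈ V, ∀ i < a, eCoeff v i = 0)
    (hR : ∀ v : V, (∀ i < R, eCoeff (v : NSpace K h) i = 0) → f v = 0) :
    (leadSet (V : Set (NSpace K h)) \ leadSet (kerSet V f)).Finite ∧
    FiniteDimensional K (LinearMap.range f) ∧
    (leadSet (V : Set (NSpace K h)) \ leadSet (kerSet V f)).ncard =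
      Module.finrank K (LinearMap.range f) := by
  classical
  set D := leadSet (V : Set (NSpace K h)) \ leadSet (kerSet V f) with hD
  have hfin : D.Finite := by
    refine (Set.finite_Ico a R).subset ?_
    rintro b ⟨⟨v, hv, hb⟩, hnot⟩
    refine ⟨?_, ?_⟩
    · by_contra hlt
      exact hb.1 (hV v hv b (by omega))
    · by_contra hle
      exact hnot ⟨v, ⟨hv, hR ⟨v, hv⟩ fun i hi => hb.2 i (by omega)⟩, hb⟩
  have hch : ∀ b : D, ∃ v : V, IsLead (v : NSpace K h) b := by
    rintro ⟨b, ⟨v, hv, hb⟩, -⟩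
    exact ⟨⟨v, hv⟩, hb⟩
  choose w hw using hch
  have : Fintype D := hfin.fintype
  -- a vanishing combination of the `f (w b)` would put the least leading index that occurs in it
  -- into the set of leading indices of the kernel
  have hli : LinearIndependent K fun b : D => f (w b) := by
    rw [linearIndependent_iff']
    intro s g hg
    by_contra hcon
    push Not at hcon
    have hne : (s.filter fun b => g b ≠ 0).Nonempty := by
      obtain ⟨i, hi, hgi⟩ := hcon
      exact ⟨i, Finset.mem_filter.2 ⟨hi, hgi⟩⟩
    obtain ⟨b, hb, hmin⟩ := Finset.exists_min_image _ (fun b : D => (b : ℤ)) hne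
    rw [Finset.mem_filter] at hb
    refine b.2.2 ⟨((∑ i ∈ s, g i • w i : V) : NSpace K h), ⟨Subtype.prop _, ?_⟩, ?_, ?_⟩
    · rw [Subtype.coe_eta, map_sum]
      simpa only [map_smul] using hg
    · simp only [Submodule.coe_sum, Submodule.coe_smul, eCoeff_sum, eCoeff_smul]
      rw [Finset.sum_eq_single b]
      · exact mul_ne_zero hb.2 (hw b).1
      · intro i hi hib
        by_cases hgi : g i = 0
        · rw [hgi, zero_mul]
        · have h1 := hmin i (Finset.mem_filter.2 ⟨hi, hgi⟩)
          have h2 : (b : ℤ) ≠ i := fun e => hib (Subtype.ext e.symm)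
          rw [(hw i).2 b (lt_of_le_of_ne h1 h2), mul_zero]
      · exact fun hbs => absurd hb.1 hbs
    · intro j hj
      simp only [Submodule.coe_sum, Submodule.coe_smul, eCoeff_sum, eCoeff_smul]
      refine Finset.sum_eq_zero fun i hi => ?_
      by_cases hgi : g i = 0
      · rw [hgi, zero_mul]
      · have h1 := hmin i (Finset.mem_filter.2 ⟨hi, hgi⟩)
        rw [(hw i).2 j (hj.trans_le h1), mul_zero]
  have hspan : LinearMap.range f = Submodule.span K (Set.range fun b : D => f (w b)) := by
    apply le_antisymm
    -- induction on the order of vanishing of `v`, downwards from `R`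
    · have key : ∀ (n : ℕ) (v : V), (∀ i < R - n, eCoeff (v : NSpace K h) i = 0) →
          f v ∈ Submodule.span K (Set.range fun b : D => f (w b)) := by
        intro n
        induction n with
        | zero =>
          intro v hv
          rw [hR v (by simpa using hv)]
          exact Submodule.zero_mem _
        | succ n ih =>
          intro v hv
          set b : ℤ := R - (n + 1 : ℕ) with hbdef
          have hb1 : b + 1 = R - n := by push_cast [hbdef]; ring
          by_cases hvb : eCoeff (v : NSpace K h) b = 0
          · refine ih v fun i hi => ?_
            rcases (show i ≤ b by omega).lt_or_eq with hlt | rfl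
            · exact hv i hlt
            · exact hvb
          · have hlead : IsLead (v : NSpace K h) b := ⟨hvb, hv⟩
            by_cases hbk : b ∈ leadSet (kerSet V f)
            · obtain ⟨u, ⟨huV, hu⟩, hub⟩ := hbk
              obtain ⟨c, hc⟩ := exists_eCoeff_sub_smul_eq_zero hv hub
              have := ih (v - c • ⟨u, huV⟩) (fun i hi => hc i (by omega))
              rwa [map_sub, map_smul, hu, smul_zero, sub_zero] at this
            · obtain ⟨c, hc⟩ := exists_eCoeff_sub_smul_eq_zero hv
                (hw ⟨b, ⟨v, v.2, hlead⟩, hbk⟩)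
              have h1 := ih (v - c • w ⟨b, ⟨v, v.2, hlead⟩, hbk⟩) (fun i hi => hc i (by omega))
              rw [map_sub, map_smul] at h1
              have h2 := Submodule.smul_mem _ c (Submodule.subset_span
                (s := Set.range fun b : D => f (w b)) ⟨⟨b, ⟨v, v.2, hlead⟩, hbk⟩, rfl⟩)
              simpa using Submodule.add_mem _ h1 h2
      rintro _ ⟨v, rfl⟩
      refine key (R - a).toNat v fun i hi => hV v v.2 i ?_
      have := Int.self_le_toNat (R - a)
      omega
    · rw [Submodule.span_le]
      rintro _ ⟨b, rfl⟩
      exact ⟨_, rfl⟩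
  refine ⟨hfin, ?_, ?_⟩
  · rw [hspan]
    exact FiniteDimensional.span_of_finite K (Set.finite_range _)
  · rw [hspan, finrank_span_eq_card hli, ← Nat.card_coe_set_eq, Nat.card_eq_fintype_card]

/-- A subspace that contains all vectors of `V` with large leading index, and that has all leading
indices of `V`, contains `V`. -/
lemma le_of_leadSet_subset {V V' : Submodule K (NSpace K h)} (hle : V' ≤ V) {R : ℤ}
    (hR : ∀ v ∈ V, (∀ i < R, eCoeff v i = 0) → v ∈ V')
    (hlead : leadSet (V : Set (NSpace K h)) ⊆ leadSet (V' : Set (NSpace K h))) : V ≤ V' := by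
  -- induction on the order of vanishing of `v`, downwards from `R`
  have key : ∀ (n : ℕ), ∀ v ∈ V, (∀ i < R - n, eCoeff v i = 0) → v ∈ V' := by
    intro n
    induction n with
    | zero => exact fun v hvV hv => hR v hvV (by simpa using hv)
    | succ n ih =>
      intro v hvV hv
      set b : ℤ := R - (n + 1 : ℕ) with hbdef
      have hb1 : b + 1 = R - n := by push_cast [hbdef]; ring
      by_cases hvb : eCoeff v b = 0
      · refine ih v hvV fun i hi => ?_
        rcases (show i ≤ b by omega).lt_or_eq with hlt | rfl
        · exact hv i hlt
        · exact hvb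
      · obtain ⟨u, hu, hub⟩ := hlead ⟨v, hvV, hvb, hv⟩
        obtain ⟨c, hc⟩ := exists_eCoeff_sub_smul_eq_zero hv hub
        have h1 := ih (v - c • u) (V.sub_mem hvV (V.smul_mem c (hle hu)))
          (fun i hi => hc i (by omega))
        simpa using V'.add_mem h1 (V'.smul_mem c hu)
  intro v hv
  obtain ⟨a, ha⟩ := exists_forall_lt_eCoeff_eq_zero v
  refine key (R - a).toNat v hv fun i hi => ha i ?_
  have := Int.self_le_toNat (R - a)
  omega

end Lead

/-! ### The submodules `L_e(M)` and the function `φ(M)` -/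

section Level

variable (k : Type*) {K : Type*} [Field k] [Fintype k] [Field K] [Algebra k K] (m : ℕ) {h : ℕ}
  [NeZero h]

/-- The operator `t ^ (-e) bσ`. -/
def tbSigma (e : ℕ) (v : NSpace K h) : NSpace K h :=
  HahnSeries.single (-(e : ℤ)) (1 : K) • bSigma k m v

variable {m} in
@[simp] lemma eCoeff_tbSigma (e : ℕ) (v : NSpace K h) (i : ℤ) :
    eCoeff (tbSigma k m e v) i = eCoeff v (i + e * h - m) ^ Fintype.card k :=
  eCoeff_single_smul_bSigma m e v i

variable {m} in
lemma tbSigma_add (e : ℕ) (v w : NSpace K h) :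
    tbSigma k m e (v + w) = tbSigma k m e v + tbSigma k m e w :=
  eCoeff_ext fun i => by simp [add_pow_card]

variable {m} in
lemma tbSigma_smul (e : ℕ) (c : K) (v : NSpace K h) :
    tbSigma k m e (c • v) = c ^ Fintype.card k • tbSigma k m e v :=
  eCoeff_ext fun i => by simp [mul_pow]

variable {m} in
lemma tbSigma_X_smul (e : ℕ) (v : NSpace K h) :
    tbSigma k m (e + 1) ((PowerSeries.X : PowerSeries K) • v) = tbSigma k m e v :=
  eCoeff_ext fun i => by
    rw [eCoeff_tbSigma, eCoeff_tbSigma, eCoeff_X_smul]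
    congr 2
    push_cast
    ring

variable {m} in
lemma X_smul_tbSigma (e : ℕ) (v : NSpace K h) :
    (PowerSeries.X : PowerSeries K) • tbSigma k m (e + 1) v = tbSigma k m e v :=
  eCoeff_ext fun i => by
    rw [eCoeff_X_smul, eCoeff_tbSigma, eCoeff_tbSigma]
    congr 2
    push_cast
    ring

variable {m} in
lemma isLead_tbSigma {e : ℕ} {v : NSpace K h} {a : ℤ} :
    IsLead (tbSigma k m e v) (a + m - e * h) ↔ IsLead v a := by
  have hq : Fintype.card k ≠ 0 := Fintype.card_ne_zero
  simp only [IsLead, eCoeff_tbSigma, ne_eq, pow_eq_zero_iff hq]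
  rw [show a + (m : ℤ) - e * h + e * h - m = a by ring]
  refine and_congr_right fun _ => ⟨fun H i hi => ?_, fun H i hi => H _ (by omega)⟩
  have := H (i + m - e * h) (by omega)
  rwa [show i + (m : ℤ) - e * h + e * h - m = i by ring] at this

variable {m} in
/-- Over a perfect field `t ^ (-e) bσ` is surjective. -/
lemma exists_tbSigma_eq [IsAlgClosed K] (e : ℕ) (w : NSpace K h) : ∃ v, tbSigma k m e v = w := by
  have hq : Fintype.card k ≠ 0 := Fintype.card_ne_zero
  choose r hr using exists_pow_card_eq (K := K) k
  obtain ⟨a, ha⟩ := exists_forall_lt_eCoeff_eq_zero w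
  obtain ⟨v, hv⟩ := exists_eCoeff (h := h) (fun i => r (eCoeff w (i - e * h + m)))
    (a + e * h - m) (fun i hi => by
      have := hr (eCoeff w (i - e * h + m))
      rw [ha _ (by omega)] at this ⊢
      exact (pow_eq_zero_iff hq).1 this)
  refine ⟨v, eCoeff_ext fun i => ?_⟩
  rw [eCoeff_tbSigma, hv, hr]
  congr 1
  ring

/-- The vectors `v ∈ V` with `t ^ (-e) bσ(v) ∈ V`. -/
def level (e : ℕ) (V : Submodule K (NSpace K h)) : Submodule K (NSpace K h) where
  carrier := {v | v ∈ V ∧ tbSigma k m e v ∈ V}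
  add_mem' hv hw := ⟨V.add_mem hv.1 hw.1, by
    rw [tbSigma_add]; exact V.add_mem hv.2 hw.2⟩
  zero_mem' := ⟨V.zero_mem, by
    have : tbSigma k m e (0 : NSpace K h) = 0 := eCoeff_ext fun i => by
      have hq : Fintype.card k ≠ 0 := Fintype.card_ne_zero
      simp [hq]
    rw [this]; exact V.zero_mem⟩
  smul_mem' c v hv := ⟨V.smul_mem c hv.1, by
    rw [tbSigma_smul]; exact V.smul_mem _ hv.2⟩

variable {k m} in
lemma mem_level {e : ℕ} {V : Submodule K (NSpace K h)} {v : NSpace K h} :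
    v ∈ level k m e V ↔ v ∈ V ∧ tbSigma k m e v ∈ V := Iff.rfl

/-- Shorthand for an `O_L`-submodule considered as a subspace. -/
abbrev asSub (M : OSubmodule K h) : Submodule K (NSpace K h) := M.restrictScalars K

variable {k m} in
lemma level_succ_le (e : ℕ) (M : OSubmodule K h) :
    level k m (e + 1) (asSub M) ≤ level k m e (asSub M) := by
  rintro v ⟨h1, h2⟩
  refine ⟨h1, ?_⟩
  rw [← X_smul_tbSigma]
  exact M.smul_mem _ h2

variable {k m} in
lemma level_anti (M : OSubmodule K h) : Antitone fun e => level k m e (asSub M) :=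
  antitone_nat_of_succ_le fun e => level_succ_le e M

variable {k m} in
/-- The condition `φ(M)(a) ≥ e` means that `a` is a leading index of `L_e(M)`. -/
lemma le_latticePhi_iff {M : OSubmodule K h} {a₀ : ℤ} (hM : M ≤ fil K h a₀) (a : ℤ) (e : ℕ) :
    (e : WithBot ℕ) ≤ latticePhi k m M a ↔
      a ∈ leadSet (level k m e (asSub M) : Set (NSpace K h)) := by
  have hh := natCast_h_pos (h := h)
  set S := {x : WithBot ℕ | ∃ n : ℕ, x = n ∧ ∃ v ∈ M, v ≠ 0 ∧ leadIndex v = a ∧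
      HahnSeries.single (-(n : ℤ)) (1 : K) • bSigma k m v ∈ M} with hS
  have hmem : ∀ n : ℕ, (n : WithBot ℕ) ∈ S ↔
      a ∈ leadSet (level k m n (asSub M) : Set (NSpace K h)) := by
    intro n
    constructor
    · rintro ⟨n', hn, v, hv, h0, hl, hb⟩
      obtain rfl : n = n' := by exact_mod_cast hn
      exact ⟨v, ⟨hv, hb⟩, ne_zero_and_leadIndex_eq_iff.1 ⟨h0, hl⟩⟩
    · rintro ⟨v, ⟨hv, hb⟩, hl⟩
      exact ⟨n, rfl, v, hv, hl.ne_zero, hl.leadIndex_eq, hb⟩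
  have hbd : ∀ x ∈ S, x ≤ (((a + m - a₀).toNat : ℕ) : WithBot ℕ) := by
    intro x hx
    obtain ⟨n, rfl, -⟩ := id hx
    obtain ⟨v, ⟨hv, hb⟩, hl⟩ := (hmem n).1 hx
    have h1 := (isLead_tbSigma k (m := m) (e := n)).2 hl
    have h2 : a₀ ≤ a + m - n * h := by
      by_contra hlt
      exact h1.1 (hM hb _ (by omega))
    have h3 : (n : ℤ) * 1 ≤ n * h := mul_le_mul_of_nonneg_left (by omega) (by positivity)
    have h4 : n ≤ (a + m - a₀).toNat := by omega
    exact_mod_cast h4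
  have hfin : S.Finite := by
    refine (Set.finite_range fun i : Fin ((a + m - a₀).toNat + 1) =>
      ((i : ℕ) : WithBot ℕ)).subset ?_
    intro x hx
    have h1 := hbd x hx
    obtain ⟨n, rfl, -⟩ := id hx
    have h2 : n ≤ (a + m - a₀).toNat := by exact_mod_cast h1
    exact ⟨⟨n, by omega⟩, rfl⟩
  by_cases haA : a ∈ latticeA M
  · rw [latticePhi, if_pos haA]
    constructor
    · intro hle
      have hne : S.Nonempty := by
        by_contra hem
        rw [Set.not_nonempty_iff_eq_empty] at hem
        rw [← hS, hem, csSup_empty] at hle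
        simp at hle
      have hmx := hne.csSup_mem hfin
      obtain ⟨n, hn, -⟩ := id hmx
      rw [hn] at hmx
      rw [← hS, hn] at hle
      have hen : e ≤ n := by exact_mod_cast hle
      exact leadSet_mono (level_anti M hen) ((hmem n).1 hmx)
    · intro hl
      exact le_csSup hfin.bddAbove ((hmem e).2 hl)
  · rw [latticePhi, if_neg haA]
    refine iff_of_false (by simp) ?_
    rintro ⟨v, ⟨hv, -⟩, hl⟩
    exact haA ⟨v, hv, hl.ne_zero, hl.leadIndex_eq⟩

end Level

/-! ### Lattices and elementary divisors -/

section Smith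

/-- Smith normal form of a square matrix over a principal ideal domain. -/
lemma exists_mul_diagonal_mul_of_det_ne_zero {R : Type*} [CommRing R] [IsDomain R]
    [IsPrincipalIdealRing R] {n : Type*} [Fintype n] [DecidableEq n] (X : Matrix n n R)
    (hX : X.det ≠ 0) :
    ∃ (P Q : (Matrix n n R)ˣ) (a : n → R), X = P.val * Matrix.diagonal a * Q.val := by
  have hinj : Function.Injective X.mulVecLin := by
    rw [← LinearMap.ker_eq_bot, LinearMap.ker_eq_bot']
    intro v hv
    by_contra hne
    exact hX (Matrix.exists_mulVec_eq_zero_iff.1 ⟨v, hne, hv⟩)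
  let e := LinearEquiv.ofInjective X.mulVecLin hinj
  obtain ⟨b', a, ab', hab⟩ := Submodule.exists_smith_normal_form_of_rank_eq (Pi.basisFun R n)
    (N := LinearMap.range X.mulVecLin) e.symm.finrank_eq
  let P := (Pi.basisFun R n).toMatrix b'
  let D := (Pi.basisFun R n).toMatrix (ab'.map e.symm)
  let _ := (Pi.basisFun R n).invertibleToMatrix b'
  let _ := (Pi.basisFun R n).invertibleToMatrix (ab'.map e.symm)
  have hXD : X * D = P * Matrix.diagonal a := by
    ext r i
    rw [Matrix.mul_diagonal]
    have h1 : X.mulVecLin (e.symm (ab' i)) = a i • b' i := by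
      rw [← hab]
      exact congrArg Subtype.val (e.apply_symm_apply (ab' i))
    have h2 := congrFun h1 r
    simp only [Matrix.mulVecLin_apply, Pi.smul_apply, smul_eq_mul] at h2
    simp only [P, D, Module.Basis.toMatrix_apply, Pi.basisFun_repr, Module.Basis.map_apply,
      Matrix.mul_apply]
    rw [mul_comm, ← h2]
    rfl
  refine ⟨unitOfInvertible P, unitOfInvertible (⅟D), a, ?_⟩
  change X = P * Matrix.diagonal a * ⅟D
  rw [← hXD, Matrix.mul_assoc, mul_invOf_self, Matrix.mul_one]

variable {K : Type*} [Field K] {h : ℕ}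

/-- The matrix `t ^ ν`. -/
abbrev tDiag (K : Type*) [Field K] {h : ℕ} (ν : Fin h → ℤ) :
    Matrix (Fin h) (Fin h) (LaurentSeries K) :=
  Matrix.diagonal fun i => HahnSeries.single (ν i) (1 : K)

/-- Entrywise inclusion of matrices over `O_L` into matrices over `L`. -/
abbrev toL (X : Matrix (Fin h) (Fin h) (PowerSeries K)) :
    Matrix (Fin h) (Fin h) (LaurentSeries K) :=
  X.map (HahnSeries.ofPowerSeries ℤ K)

lemma toL_mul (X Y : Matrix (Fin h) (Fin h) (PowerSeries K)) : toL (X * Y) = toL X * toL Y :=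
  Matrix.map_mul

lemma toL_one : toL (1 : Matrix (Fin h) (Fin h) (PowerSeries K)) = 1 :=
  Matrix.map_one _ (map_zero _) (map_one _)

lemma exists_units_mul_diagonal_perm {R n : Type*} [CommRing R] [Fintype n] [DecidableEq n]
    (P Q : (Matrix n n R)ˣ) (u : n → Rˣ) (d : n → R) (π : Equiv.Perm n) :
    ∃ P' Q' : (Matrix n n R)ˣ, P.val * Matrix.diagonal (fun i => (u i : R) * d i) * Q.val =
      P'.val * Matrix.diagonal (fun i => d (π i)) * Q'.val := by
  have hU : IsUnit (Matrix.diagonal fun i => (u i : R)) := by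
    rw [Matrix.isUnit_iff_isUnit_det, Matrix.det_diagonal]
    exact IsUnit.prod_univ_iff.2 fun i => (u i).isUnit
  have hP : IsUnit ((P.val * Matrix.diagonal fun i => (u i : R)).submatrix (Equiv.refl n) π) :=
    (Matrix.isUnit_submatrix_equiv _ _).2 (P.isUnit.mul hU)
  have hQ : IsUnit (Q.val.submatrix π (Equiv.refl n)) :=
    (Matrix.isUnit_submatrix_equiv _ _).2 Q.isUnit
  refine ⟨hP.unit, hQ.unit, ?_⟩
  have hdd : (Matrix.diagonal fun i => (u i : R) * d i) =
      (Matrix.diagonal fun i => (u i : R)) * Matrix.diagonal d :=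
    (Matrix.diagonal_mul_diagonal _ _).symm
  have hsub : (Matrix.diagonal fun i => d (π i)) = (Matrix.diagonal d).submatrix π π :=
    (Matrix.submatrix_diagonal_equiv d π).symm
  rw [IsUnit.unit_spec, IsUnit.unit_spec, hsub, Matrix.submatrix_mul_equiv,
    Matrix.submatrix_mul_equiv, hdd, ← Matrix.mul_assoc]
  rfl

/-- Cartan decomposition of an integral matrix, with elementary divisors in any given order. -/
lemma exists_cartan (X : Matrix (Fin h) (Fin h) (PowerSeries K)) (hX : X.det ≠ 0) :
    ∃ ν : Fin h → ℕ, ∀ π : Equiv.Perm (Fin h),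
      ∃ k₁ k₂ : Matrix.GeneralLinearGroup (Fin h) (PowerSeries K),
        toL X = toL k₁.val * tDiag K (fun i => ν (π i)) * toL k₂.val := by
  obtain ⟨P, Q, a, hPQ⟩ := exists_mul_diagonal_mul_of_det_ne_zero X hX
  have ha : ∀ i, a i ≠ 0 := by
    intro i hi
    apply hX
    rw [hPQ, Matrix.det_mul, Matrix.det_mul, Matrix.det_diagonal,
      Finset.prod_eq_zero (Finset.mem_univ i) hi, mul_zero, zero_mul]
  have hu : ∀ i, ∃ (n : ℕ) (u : (PowerSeries K)ˣ),
      a i = (u : PowerSeries K) * PowerSeries.X ^ n := fun i =>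
    IsDiscreteValuationRing.eq_unit_mul_pow_irreducible (ha i) PowerSeries.X_irreducible
  choose ν u hu using hu
  -- the units are absorbed into `k₁`, the permutation into `k₁` and `k₂`
  refine ⟨ν, fun π => ?_⟩
  obtain ⟨k₁, k₂, hk⟩ := exists_units_mul_diagonal_perm P Q u
    (fun i => (PowerSeries.X : PowerSeries K) ^ ν i) π
  have hd : tDiag K (fun i => (ν (π i) : ℤ)) =
      toL (Matrix.diagonal fun i => (PowerSeries.X : PowerSeries K) ^ ν (π i)) := by
    rw [toL, Matrix.diagonal_map (map_zero _)]
    exact congrArg Matrix.diagonal (funext fun i =>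
      (HahnSeries.ofPowerSeries_X_pow (R := K) (Γ := ℤ) (ν (π i))).symm)
  refine ⟨k₁, k₂, ?_⟩
  rw [hd, ← toL_mul, ← toL_mul, ← hk, hPQ, funext hu]

end Smith

section ColSpan

variable {K : Type*} [Field K] {h : ℕ}

/-- The `O_L`-span of the columns of a matrix. -/
def colSpan (G : Matrix (Fin h) (Fin h) (LaurentSeries K)) : OSubmodule K h :=
  Submodule.span (PowerSeries K) (Set.range G.col)

lemma latticeOf_eq_colSpan (g : Matrix.GeneralLinearGroup (Fin h) (LaurentSeries K)) :
    latticeOf g = colSpan g.val := rfl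

lemma mem_colSpan {G : Matrix (Fin h) (Fin h) (LaurentSeries K)} {v : NSpace K h} :
    v ∈ colSpan G ↔
      ∃ x : Fin h → PowerSeries K, v = G.mulVec fun i => HahnSeries.ofPowerSeries ℤ K (x i) := by
  rw [colSpan, Submodule.mem_span_range_iff_exists_fun]
  refine exists_congr fun x => ?_
  have : ∑ i, x i • G.col i = G.mulVec fun i => HahnSeries.ofPowerSeries ℤ K (x i) := by
    funext r
    simp only [Finset.sum_apply, Matrix.mulVec, dotProduct]
    refine Finset.sum_congr rfl fun i _ => ?_
    rw [Pi.smul_apply, Algebra.smul_def, mul_comm]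
    rfl
  rw [this, eq_comm]

lemma exists_ofPowerSeries_eq {x : LaurentSeries K} (hx : ∀ j < 0, x.coeff j = 0) :
    ∃ f : PowerSeries K, HahnSeries.ofPowerSeries ℤ K f = x := by
  refine ⟨PowerSeries.mk fun n => x.coeff n, ?_⟩
  ext d
  rw [PowerSeries.coeff_coe]
  split_ifs with hd
  · exact (hx d hd).symm
  · rw [PowerSeries.coeff_mk]
    congr 1
    omega

lemma ofPowerSeries_coeff_neg (f : PowerSeries K) {j : ℤ} (hj : j < 0) :
    (HahnSeries.ofPowerSeries ℤ K f).coeff j = 0 := by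
  rw [PowerSeries.coeff_coe, if_pos hj]

lemma colSpan_mul_toL_le (G : Matrix (Fin h) (Fin h) (LaurentSeries K))
    (X : Matrix (Fin h) (Fin h) (PowerSeries K)) : colSpan (G * toL X) ≤ colSpan G := by
  intro v hv
  obtain ⟨x, rfl⟩ := mem_colSpan.1 hv
  refine mem_colSpan.2 ⟨X.mulVec x, ?_⟩
  rw [← Matrix.mulVec_mulVec]
  congr 1
  funext i
  simp [Matrix.mulVec, dotProduct, map_sum]

lemma toL_mul_toL_inv (u : Matrix.GeneralLinearGroup (Fin h) (PowerSeries K)) :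
    toL u.val * toL (u⁻¹).val = 1 := by
  rw [← toL_mul, ← Units.val_mul, mul_inv_cancel, Units.val_one, toL_one]

lemma toL_inv_mul_toL (u : Matrix.GeneralLinearGroup (Fin h) (PowerSeries K)) :
    toL (u⁻¹).val * toL u.val = 1 := by
  rw [← toL_mul, ← Units.val_mul, inv_mul_cancel, Units.val_one, toL_one]

lemma colSpan_mul_toL_unit (G : Matrix (Fin h) (Fin h) (LaurentSeries K))
    (u : Matrix.GeneralLinearGroup (Fin h) (PowerSeries K)) :
    colSpan (G * toL u.val) = colSpan G := by
  apply le_antisymm (colSpan_mul_toL_le _ _)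
  conv_lhs => rw [← Matrix.mul_one G, ← toL_mul_toL_inv u, ← Matrix.mul_assoc]
  exact colSpan_mul_toL_le _ _

lemma exists_colSpan_eq {G : Matrix (Fin h) (Fin h) (LaurentSeries K)} (hG : IsUnit G)
    (v : NSpace K h) : ∃ y, v = G.mulVec y := by
  obtain ⟨u, rfl⟩ := hG
  refine ⟨(u⁻¹).val.mulVec v, ?_⟩
  rw [Matrix.mulVec_mulVec, ← Units.val_mul, mul_inv_cancel, Units.val_one, Matrix.one_mulVec]

lemma mulVec_injective_of_isUnit' {G : Matrix (Fin h) (Fin h) (LaurentSeries K)}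
    (hG : IsUnit G) : Function.Injective G.mulVec := by
  obtain ⟨u, rfl⟩ := hG
  intro x y hxy
  have := congrArg (u⁻¹).val.mulVec hxy
  simpa [Matrix.mulVec_mulVec, ← Units.val_mul] using this

/-- Membership in `G t ^ α O_L ^ h` in terms of coordinates with respect to `G`. -/
lemma mulVec_mem_colSpan_mul_tDiag {G : Matrix (Fin h) (Fin h) (LaurentSeries K)}
    (hG : IsUnit G) (α : Fin h → ℤ) (y : NSpace K h) :
    G.mulVec y ∈ colSpan (G * tDiag K α) ↔ ∀ i, ∀ j < α i, (y i).coeff j = 0 := by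
  rw [mem_colSpan]
  constructor
  · rintro ⟨x, hx⟩ i j hj
    rw [← Matrix.mulVec_mulVec] at hx
    rw [mulVec_injective_of_isUnit' hG hx, Matrix.mulVec_diagonal, HahnSeries.coeff_single_mul,
      one_mul, ofPowerSeries_coeff_neg _ (by omega)]
  · intro hy
    have : ∀ i, ∃ f : PowerSeries K,
        HahnSeries.ofPowerSeries ℤ K f = HahnSeries.single (-α i) (1 : K) * y i := by
      intro i
      apply exists_ofPowerSeries_eq
      intro j hj
      rw [HahnSeries.coeff_single_mul, one_mul, hy i _ (by omega)]
    choose f hf using this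
    refine ⟨f, ?_⟩
    rw [← Matrix.mulVec_mulVec]
    congr 1
    funext i
    rw [Matrix.mulVec_diagonal, hf, ← mul_assoc, HahnSeries.single_mul_single]
    simp

lemma mulVec_mem_colSpan {G : Matrix (Fin h) (Fin h) (LaurentSeries K)}
    (hG : IsUnit G) (y : NSpace K h) :
    G.mulVec y ∈ colSpan G ↔ ∀ i, ∀ j < 0, (y i).coeff j = 0 := by
  have := mulVec_mem_colSpan_mul_tDiag hG 0 y
  have h1 : tDiag K (0 : Fin h → ℤ) = 1 := by
    rw [← Matrix.diagonal_one]
    rfl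
  rwa [h1, Matrix.mul_one] at this

lemma isUnit_tDiag (α : Fin h → ℤ) : IsUnit (tDiag K α) := by
  rw [Matrix.isUnit_iff_isUnit_det, Matrix.det_diagonal, isUnit_iff_ne_zero,
    Finset.prod_ne_zero_iff]
  exact fun i _ => HahnSeries.single_ne_zero one_ne_zero

variable [NeZero h]

lemma exists_colSpan_le_fil (G : Matrix (Fin h) (Fin h) (LaurentSeries K)) :
    ∃ a, colSpan G ≤ fil K h a := by
  choose a ha using fun j => exists_forall_lt_eCoeff_eq_zero (G.col j)
  obtain ⟨B, hB⟩ := (Set.finite_range a).bddBelow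
  refine ⟨B, ?_⟩
  rw [colSpan, Submodule.span_le]
  rintro _ ⟨j, rfl⟩ i hi
  exact ha j i (hi.trans_le (hB ⟨j, rfl⟩))

/-- The lattice `t ^ c M_0` as a column span. -/
lemma colSpan_tDiag_const (c : ℤ) : colSpan (tDiag K fun _ : Fin h => c) = fil K h (c * h) := by
  ext v
  have := mulVec_mem_colSpan_mul_tDiag (h := h) (K := K) isUnit_one (fun _ => c) v
  rw [Matrix.one_mulVec, Matrix.one_mul] at this
  rw [this, mem_fil]
  constructor
  · intro H i hi
    obtain ⟨d, r, rfl⟩ := exists_index h i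
    rw [eCoeff_mul_add]
    apply H
    have : (0 : ℤ) ≤ ((r : ℕ) : ℤ) := by positivity
    exact lt_of_mul_lt_mul_right (by linarith) (natCast_h_pos (h := h)).le
  · intro H r d hd
    rw [← eCoeff_mul_add]
    apply H
    have hr : ((r : ℕ) : ℤ) < h := by exact_mod_cast r.2
    have : (d + 1) * (h : ℤ) ≤ c * h :=
      mul_le_mul_of_nonneg_right (by omega) natCast_h_pos.le
    linarith

lemma exists_fil_le_colSpan {G : Matrix (Fin h) (Fin h) (LaurentSeries K)} (hG : IsUnit G) :
    ∃ a, fil K h a ≤ colSpan G := by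
  obtain ⟨u, rfl⟩ := hG
  obtain ⟨B, hB⟩ := (Set.finite_range fun p : Fin h × Fin h =>
    ((u⁻¹).val p.1 p.2).order).bddBelow
  refine ⟨(-B) * h, ?_⟩
  rw [← colSpan_tDiag_const, colSpan, Submodule.span_le]
  rintro _ ⟨j, rfl⟩
  have : (tDiag K fun _ : Fin h => -B).col j =
      u.val.mulVec ((u⁻¹).val.mulVec ((tDiag K fun _ : Fin h => -B).col j)) := by
    rw [Matrix.mulVec_mulVec, ← Units.val_mul, mul_inv_cancel, Units.val_one, Matrix.one_mulVec]
  rw [SetLike.mem_coe, this, mulVec_mem_colSpan u.isUnit]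
  intro i d hd
  have h2 : (u⁻¹).val.mulVec ((tDiag K fun _ : Fin h => -B).col j) i =
      HahnSeries.single (-B) (1 : K) * (u⁻¹).val i j := by
    rw [Matrix.mulVec, dotProduct, Finset.sum_eq_single j]
    · simp [mul_comm]
    · intro s _ hs
      simp [hs]
    · simp
  rw [h2, HahnSeries.coeff_single_mul, one_mul]
  apply HahnSeries.coeff_eq_zero_of_lt_order
  have := hB ⟨(i, j), rfl⟩
  simp only at this
  omega

/-- The number of leading indices lost on passing from `G O_L ^ h` to `G t ^ α O_L ^ h` is the
length of the quotient of these lattices. -/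
lemma ncard_leadSet_colSpan_diff {G : Matrix (Fin h) (Fin h) (LaurentSeries K)} (hG : IsUnit G)
    (α : Fin h → ℕ) :
    (leadSet (colSpan G : Set (NSpace K h)) \
      leadSet (colSpan (G * tDiag K fun i => (α i : ℤ)) : Set (NSpace K h))).ncard =
      ∑ i, α i := by
  obtain ⟨u, rfl⟩ := id hG
  obtain ⟨a, ha⟩ := exists_colSpan_le_fil u.val
  obtain ⟨R, hR⟩ := exists_fil_le_colSpan (hG.mul (isUnit_tDiag fun i => (α i : ℤ)))
  -- the coordinates with respect to `G` modulo `t ^ α`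
  let f : asSub (colSpan u.val) →ₗ[K] ((Σ i, Fin (α i)) → K) :=
    { toFun := fun v p => ((u⁻¹).val.mulVec (v : NSpace K h) p.1).coeff ((p.2 : ℕ) : ℤ)
      map_add' := fun v w => by
        funext p
        simp [Matrix.mulVec_add]
      map_smul' := fun c v => by
        funext p
        have hc : ((c • v : asSub (colSpan u.val)) : NSpace K h) =
            (HahnSeries.C c : LaurentSeries K) • (v : NSpace K h) := by
          funext r
          exact HahnSeries.C_mul_eq_smul.symm
        rw [hc, Matrix.mulVec_smul, Pi.smul_apply, smul_eq_mul, HahnSeries.C_mul_eq_smul,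
          HahnSeries.coeff_smul]
        rfl }
  have hinv : ∀ y, (u⁻¹).val.mulVec (u.val.mulVec y) = y := fun y => by
    rw [Matrix.mulVec_mulVec, ← Units.val_mul, inv_mul_cancel, Units.val_one, Matrix.one_mulVec]
  have hker : kerSet _ f = (colSpan (u.val * tDiag K fun i => (α i : ℤ)) : Set (NSpace K h)) := by
    ext v
    obtain ⟨y, rfl⟩ := exists_colSpan_eq hG v
    rw [SetLike.mem_coe, mulVec_mem_colSpan_mul_tDiag hG]
    constructor
    · rintro ⟨hv, hfv⟩ i j hj
      have hy := (mulVec_mem_colSpan hG y).1 hv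
      by_cases hj0 : j < 0
      · exact hy i j hj0
      · have := congrFun hfv ⟨i, ⟨j.toNat, by omega⟩⟩
        simp only [f, LinearMap.coe_mk, AddHom.coe_mk, hinv, Pi.zero_apply] at this
        rwa [Int.toNat_of_nonneg (by omega)] at this
    · intro hy
      refine ⟨(mulVec_mem_colSpan hG y).2 fun i j hj => hy i j (by omega), ?_⟩
      funext p
      simp only [f, LinearMap.coe_mk, AddHom.coe_mk, hinv, Pi.zero_apply]
      exact hy _ _ (by exact_mod_cast p.2.2)
  have hsurj : LinearMap.range f = ⊤ := by
    rw [LinearMap.range_eq_top]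
    intro z
    refine ⟨⟨u.val.mulVec fun i => HahnSeries.ofPowerSeries ℤ K
      (PowerSeries.mk fun n => if hn : n < α i then z ⟨i, n, hn⟩ else 0), ?_⟩, ?_⟩
    · exact (mulVec_mem_colSpan hG _).2 fun i j hj => ofPowerSeries_coeff_neg _ hj
    · funext p
      simp only [f, LinearMap.coe_mk, AddHom.coe_mk, hinv]
      rw [HahnSeries.ofPowerSeries_apply_coeff, PowerSeries.coeff_mk, dif_pos p.2.2]
  have key := (ncard_leadSet_diff (asSub (colSpan u.val)) f (a := a) (R := R)
    (fun v hv => ha hv) (fun v hv => by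
      have h1 : (v : NSpace K h) ∈ kerSet _ f := by
        rw [hker]
        exact hR hv
      obtain ⟨_, h2⟩ := h1
      exact h2)).2.2
  rw [hker, hsurj, finrank_top, Module.finrank_fintype_fun_eq_card, Fintype.card_sigma] at key
  simpa using key

end ColSpan

/-! ### Relative position of `M` and `bσ(M)` -/

section Counting

/-- Two finite families with the same fibre cardinalities differ by a bijection of indices. -/
lemma exists_equiv_of_natCard_fiber_eq {α β ι : Type*} (f : α → ι) (g : β → ι)
    (hα : ∀ c, Finite {a // f a = c}) (hβ : ∀ c, Finite {b // g b = c})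
    (hc : ∀ c, Nat.card {a // f a = c} = Nat.card {b // g b = c}) :
    ∃ E : α ≃ β, ∀ a, g (E a) = f a := by
  have : ∀ c, Nonempty ({a // f a = c} ≃ {b // g b = c}) := fun c => Finite.card_eq.1 (hc c)
  exact ⟨Equiv.ofFiberEquiv fun c => (this c).some, fun a => Equiv.ofFiberEquiv_map _ a⟩

lemma card_filter_le_add_sum_tsub {ι : Type*} [Fintype ι] (ν : ι → ℕ) (e : ℕ) :
    (Finset.univ.filter fun i => ν i ≤ e).card + ∑ i, (e - ν i) = ∑ i, (e + 1 - ν i) := by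
  rw [Finset.card_filter, ← Finset.sum_add_distrib]
  refine Finset.sum_congr rfl fun i _ => ?_
  split_ifs <;> omega

/-- The numbers `∑ i, (e - ν i)` for small `e` determine `ν` up to permutation. -/
lemma exists_perm_of_sum_tsub_eq {h : ℕ} {μ ν : Fin h → ℕ} {m : ℕ} (hμ : ∀ i, μ i ≤ m)
    (hs : ∀ e ≤ m + 1, ∑ i, (e - ν i) = ∑ i, (e - μ i)) :
    ∃ π : Equiv.Perm (Fin h), ∀ i, ν (π i) = μ i := by
  have hle : ∀ e ≤ m, (Finset.univ.filter fun i => ν i ≤ e).card =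
      (Finset.univ.filter fun i => μ i ≤ e).card := by
    intro e he
    have h1 := card_filter_le_add_sum_tsub ν e
    have h2 := card_filter_le_add_sum_tsub μ e
    rw [hs e (by omega), hs (e + 1) (by omega)] at h1
    omega
  have hν : ∀ i, ν i ≤ m := by
    have h1 := hle m le_rfl
    rw [Finset.filter_true_of_mem (fun i _ => hμ i)] at h1
    have h2 := Finset.filter_card_eq h1
    exact fun i => h2 i (Finset.mem_univ i)
  have hsplit : ∀ (ν : Fin h → ℕ) (e : ℕ), (Finset.univ.filter fun i => ν i ≤ e + 1).card =
      (Finset.univ.filter fun i => ν i ≤ e).card +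
        (Finset.univ.filter fun i => ν i = e + 1).card := by
    intro ν e
    rw [Finset.card_filter, Finset.card_filter, Finset.card_filter, ← Finset.sum_add_distrib]
    refine Finset.sum_congr rfl fun i _ => ?_
    split_ifs <;> omega
  have heq : ∀ e, (Finset.univ.filter fun i => μ i = e).card =
      (Finset.univ.filter fun i => ν i = e).card := by
    intro e
    by_cases he : e ≤ m
    · rcases e with _ | e
      · have := hle 0 (by omega)
        simpa using this.symm
      · have h1 := hle (e + 1) he
        have h2 := hle e (by omega)
        have h3 := hsplit μ e
        have h4 := hsplit ν e
        omega
    · rw [Finset.filter_false_of_mem, Finset.filter_false_of_mem]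
      · intro i _; have := hν i; omega
      · intro i _; have := hμ i; omega
  obtain ⟨E, hE⟩ := exists_equiv_of_natCard_fiber_eq μ ν (fun _ => inferInstance)
    (fun _ => inferInstance) (fun e => by
      rw [Nat.card_eq_fintype_card, Nat.card_eq_fintype_card, Fintype.card_subtype,
        Fintype.card_subtype, heq])
  exact ⟨E, hE⟩

end Counting

section RelativePosition

variable (k K : Type*) [Field k] [Fintype k] [Field K] [Algebra k K]

/-- The Frobenius of `L` as a ring homomorphism. -/
def sigmaHom : LaurentSeries K →+* LaurentSeries K where
  toFun := sigmaL k K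
  map_one' := by
    ext i
    rw [sigmaL_coeff]
    have hq : Fintype.card k ≠ 0 := Fintype.card_ne_zero
    simp only [HahnSeries.coeff_one]
    split_ifs <;> simp [hq]
  map_mul' x y := HahnSeries.map_mul (FiniteField.frobeniusAlgHom k K : K →ₙ+* K)
  map_zero' := by
    ext i
    rw [sigmaL_coeff]
    have hq : Fintype.card k ≠ 0 := Fintype.card_ne_zero
    simp [hq]
  map_add' x y := by
    ext i
    simp only [sigmaL_coeff, HahnSeries.coeff_add, add_pow_card]

@[simp] lemma sigmaHom_apply (x : LaurentSeries K) : sigmaHom k K x = sigmaL k K x := rfl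

/-- The automorphism of `O_L` that is inverse to the Frobenius. -/
lemma exists_sigma_inv [IsAlgClosed K] : ∃ τ : PowerSeries K →+* PowerSeries K, ∀ f,
    sigmaL k K (HahnSeries.ofPowerSeries ℤ K (τ f)) = HahnSeries.ofPowerSeries ℤ K f := by
  have hbij : Function.Bijective (FiniteField.frobeniusAlgHom k K : K →+* K) :=
    ⟨RingHom.injective _, fun x => exists_pow_card_eq k x⟩
  let E := RingEquiv.ofBijective (FiniteField.frobeniusAlgHom k K : K →+* K) hbij
  refine ⟨PowerSeries.map E.symm.toRingHom, fun f => ?_⟩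
  ext i
  rw [sigmaL_coeff, PowerSeries.coeff_coe, PowerSeries.coeff_coe]
  have hq : Fintype.card k ≠ 0 := Fintype.card_ne_zero
  split_ifs
  · simp [hq]
  · rw [PowerSeries.coeff_map]
    exact E.apply_symm_apply _

variable {k K}
variable {m h : ℕ} [NeZero h]

lemma bSigma_mulVec (G : Matrix (Fin h) (Fin h) (LaurentSeries K)) (y : NSpace K h) :
    bSigma k m (G.mulVec y) =
      (bMatrix K m h * G.map (sigmaL k K)).mulVec fun i => sigmaL k K (y i) := by
  rw [← Matrix.mulVec_mulVec, bSigma]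
  congr 1
  exact funext fun r => RingHom.map_mulVec (sigmaHom k K) G y r

lemma isUnit_bMatrix : IsUnit (bMatrix K m h) := by
  rw [Matrix.isUnit_iff_isUnit_det, isUnit_iff_ne_zero]
  intro hdet
  obtain ⟨v, hv, h0⟩ := Matrix.exists_mulVec_eq_zero_iff.2 hdet
  refine hv (eCoeff_ext fun i => ?_)
  have := eCoeff_bMatrix_mulVec m v (i + m)
  rw [h0, add_sub_cancel_right, eCoeff_zero] at this
  rw [← this, eCoeff_zero]

lemma isUnit_map_sigmaL {G : Matrix (Fin h) (Fin h) (LaurentSeries K)} (hG : IsUnit G) :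
    IsUnit (G.map (sigmaL k K)) :=
  hG.map (sigmaHom k K).mapMatrix

variable (k m) in
/-- The number of leading indices `a` of `V` for which no `v ∈ V` with leading index `a` satisfies
`t ^ (-e) bσ(v) ∈ V`. -/
def levelCodim (e : ℕ) (V : Submodule K (NSpace K h)) : ℕ :=
  (leadSet (V : Set (NSpace K h)) \ leadSet (level k m e V : Set (NSpace K h))).ncard

lemma sigmaL_coeff_eq_zero_iff (x : LaurentSeries K) (j : ℤ) :
    (sigmaL k K x).coeff j = 0 ↔ x.coeff j = 0 := by
  have hq : Fintype.card k ≠ 0 := Fintype.card_ne_zero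
  rw [sigmaL_coeff, pow_eq_zero_iff hq]

/-- If `bσ(M)` has relative position `ν` to `M`, then in suitable bases `v_i`, `u_i` of `M` one has
`bσ(v_i) = t ^ (ν i) u_i`, so that `L_e(M)` is spanned by the vectors `t ^ (e - ν i) v_i`. -/
lemma levelCodim_of_relativePosition [IsAlgClosed K]
    {g : Matrix.GeneralLinearGroup (Fin h) (LaurentSeries K)} {ν : Fin h → ℕ}
    {k₁ k₂ : Matrix.GeneralLinearGroup (Fin h) (PowerSeries K)}
    (hg : (g⁻¹).val * bMatrix K m h * g.val.map (sigmaL k K) =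
      toL k₁.val * tDiag K (fun i => (ν i : ℤ)) * toL k₂.val) (e : ℕ) :
    levelCodim k m e (asSub (latticeOf g)) = ∑ i, (e - ν i) := by
  obtain ⟨τ, hτ⟩ := exists_sigma_inv k K
  let k₃ : Matrix.GeneralLinearGroup (Fin h) (PowerSeries K) :=
    Units.map τ.mapMatrix.toMonoidHom k₂
  have hk₃ : (toL k₃.val).map (sigmaL k K) = toL k₂.val := by
    refine Matrix.ext fun i j => ?_
    exact hτ _
  have hk₃' : (toL (k₃⁻¹).val).map (sigmaL k K) = toL (k₂⁻¹).val := by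
    have h1 : (toL (k₃⁻¹).val).map (sigmaL k K) * toL k₂.val = 1 := by
      rw [← hk₃]
      have := congrArg (sigmaHom k K).mapMatrix (toL_inv_mul_toL k₃)
      rwa [map_mul, map_one] at this
    calc _ = (toL (k₃⁻¹).val).map (sigmaL k K) * (toL k₂.val * toL (k₂⁻¹).val) := by
          rw [toL_mul_toL_inv, Matrix.mul_one]
      _ = _ := by rw [← Matrix.mul_assoc, h1, Matrix.one_mul]
  have hu : ∀ u : Matrix.GeneralLinearGroup (Fin h) (PowerSeries K), IsUnit (toL u.val) := fun u =>
    ⟨⟨toL u.val, toL (u⁻¹).val, toL_mul_toL_inv u, toL_inv_mul_toL u⟩, rfl⟩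
  set G₁ := g.val * toL k₁.val with hG₁
  set G₂ := g.val * toL (k₃⁻¹).val with hG₂
  have hG₁u : IsUnit G₁ := g.isUnit.mul (hu _)
  have hG₂u : IsUnit G₂ := g.isUnit.mul (hu _)
  have hM₁ : colSpan G₁ = latticeOf g := colSpan_mul_toL_unit _ _
  have hM₂ : colSpan G₂ = latticeOf g := colSpan_mul_toL_unit _ _
  -- `bσ` maps the `i`-th column of `G₂` to `t ^ (ν i)` times the `i`-th column of `G₁`
  have hb : bMatrix K m h * G₂.map (sigmaL k K) = G₁ * tDiag K (fun i => (ν i : ℤ)) := by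
    have h1 : G₂.map (sigmaL k K) = g.val.map (sigmaL k K) * toL (k₂⁻¹).val := by
      rw [← hk₃', hG₂]
      exact map_mul (sigmaHom k K).mapMatrix _ _
    have h2 : bMatrix K m h * g.val.map (sigmaL k K) =
        g.val * (toL k₁.val * tDiag K (fun i => (ν i : ℤ)) * toL k₂.val) := by
      rw [← hg, ← Matrix.mul_assoc, ← Matrix.mul_assoc, ← Units.val_mul, mul_inv_cancel,
        Units.val_one, Matrix.one_mul]
    rw [h1, ← Matrix.mul_assoc, h2, Matrix.mul_assoc, Matrix.mul_assoc, toL_mul_toL_inv,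
      Matrix.mul_one, hG₁, Matrix.mul_assoc]
  have hlevel : (level k m e (asSub (latticeOf g)) : Set (NSpace K h)) =
      (colSpan (G₂ * tDiag K fun i => ((e - ν i : ℕ) : ℤ)) : Set (NSpace K h)) := by
    ext v
    obtain ⟨y, rfl⟩ := exists_colSpan_eq hG₂u v
    have h1 : tbSigma k m e (G₂.mulVec y) = G₁.mulVec fun i =>
        HahnSeries.single ((ν i : ℤ) - e) (1 : K) * sigmaL k K (y i) := by
      rw [tbSigma, bSigma_mulVec, hb, ← Matrix.mulVec_mulVec, ← Matrix.mulVec_smul]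
      congr 1
      funext i
      rw [Pi.smul_apply, Matrix.mulVec_diagonal, smul_eq_mul, ← mul_assoc,
        HahnSeries.single_mul_single, mul_one]
      rw [neg_add_eq_sub]
    rw [SetLike.mem_coe, SetLike.mem_coe, mem_level, mulVec_mem_colSpan_mul_tDiag hG₂u, h1]
    have h2 : G₂.mulVec y ∈ asSub (latticeOf g) ↔ ∀ i, ∀ j < 0, (y i).coeff j = 0 := by
      rw [← hM₂]
      exact mulVec_mem_colSpan hG₂u y
    have h3 : (G₁.mulVec fun i => HahnSeries.single ((ν i : ℤ) - e) (1 : K) * sigmaL k K (y i)) ∈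
        asSub (latticeOf g) ↔ ∀ i, ∀ j < (e : ℤ) - ν i, (y i).coeff j = 0 := by
      rw [← hM₁]
      refine (mulVec_mem_colSpan hG₁u _).trans (forall_congr' fun i => ?_)
      simp only [HahnSeries.coeff_single_mul, one_mul, sigmaL_coeff_eq_zero_iff]
      refine ⟨fun H j hj => ?_, fun H j hj => H _ (by omega)⟩
      have := H (j + (ν i - e)) (by omega)
      rwa [add_sub_cancel_right] at this
    rw [h2, h3, ← forall_and]
    refine forall_congr' fun i => ⟨fun H j hj => ?_, fun H => ⟨fun j hj => H j (by omega),
      fun j hj => H j (by omega)⟩⟩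
    by_cases hj0 : j < 0
    · exact H.1 j hj0
    · exact H.2 j (by omega)
  have key := ncard_leadSet_colSpan_diff hG₂u fun i => e - ν i
  rw [levelCodim, hlevel]
  rwa [hM₂] at key

/-- A lattice lies in `X_μ(b)` if the numbers `levelCodim e M` have the expected values. The
values for `e ≤ m + 1` suffice since `μ i ≤ m`. -/
lemma mem_adlv_of_levelCodim [IsAlgClosed K] {μ : Fin h → ℕ} (hμ : ∀ i, μ i ≤ m)
    (g : Matrix.GeneralLinearGroup (Fin h) (LaurentSeries K))
    (hcod : ∀ e ≤ m + 1, levelCodim k m e (asSub (latticeOf g)) = ∑ i, (e - μ i)) :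
    latticeOf g ∈ adlv k K m μ := by
  obtain ⟨a, ha⟩ := exists_colSpan_le_fil g.val
  obtain ⟨R, hR⟩ := exists_fil_le_colSpan g.isUnit
  set M := latticeOf g with hM
  have hle0 : level k m 0 (asSub M) ≤ asSub M := fun v hv => hv.1
  -- vectors with large leading index are mapped into `M` by `bσ`
  have hbig : ∀ v ∈ asSub M, (∀ i < R, eCoeff v i = 0) → v ∈ level k m 0 (asSub M) := by
    intro v hv hvR
    refine ⟨hv, hR fun i hi => ?_⟩
    have hq : Fintype.card k ≠ 0 := Fintype.card_ne_zero
    rw [eCoeff_tbSigma, hvR _ (by push_cast; omega), zero_pow hq]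
  have hstable : asSub M ≤ level k m 0 (asSub M) := by
    refine le_of_leadSet_subset hle0 hbig ?_
    have h0 := hcod 0 (by omega)
    simp only [zero_tsub, Finset.sum_const_zero] at h0
    have hfin : (leadSet (asSub M : Set (NSpace K h)) \
        leadSet (level k m 0 (asSub M) : Set (NSpace K h))).Finite := by
      refine (Set.finite_Ico a R).subset ?_
      rintro b ⟨⟨v, hv, hb⟩, hnot⟩
      refine ⟨?_, ?_⟩
      · by_contra hlt
        exact hb.1 (ha hv b (by omega))
      · by_contra hle
        exact hnot ⟨v, hbig v hv fun i hi => hb.2 i (by omega), hb⟩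
    rw [levelCodim, Set.ncard_eq_zero hfin] at h0
    exact Set.sdiff_eq_empty.1 h0
  -- so the matrix of `bσ` is integral
  set Y := (g⁻¹).val * bMatrix K m h * g.val.map (sigmaL k K) with hY
  have hYint : ∀ i j, ∃ f : PowerSeries K, HahnSeries.ofPowerSeries ℤ K f = Y i j := by
    intro i j
    apply exists_ofPowerSeries_eq
    have hcol : g.val.mulVec (Y.col j) = tbSigma k m 0 (g.val.col j) := by
      have h1 : g.val.col j = g.val.mulVec (Pi.single j 1) := by
        rw [Matrix.mulVec_single_one]
      have h2 : (fun i => sigmaL k K ((Pi.single j 1 : NSpace K h) i)) = Pi.single j 1 := by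
        funext i
        rw [← sigmaHom_apply, Pi.single_apply]
        split_ifs
        · exact map_one _
        · exact map_zero _
      have h3 : tbSigma k m 0 (g.val.col j) = bSigma k m (g.val.col j) := by
        rw [tbSigma]
        simp
      rw [h3, h1, bSigma_mulVec, h2, Matrix.mulVec_single_one, hY]
      have h4 : (g⁻¹.val * bMatrix K m h * g.val.map (sigmaL k K)).col j =
          (g⁻¹.val * (bMatrix K m h * g.val.map (sigmaL k K))).mulVec (Pi.single j 1) := by
        rw [Matrix.mulVec_single_one, Matrix.mul_assoc]
      rw [h4, ← Matrix.mulVec_mulVec, Matrix.mulVec_mulVec, ← Units.val_mul, mul_inv_cancel,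
        Units.val_one, Matrix.one_mulVec, Matrix.mulVec_single_one]
    have hmem : g.val.mulVec (Y.col j) ∈ colSpan g.val := by
      rw [hcol]
      exact (hstable (Submodule.subset_span ⟨j, rfl⟩ : g.val.col j ∈ M)).2
    exact (mulVec_mem_colSpan g.isUnit _).1 hmem i
  choose X hX using hYint
  have hXY : toL (Matrix.of X) = Y := by
    refine Matrix.ext fun i j => ?_
    exact hX i j
  have hdet : (Matrix.of X).det ≠ 0 := by
    intro h0
    have h1 : IsUnit Y := (((g⁻¹).isUnit).mul isUnit_bMatrix).mul (isUnit_map_sigmaL g.isUnit)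
    rw [Matrix.isUnit_iff_isUnit_det, isUnit_iff_ne_zero, ← hXY] at h1
    apply h1
    rw [toL, ← RingHom.mapMatrix_apply, ← RingHom.map_det, h0, map_zero]
  -- its elementary divisors `ν` are those prescribed by `μ`, up to a permutation
  obtain ⟨ν, hν⟩ := exists_cartan (Matrix.of X) hdet
  obtain ⟨π, hπ⟩ := exists_perm_of_sum_tsub_eq (μ := μ) (ν := ν) hμ (fun e he => by
    obtain ⟨k₁, k₂, hk⟩ := hν (Equiv.refl _)
    rw [← hcod e he]
    exact (levelCodim_of_relativePosition (ν := ν) (k₁ := k₁) (k₂ := k₂)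
      (by rw [← hY, ← hXY, hk]; rfl) e).symm)
  obtain ⟨k₁, k₂, hk⟩ := hν π
  refine ⟨g, rfl, k₁, k₂, ?_⟩
  rw [← hY, ← hXY, hk]
  simp only [hπ]

end RelativePosition

/-! ### Normalization and volume -/

section Profile

variable {h : ℕ} [NeZero h]

/-- A set of integers stable under `+ h` that is described by the smallest element
`q r * h + r` of each residue class `r`. -/
def IsProfile (A : Set ℤ) (q : Fin h → ℤ) : Prop := ∀ (c : ℤ) (r : Fin h),
  c * h + ((r : ℕ) : ℤ) ∈ A ↔ q r ≤ c

lemma exists_isProfile {A : Set ℤ} (hbdd : BddBelow A) (hadd : ∀ a ∈ A, a + h ∈ A)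
    (hne : ∀ r : Fin h, ∃ c : ℤ, c * h + ((r : ℕ) : ℤ) ∈ A) : ∃ q : Fin h → ℤ, IsProfile A q := by
  have hh := natCast_h_pos (h := h)
  obtain ⟨B, hB⟩ := hbdd
  have : ∀ r : Fin h, ∃ q : ℤ, ∀ c : ℤ, c * h + ((r : ℕ) : ℤ) ∈ A ↔ q ≤ c := by
    intro r
    obtain ⟨q, hq, hmin⟩ := Int.exists_least_of_bdd
      (P := fun c : ℤ => c * h + ((r : ℕ) : ℤ) ∈ A) ⟨B / h - 1, fun c hc => by
        by_contra hlt
        push Not at hlt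
        have h1 := hB hc
        have hr : ((r : ℕ) : ℤ) < h := by exact_mod_cast r.2
        have h2 := Int.mul_ediv_add_emod B h
        have h3 := Int.emod_nonneg B hh.ne'
        have h4 : (c + 1) * h ≤ (B / h - 1) * h := by
          apply mul_le_mul_of_nonneg_right _ hh.le
          omega
        nlinarith⟩ (hne r)
    refine ⟨q, fun c => ⟨hmin c, fun hc => ?_⟩⟩
    induction c, hc using Int.leInduction with
    | base => exact hq
    | succ c _ ih =>
      have := hadd _ ih
      rwa [show c * (h : ℤ) + ((r : ℕ) : ℤ) + h = (c + 1) * h + ((r : ℕ) : ℤ) by ring] at this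
  choose q hq using this
  exact ⟨q, fun c r => hq r c⟩

/-- The elements of a sequence of representatives modulo `h` reduce to `0, …, h - 1`. -/
lemma sum_emod_eq {f : Fin h → ℤ} (hf : ∀ i j, f i % h = f j % h → i = j) :
    ∑ i, f i % h = (h : ℤ) * (h - 1) / 2 := by
  have hh := natCast_h_pos (h := h)
  let g : Fin h → Fin h := fun i => ⟨(f i % h).toNat, by
    have := Int.emod_lt_of_pos (f i) hh
    have := Int.emod_nonneg (f i) hh.ne'
    omega⟩
  have hg : ∀ i, (((g i : Fin h) : ℕ) : ℤ) = f i % h := fun i =>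
    Int.toNat_of_nonneg (Int.emod_nonneg (f i) hh.ne')
  have hinj : Function.Injective g := by
    intro i j hij
    exact hf i j (by rw [← hg, ← hg, hij])
  have hbij := Finite.injective_iff_bijective.1 hinj
  have h1 : ∑ i, f i % h = ∑ r : Fin h, ((r : ℕ) : ℤ) := by
    rw [← hbij.sum_comp fun r : Fin h => ((r : ℕ) : ℤ)]
    exact Finset.sum_congr rfl fun i _ => (hg i).symm
  have h2 : ∑ r : Fin h, ((r : ℕ) : ℤ) = ((∑ r ∈ Finset.range h, r : ℕ) : ℤ) := by
    rw [Fin.sum_univ_eq_sum_range fun r => ((r : ℕ) : ℤ)]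
    push_cast
    rfl
  have h3 := Finset.sum_range_id_mul_two h
  have h4 : ((∑ r ∈ Finset.range h, r : ℕ) : ℤ) * 2 = (h : ℤ) * (h - 1) := by
    have hpos : 1 ≤ h := Nat.pos_of_ne_zero (NeZero.ne h)
    rw [← Nat.cast_pred hpos]
    exact_mod_cast h3
  rw [h1, h2, ← h4, Int.mul_ediv_cancel _ (by norm_num)]

lemma emod_mul_add (c : ℤ) (r : Fin h) : (c * h + ((r : ℕ) : ℤ)) % (h : ℤ) = (r : ℕ) := by
  have hr : ((r : ℕ) : ℤ) < h := by exact_mod_cast r.2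
  rw [add_comm, Int.add_mul_emod_self_right, Int.emod_eq_of_lt (by positivity) hr]

lemma mul_add_inj {c d : ℤ} {r s : Fin h}
    (e : c * h + ((r : ℕ) : ℤ) = d * h + ((s : ℕ) : ℤ)) : c = d ∧ r = s := by
  have h1 : r = s := by
    have := congrArg (· % (h : ℤ)) e
    simp only [emod_mul_add] at this
    exact Fin.ext (by exact_mod_cast this)
  subst h1
  exact ⟨mul_right_cancel₀ (natCast_h_pos (h := h)).ne' (by linarith), rfl⟩

lemma IsProfile.diff_eq_range {A : Set ℤ} {q : Fin h → ℤ} (hq : IsProfile A q) :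
    A \ ((fun a : ℤ => (h : ℤ) + a) '' A) = Set.range fun r => q r * h + ((r : ℕ) : ℤ) := by
  ext a
  constructor
  · rintro ⟨ha, hna⟩
    obtain ⟨c, r, rfl⟩ := exists_index h a
    refine ⟨r, ?_⟩
    have h1 := (hq c r).1 ha
    have h2 : ¬ q r ≤ c - 1 := fun hle => hna ⟨_, (hq (c - 1) r).2 hle, by ring⟩
    simp only [show q r = c by omega]
  · rintro ⟨r, rfl⟩
    refine ⟨(hq _ _).2 le_rfl, ?_⟩
    rintro ⟨a, ha, hEq⟩
    have h1 : a = (q r - 1) * h + ((r : ℕ) : ℤ) := by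
      simp only at hEq
      linarith
    rw [h1, hq] at ha
    omega

lemma IsProfile.isNormalized_iff {A : Set ℤ} {q : Fin h → ℤ} (hq : IsProfile A q) :
    IsNormalized h A ↔ ∑ r, q r = 0 := by
  have hh := natCast_h_pos (h := h)
  rw [IsNormalized, hq.diff_eq_range, finsum_mem_range (fun r s e => (mul_add_inj e).2),
    finsum_eq_sum_of_fintype, Finset.sum_add_distrib, ← Finset.sum_mul]
  have := sum_emod_eq (h := h) (f := fun r => 0 * h + ((r : ℕ) : ℤ)) (fun i j e => by
    simp only [emod_mul_add] at e
    exact Fin.ext (by exact_mod_cast e))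
  simp only [emod_mul_add] at this
  rw [this]
  constructor
  · intro e
    have : (∑ r, q r) * (h : ℤ) = 0 := by linarith
    rcases mul_eq_zero.1 this with h0 | h0
    · exact h0
    · omega
  · intro e
    rw [e]
    ring

lemma IsProfile.ncard_diff_Ici {A : Set ℤ} {q : Fin h → ℤ} (hq : IsProfile A q) {n : ℤ}
    (hn : ∀ r, q r ≤ n) : ((A \ Set.Ici (n * h)).ncard : ℤ) = n * h - ∑ r, q r := by
  have hset : A \ Set.Ici (n * h) = (fun p : (Σ _ : Fin h, ℤ) => p.2 * h + ((p.1 : ℕ) : ℤ)) ''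
      ((Finset.univ.sigma fun r : Fin h => Finset.Ico (q r) n : Finset (Σ _ : Fin h, ℤ)) :
        Set (Σ _ : Fin h, ℤ)) := by
    ext a
    obtain ⟨c, r, rfl⟩ := exists_index h a
    have hr : ((r : ℕ) : ℤ) < h := by exact_mod_cast r.2
    have hlt : c * h + ((r : ℕ) : ℤ) < n * h ↔ c < n := by
      have hh := natCast_h_pos (h := h)
      constructor
      · intro hlt
        have : (0 : ℤ) ≤ ((r : ℕ) : ℤ) := by positivity
        exact lt_of_mul_lt_mul_right (by linarith) hh.le
      · intro hlt
        have : (c + 1) * (h : ℤ) ≤ n * h := mul_le_mul_of_nonneg_right (by omega) hh.le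
        linarith
    simp only [Set.mem_sdiff, hq c r, Set.mem_Ici, not_le, hlt, Set.mem_image, Finset.mem_coe,
      Finset.mem_sigma, Finset.mem_univ, true_and, Finset.mem_Ico]
    constructor
    · exact fun H => ⟨⟨r, c⟩, H, rfl⟩
    · rintro ⟨⟨s, d⟩, H, e⟩
      obtain ⟨rfl, rfl⟩ := mul_add_inj e
      exact H
  rw [hset, Set.ncard_image_of_injective, Set.ncard_coe_finset, Finset.card_sigma]
  · have : ∀ r : Fin h, ((Finset.Ico (q r) n).card : ℤ) = n - q r := fun r => by
      rw [Int.card_Ico, Int.toNat_of_nonneg (by have := hn r; omega)]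
    push_cast [this]
    simp [Finset.sum_sub_distrib, mul_comm]
  · rintro ⟨r, c⟩ ⟨s, d⟩ e
    obtain ⟨rfl, rfl⟩ := mul_add_inj e
    rfl

end Profile

section Volume

variable {K : Type*} [Field K] {h : ℕ}

lemma order_det_toL (u : Matrix.GeneralLinearGroup (Fin h) (PowerSeries K)) :
    (toL u.val).det.order = 0 := by
  have hnn : ∀ f : PowerSeries K, 0 ≤ (HahnSeries.ofPowerSeries ℤ K f).order := by
    intro f
    by_cases hf : HahnSeries.ofPowerSeries ℤ K f = 0
    · rw [hf, HahnSeries.order_zero]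
    · by_contra hlt
      exact HahnSeries.coeff_order_eq_zero.not.2 hf (ofPowerSeries_coeff_neg f (by omega))
  have hd : ∀ X : Matrix (Fin h) (Fin h) (PowerSeries K),
      (toL X).det = HahnSeries.ofPowerSeries ℤ K X.det := fun X =>
    (RingHom.map_det (HahnSeries.ofPowerSeries ℤ K) X).symm
  have h1 : (toL u.val).det * (toL (u⁻¹).val).det = 1 := by
    rw [← Matrix.det_mul, toL_mul_toL_inv, Matrix.det_one]
  have h2 := HahnSeries.order_mul (left_ne_zero_of_mul_eq_one h1) (right_ne_zero_of_mul_eq_one h1)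
  rw [h1, HahnSeries.order_one, hd, hd] at h2
  have h3 := hnn u.val.det
  have h4 := hnn (u⁻¹).val.det
  rw [hd]
  omega

lemma det_tDiag (α : Fin h → ℤ) :
    (tDiag K α).det = HahnSeries.single (∑ i, α i) (1 : K) := by
  rw [Matrix.det_diagonal]
  have : ∀ s : Finset (Fin h), ∏ i ∈ s, HahnSeries.single (α i) (1 : K) =
      HahnSeries.single (∑ i ∈ s, α i) (1 : K) := by
    intro s
    classical
    induction s using Finset.induction_on with
    | empty => simp
    | insert i s hi ih =>
      rw [Finset.prod_insert hi, ih, HahnSeries.single_mul_single, Finset.sum_insert hi, mul_one]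
  exact this _

variable [NeZero h]

/-- The length of `M / t ^ n M_0` is determined by the volume of `M`. -/
lemma ncard_leadSet_diff_Ici (g : Matrix.GeneralLinearGroup (Fin h) (LaurentSeries K)) {n : ℤ}
    (hn : fil K h (n * h) ≤ latticeOf g) :
    ((leadSet (latticeOf g : Set (NSpace K h)) \ Set.Ici (n * h)).ncard : ℤ) =
      n * h - g.val.det.order := by
  have hint : ∀ i j, ∃ f : PowerSeries K, HahnSeries.ofPowerSeries ℤ K f =
      ((g⁻¹).val * tDiag K fun _ : Fin h => n) i j := by
    intro i j
    apply exists_ofPowerSeries_eq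
    have h1 : (tDiag K fun _ : Fin h => n).col j ∈ colSpan (tDiag K fun _ : Fin h => n) :=
      Submodule.subset_span ⟨j, rfl⟩
    rw [colSpan_tDiag_const] at h1
    have h2 : (tDiag K fun _ : Fin h => n).col j =
        g.val.mulVec (((g⁻¹).val * tDiag K fun _ => n).col j) := by
      rw [← Matrix.mulVec_single_one, ← Matrix.mulVec_single_one, Matrix.mulVec_mulVec,
        ← Matrix.mul_assoc, ← Units.val_mul, mul_inv_cancel, Units.val_one, Matrix.one_mul]
    have h3 := hn h1
    rw [h2] at h3
    exact (mulVec_mem_colSpan g.isUnit _).1 h3 i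
  choose X hX using hint
  have hXY : toL (Matrix.of X) = (g⁻¹).val * tDiag K (fun _ : Fin h => n) :=
    Matrix.ext fun i j => hX i j
  have hdet : (Matrix.of X).det ≠ 0 := by
    intro h0
    have h1 : IsUnit ((g⁻¹).val * tDiag K fun _ => n) := (g⁻¹).isUnit.mul (isUnit_tDiag _)
    rw [Matrix.isUnit_iff_isUnit_det, isUnit_iff_ne_zero, ← hXY] at h1
    apply h1
    rw [toL, ← RingHom.mapMatrix_apply, ← RingHom.map_det, h0, map_zero]
  -- adapted bases of `M` and `t ^ n M_0`
  obtain ⟨ν, hν⟩ := exists_cartan (Matrix.of X) hdet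
  obtain ⟨k₁, k₂, hk⟩ := hν (Equiv.refl _)
  simp only [Equiv.refl_apply] at hk
  rw [hXY] at hk
  have hmul : (tDiag K fun _ => n) =
      g.val * toL k₁.val * (tDiag K fun i => (ν i : ℤ)) * toL k₂.val := by
    calc _ = g.val * ((g⁻¹).val * tDiag K fun _ => n) := by
          rw [← Matrix.mul_assoc, ← Units.val_mul, mul_inv_cancel, Units.val_one, Matrix.one_mul]
      _ = _ := by rw [hk]; simp only [Matrix.mul_assoc]
  have hu : IsUnit (g.val * toL k₁.val) := g.isUnit.mul
    ⟨⟨toL k₁.val, toL (k₁⁻¹).val, toL_mul_toL_inv k₁, toL_inv_mul_toL k₁⟩, rfl⟩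
  have h1 := ncard_leadSet_colSpan_diff hu ν
  rw [colSpan_mul_toL_unit, ← colSpan_mul_toL_unit (_ * tDiag K _) k₂, ← hmul,
    colSpan_tDiag_const, leadSet_fil] at h1
  rw [latticeOf_eq_colSpan, h1]
  have h2 := congrArg Matrix.det hmul
  rw [Matrix.det_mul, Matrix.det_mul, Matrix.det_mul, det_tDiag, det_tDiag] at h2
  have h3 := congrArg HahnSeries.order h2
  have hg0 : g.val.det ≠ 0 := by
    rw [← isUnit_iff_ne_zero, ← Matrix.isUnit_iff_isUnit_det]
    exact g.isUnit
  have hk0 : ∀ u : Matrix.GeneralLinearGroup (Fin h) (PowerSeries K), (toL u.val).det ≠ 0 := by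
    intro u
    have : (toL u.val).det * (toL (u⁻¹).val).det = 1 := by
      rw [← Matrix.det_mul, toL_mul_toL_inv, Matrix.det_one]
    exact left_ne_zero_of_mul_eq_one this
  have hs0 : HahnSeries.single (∑ i, (ν i : ℤ)) (1 : K) ≠ 0 :=
    HahnSeries.single_ne_zero one_ne_zero
  rw [HahnSeries.order_mul (mul_ne_zero (mul_ne_zero hg0 (hk0 _)) hs0) (hk0 _),
    HahnSeries.order_mul (mul_ne_zero hg0 (hk0 _)) hs0, HahnSeries.order_mul hg0 (hk0 _),
    order_det_toL, order_det_toL, HahnSeries.order_single one_ne_zero,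
    HahnSeries.order_single one_ne_zero] at h3
  simp only [Finset.sum_const, Finset.card_univ, Fintype.card_fin, nsmul_eq_mul] at h3
  push_cast
  linarith

lemma leadSet_add_h (M : OSubmodule K h) {a : ℤ} (ha : a ∈ leadSet (M : Set (NSpace K h))) :
    a + h ∈ leadSet (M : Set (NSpace K h)) := by
  obtain ⟨v, hv, hl⟩ := ha
  exact ⟨_, M.smul_mem _ hv, isLead_X_smul.2 hl⟩

lemma bddBelow_leadSet {M : OSubmodule K h} {a : ℤ} (hM : M ≤ fil K h a) :
    BddBelow (leadSet (M : Set (NSpace K h))) := by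
  have := leadSet_mono (S := (M : Set (NSpace K h))) (T := fil K h a) hM
  rw [leadSet_fil] at this
  exact ⟨a, fun _ hb => this hb⟩

lemma exists_isProfile_leadSet {M : OSubmodule K h} {a R : ℤ} (ha : M ≤ fil K h a)
    (hR : fil K h R ≤ M) : ∃ q : Fin h → ℤ, IsProfile (leadSet (M : Set (NSpace K h))) q := by
  have hh := natCast_h_pos (h := h)
  refine exists_isProfile (bddBelow_leadSet ha) (fun a => leadSet_add_h M) fun r => ⟨|R|, ?_⟩
  apply leadSet_mono (S := (fil K h R : Set (NSpace K h))) hR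
  rw [leadSet_fil, Set.mem_Ici]
  have h1 : |R| * 1 ≤ |R| * h := mul_le_mul_of_nonneg_left (by omega) (abs_nonneg R)
  have h2 := le_abs_self R
  have : (0 : ℤ) ≤ ((r : ℕ) : ℤ) := by positivity
  linarith

/-- A lattice has volume `0` if and only if its set of leading indices is normalized. -/
lemma isNormalized_leadSet_iff (g : Matrix.GeneralLinearGroup (Fin h) (LaurentSeries K)) :
    IsNormalized h (leadSet (latticeOf g : Set (NSpace K h))) ↔ g.val.det.order = 0 := by
  have hh := natCast_h_pos (h := h)
  obtain ⟨a, ha⟩ := exists_colSpan_le_fil g.val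
  obtain ⟨R, hR⟩ := exists_fil_le_colSpan g.isUnit
  obtain ⟨q, hq⟩ := exists_isProfile_leadSet (M := latticeOf g) ha hR
  obtain ⟨C, hC⟩ := (Set.finite_range q).bddAbove
  -- `n` is so large that `t ^ n M_0 ⊆ M` and `n h` exceeds the smallest elements of all residue
  -- classes
  set n := max |R| C with hn
  have hnR : R ≤ n * h := by
    have h1 : |R| * 1 ≤ n * h := mul_le_mul (le_max_left _ _) (by omega) (by norm_num)
      ((abs_nonneg R).trans (le_max_left _ _))
    have h2 := le_abs_self R
    linarith
  have h1 := ncard_leadSet_diff_Ici g ((fil_anti hnR).trans hR)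
  have h2 := hq.ncard_diff_Ici (n := n) fun r => (hC ⟨r, rfl⟩).trans (le_max_right _ _)
  rw [hq.isNormalized_iff]
  omega

end Volume

/-! ### Combinatorics of extended semi-modules -/

section Combinatorics

variable {m h : ℕ} [NeZero h]

/-- If `m` is prime to `h`, every residue class modulo `h` contains one of `0, m, …, (h - 1) m`. -/
lemma exists_mul_emod_eq (hmh : Nat.Coprime m h) (x : ℤ) :
    ∃ i : ℕ, i < h ∧ (i * m : ℤ) % h = x % h := by
  have hh := natCast_h_pos (h := h)
  obtain ⟨u, hu⟩ := Int.mod_coprime hmh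
  refine ⟨((x * u) % h).toNat, ?_, ?_⟩
  · have := Int.emod_lt_of_pos (x * u) hh
    omega
  · rw [Int.toNat_of_nonneg (Int.emod_nonneg _ hh.ne'), Int.mul_emod, Int.emod_emod_of_dvd _ dvd_rfl,
      ← Int.mul_emod, mul_assoc, mul_comm u, Int.mul_emod, hu, ← Int.mul_emod, mul_one]

lemma IsSemimodule.add_mul_mem {A : Set ℤ} (hA : IsSemimodule m h A) {a : ℤ} (ha : a ∈ A)
    (i : ℕ) : a + i * m ∈ A := by
  induction i with
  | zero => simpa using ha
  | succ i ih =>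
    have := hA.add_m_mem _ ih
    push_cast
    rwa [show a + ((i : ℤ) + 1) * m = a + i * m + m by ring]

lemma IsSemimodule.exists_isProfile (hmh : Nat.Coprime m h) {A : Set ℤ} (hA : IsSemimodule m h A)
    (hne : A.Nonempty) : ∃ q : Fin h → ℤ, IsProfile A q := by
  have hh := natCast_h_pos (h := h)
  refine AffineDL.exists_isProfile hA.bddBelow hA.add_h_mem fun r => ?_
  obtain ⟨a, ha⟩ := hne
  obtain ⟨i, -, hi⟩ := exists_mul_emod_eq hmh (r - a)
  have h1 := hA.add_mul_mem ha i
  refine ⟨(a + i * m) / h, ?_⟩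
  have h2 : (a + i * m) % h = ((r : ℕ) : ℤ) := by
    rw [Int.add_emod, hi, ← Int.add_emod, add_sub_cancel]
    simpa using emod_mul_add 0 r
  rw [← h2, mul_comm, Int.mul_ediv_add_emod]
  exact h1

/-- A normalized semi-module lies between two half-lines that depend only on `m` and `h`. -/
lemma IsSemimodule.bounds (hmh : Nat.Coprime m h) {A : Set ℤ} (hA : IsSemimodule m h A)
    (hne : A.Nonempty) (hnorm : IsNormalized h A) :
    A ⊆ Set.Ici (-(h * m : ℤ)) ∧ Set.Ici (h * m + h : ℤ) ⊆ A := by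
  have hh := natCast_h_pos (h := h)
  obtain ⟨q, hq⟩ := hA.exists_isProfile hmh hne
  have hsum := hq.isNormalized_iff.1 hnorm
  have hmem : ∀ r, q r * h + ((r : ℕ) : ℤ) ∈ A := fun r => (hq _ _).2 le_rfl
  -- the minima of two residue classes differ by at most `h m`
  have hdiff : ∀ r s, q r * h + ((r : ℕ) : ℤ) ≤ q s * h + ((s : ℕ) : ℤ) + h * m := by
    intro r s
    obtain ⟨i, hi, hir⟩ := exists_mul_emod_eq hmh (r - s)
    have h1 := hA.add_mul_mem (hmem s) i
    obtain ⟨c, r', hc⟩ := exists_index h (q s * h + ((s : ℕ) : ℤ) + i * m)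
    have hr' : r' = r := by
      have e := congrArg (· % (h : ℤ)) hc
      simp only [emod_mul_add] at e
      rw [Int.add_emod, hir, ← Int.add_emod,
        show q s * h + ((s : ℕ) : ℤ) + (((r : ℕ) : ℤ) - ((s : ℕ) : ℤ)) = q s * h + ((r : ℕ) : ℤ) by
          ring, emod_mul_add] at e
      exact Fin.ext (by exact_mod_cast e.symm)
    subst hr'
    rw [hc, hq] at h1
    have h2 : q r' * (h : ℤ) ≤ c * h := mul_le_mul_of_nonneg_right h1 hh.le
    have h3 : (i : ℤ) * m ≤ h * m :=
      mul_le_mul_of_nonneg_right (by exact_mod_cast hi.le) (by positivity)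
    linarith
  have hlt : ∀ r : Fin h, ((r : ℕ) : ℤ) < h := fun r => by exact_mod_cast r.2
  have hge : ∀ r : Fin h, (0 : ℤ) ≤ ((r : ℕ) : ℤ) := fun r => by positivity
  have h0 : ∃ s, q s ≤ 0 := by
    by_contra hcon
    push Not at hcon
    have : ∑ r : Fin h, (0 : ℤ) < ∑ r, q r :=
      Finset.sum_lt_sum_of_nonempty ⟨0, Finset.mem_univ _⟩ fun r _ => hcon r
    simp only [Finset.sum_const_zero] at this
    omega
  have h0' : ∃ s, 0 ≤ q s := by
    by_contra hcon
    push Not at hcon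
    have : ∑ r, q r < ∑ r : Fin h, (0 : ℤ) :=
      Finset.sum_lt_sum_of_nonempty ⟨0, Finset.mem_univ _⟩ fun r _ => hcon r
    simp only [Finset.sum_const_zero] at this
    omega
  obtain ⟨s, hs⟩ := h0
  obtain ⟨s', hs'⟩ := h0'
  constructor
  · intro a ha
    obtain ⟨c, r, rfl⟩ := exists_index h a
    have h1 := (hq c r).1 ha
    have h2 : q r * (h : ℤ) ≤ c * h := mul_le_mul_of_nonneg_right h1 hh.le
    have h3 : 0 ≤ q s' * (h : ℤ) := mul_nonneg hs' hh.le
    have h4 := hdiff s' r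
    have h5 := hge s'
    rw [Set.mem_Ici]
    linarith
  · intro a ha
    obtain ⟨c, r, rfl⟩ := exists_index h a
    rw [hq]
    have h3 : q s * (h : ℤ) ≤ 0 := mul_nonpos_of_nonpos_of_nonneg hs hh.le
    have h4 := hdiff r s
    have h5 := hlt s
    rw [Set.mem_Ici] at ha
    by_contra hcon
    have h6 : (c + 1) * (h : ℤ) ≤ q r * h := mul_le_mul_of_nonneg_right (by omega) hh.le
    linarith

variable {μ : Fin h → ℕ} {A : Set ℤ} {φ : ℤ → WithBot ℕ}

lemma IsExtendedSemimodule.nonempty (hp : IsExtendedSemimodule m h μ A φ) : A.Nonempty := by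
  obtain ⟨s, hs, -⟩ := hp.decomposition
  exact ⟨_, hs.mapsTo (Set.mem_univ (0, 0))⟩

lemma IsExtendedSemimodule.bounds (hmh : Nat.Coprime m h)
    (hp : IsExtendedSemimodule m h μ A φ) :
    A ⊆ Set.Ici (-(h * m : ℤ)) ∧ Set.Ici (h * m + h : ℤ) ⊆ A :=
  hp.semimodule.bounds hmh hp.nonempty hp.normalized

lemma IsExtendedSemimodule.mem_iff (hp : IsExtendedSemimodule m h μ A φ) {a : ℤ} :
    a ∈ A ↔ φ a ≠ ⊥ := by
  rw [Ne, hp.eq_bot_iff, not_not]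

/-- An extended semi-module is determined by finitely many values of `φ`, which are bounded. -/
lemma finite_isExtendedSemimodule (hmh : Nat.Coprime m h) (μ : Fin h → ℕ) :
    {p : Set ℤ × (ℤ → WithBot ℕ) | IsExtendedSemimodule m h μ p.1 p.2}.Finite := by
  have hh := natCast_h_pos (h := h)
  set C : ℤ := h * m + h with hC
  have hC0 : (0 : ℤ) ≤ h * m := by positivity
  -- outside `[-C, C)` the set `A` is known, and so are the values of `φ`, by the case of equality
  -- in `le_max`
  let Ψ : Set ℤ × (ℤ → WithBot ℕ) → (Set.Ico (-C) C → WithBot ℕ) := fun p a => p.2 a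
  set V : Set (WithBot ℕ) := insert ⊥ ((fun n : ℕ => (n : WithBot ℕ)) '' Set.Iic (2 * C + m).toNat)
    with hV
  have hVfin : V.Finite := ((Set.finite_Iic _).image _).insert _
  refine Set.Finite.of_finite_image (f := Ψ)
    ((Set.Finite.pi' fun _ : Set.Ico (-C) C => hVfin).subset ?_) ?_
  · rintro _ ⟨⟨A, φ⟩, hp, rfl⟩ ⟨a, ha⟩
    change φ a ∈ V
    by_cases haA : a ∈ A
    · obtain ⟨n, hn, hle, -⟩ := hp.le_max a haA
      have h1 := (hp.bounds hmh).1 hn.1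
      rw [Set.mem_Ici] at h1
      obtain ⟨e, he⟩ := WithBot.ne_bot_iff_exists.1 (hp.mem_iff.1 haA)
      right
      refine ⟨e, ?_, he⟩
      rw [← he] at hle
      have h2 : e ≤ n := WithBot.coe_le_coe.1 hle
      have h3 : (n : ℤ) * 1 ≤ n * h := mul_le_mul_of_nonneg_left (by omega) (by positivity)
      rw [Set.mem_Iic]
      have := ha.2
      omega
    · left
      exact (hp.eq_bot_iff a).2 haA
  · rintro ⟨A, φ⟩ hp ⟨A', φ'⟩ hp' heq
    replace hp : IsExtendedSemimodule m h μ A φ := hp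
    replace hp' : IsExtendedSemimodule m h μ A' φ' := hp'
    have hval : ∀ a, -C ≤ a → a < C → φ a = φ' a := fun a h1 h2 => congrFun heq ⟨a, h1, h2⟩
    have hA : A = A' := by
      ext a
      by_cases h1 : -C ≤ a
      · by_cases h2 : a < C
        · rw [hp.mem_iff, hp'.mem_iff, hval a h1 h2]
        · exact iff_of_true ((hp.bounds hmh).2 (by rw [Set.mem_Ici]; omega))
            ((hp'.bounds hmh).2 (by rw [Set.mem_Ici]; omega))
      · refine iff_of_false (fun ha => ?_) (fun ha => ?_)
        · have := (hp.bounds hmh).1 ha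
          rw [Set.mem_Ici] at this
          omega
        · have := (hp'.bounds hmh).1 ha
          rw [Set.mem_Ici] at this
          omega
    subst hA
    refine Prod.ext rfl (funext fun a => ?_)
    change φ a = φ' a
    by_cases h2 : a < C
    · by_cases h1 : -C ≤ a
      · exact hval a h1 h2
      · have ha : a ∉ A := fun ha => by
          have := (hp.bounds hmh).1 ha
          rw [Set.mem_Ici] at this
          omega
        rw [(hp.eq_bot_iff a).2 ha, (hp'.eq_bot_iff a).2 ha]
    · have hall : ∀ b, a ≤ b → b ∈ A := fun b hb =>
        (hp.bounds hmh).2 (by rw [Set.mem_Ici]; omega)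
      obtain ⟨n, hn, -, he⟩ := hp.le_max a (hall a le_rfl)
      obtain ⟨n', hn', -, he'⟩ := hp'.le_max a (hall a le_rfl)
      rw [he hall, he' hall, hn.unique hn']

end Combinatorics

section Cyclic

variable {m h : ℕ} [NeZero h]

/-- There is an extended semi-module for every `μ`: the set `A` generated under `+ h` by elements
`b 0, …, b (h - 1)` with `b (i + 1) = b i + m - μ i * h` (cyclically), with the maximal `φ`. -/
lemma exists_isExtendedSemimodule (hmh : Nat.Coprime m h) {μ : Fin h → ℕ} (hsum : ∑ i, μ i = m) :
    ∃ A φ, IsExtendedSemimodule m h μ A φ := by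
  have hh := natCast_h_pos (h := h)
  have hpos : 0 < h := Nat.pos_of_ne_zero (NeZero.ne h)
  let μ' : ℕ → ℕ := fun i => if hi : i < h then μ ⟨i, hi⟩ else 0
  -- `β i ≡ i m` modulo `h`, so that `β 0, …, β (h - 1)` represent all residue classes
  let β : ℕ → ℤ := fun i => i * m - h * ∑ j ∈ Finset.range i, (μ' j : ℤ)
  have hβ : ∀ i, β i % h = (i * m : ℤ) % h := fun i => Int.sub_mul_emod_self_left _ _ _
  have hinjβ : ∀ i j : Fin h, β i % h = β j % h → i = j := by
    intro i j e
    rw [hβ, hβ] at e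
    have h1 : ((i : ℕ) * m) ≡ (j : ℕ) * m [MOD h] := by
      rw [← Int.natCast_modEq_iff]
      push_cast
      exact e
    have h2 := Nat.ModEq.cancel_right_of_coprime (Nat.Coprime.symm hmh) h1
    exact Fin.ext (by rwa [Nat.ModEq, Nat.mod_eq_of_lt i.2, Nat.mod_eq_of_lt j.2] at h2)
  -- the shift that makes the sum of the generators equal to `h (h - 1) / 2`
  set s : ℤ := -∑ i : Fin h, β i / h with hs
  let b : Fin h → ℤ := fun i => β i + s
  have hinj : ∀ (i j : Fin h) (c d : ℤ), b i + c * h = b j + d * h → i = j ∧ c = d := by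
    intro i j c d e
    have e1 : β i = β j + (d - c) * h := by simp only [b] at e; linarith
    have h1 : i = j := hinjβ i j (by rw [e1, Int.add_mul_emod_self_right])
    subst h1
    exact ⟨rfl, mul_right_cancel₀ hh.ne' (by linarith)⟩
  have hsurj : ∀ a : ℤ, ∃ (i : Fin h) (c : ℤ), a = b i + c * h := by
    intro a
    obtain ⟨i, hi, e⟩ := exists_mul_emod_eq hmh (a - s)
    refine ⟨⟨i, hi⟩, (a - b ⟨i, hi⟩) / h, ?_⟩
    have h1 : (h : ℤ) ∣ a - b ⟨i, hi⟩ := by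
      have h2 : (a - s) % h = β i % h := by rw [hβ, e]
      have h3 := Int.ModEq.dvd (show β i ≡ a - s [ZMOD h] from h2.symm)
      simpa [b, sub_sub, add_comm] using h3
    rw [Int.ediv_mul_cancel h1]
    ring
  -- the last generator leads back to the first one because of `∑ μ i = m`
  have hnext : ∀ i : Fin h, ∃ i' : Fin h, b i + m = b i' + μ i * h := by
    intro i
    have hstep : β (i + 1) = β i + m - h * μ i := by
      have : μ' i = μ i := by simp [μ']
      simp only [β]
      rw [Finset.sum_range_succ, this]
      push_cast
      ring
    by_cases hi : (i : ℕ) + 1 < h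
    · refine ⟨⟨i + 1, hi⟩, ?_⟩
      simp only [b]
      rw [hstep]
      ring
    · refine ⟨⟨0, hpos⟩, ?_⟩
      have h1 : (i : ℕ) + 1 = h := by have := i.2; omega
      have h2 : β h = 0 := by
        have : ∑ j ∈ Finset.range h, (μ' j : ℤ) = m := by
          rw [← hsum, Nat.cast_sum, ← Fin.sum_univ_eq_sum_range (fun j => (μ' j : ℤ))]
          exact Finset.sum_congr rfl fun j _ => by simp [μ']
        simp only [β]
        rw [this]
        ring
      rw [h1, h2] at hstep
      simp only [b]
      have h3 : β 0 = 0 := by simp [β]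
      rw [h3]
      linarith
  choose nxt hnxt using hnext
  -- every `a` is of the form `b (ι a) + κ a * h`
  choose ι κ hικ using hsurj
  have hι : ∀ i c, ι (b i + c * h) = i ∧ κ (b i + c * h) = c := fun i c => by
    obtain ⟨h1, h2⟩ := hinj _ _ _ _ (hικ (b i + c * h)).symm
    exact ⟨h1, h2⟩
  let A : Set ℤ := {a | 0 ≤ κ a}
  let φ : ℤ → WithBot ℕ := fun a => if 0 ≤ κ a then ((μ (ι a) + (κ a).toNat : ℕ) : WithBot ℕ)
    else ⊥
  have hA : ∀ i c, b i + c * h ∈ A ↔ 0 ≤ c := fun i c => by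
    change 0 ≤ κ (b i + c * h) ↔ _
    rw [(hι i c).2]
  have hφ : ∀ (i : Fin h) (c : ℕ), φ (b i + c * h) = ((μ i + c : ℕ) : WithBot ℕ) := fun i c => by
    simp only [φ]
    rw [(hι i c).2, (hι i c).1, if_pos (by positivity)]
    simp
  have hφ' : ∀ (i : Fin h) (c : ℤ), c < 0 → φ (b i + c * h) = ⊥ := fun i c hc => by
    simp only [φ]
    rw [(hι i c).2, if_neg (by omega)]
  -- the images of the generators under `+ m`
  have hAm : ∀ i c (n : ℕ), b i + c * h + m - n * h ∈ A ↔ (n : ℤ) ≤ μ i + c := fun i c n => by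
    rw [show b i + c * h + m - n * h = b (nxt i) + (μ i + c - n) * h by
      have := hnxt i
      linarith, hA]
    omega
  have hseq : ∀ (i : Fin h) (j : ℕ), b i + (j : ℤ) * h + h = b i + ((j + 1 : ℕ) : ℤ) * h := by
    intro i j
    push_cast
    ring
  obtain ⟨B, hB⟩ := (Set.finite_range b).bddBelow
  refine ⟨A, φ, ⟨⟨B, fun a ha => ?_⟩, fun a ha => ?_, fun a ha => ?_⟩, ?_, fun a => ?_, fun a => ?_,
    fun a ha => ?_, ?_⟩
  · obtain ⟨i, c, rfl⟩ : ∃ i c, a = b i + c * h := ⟨_, _, hικ a⟩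
    have h1 := hB ⟨i, rfl⟩
    have h2 : 0 ≤ c * (h : ℤ) := mul_nonneg ((hA i c).1 ha) hh.le
    linarith
  · obtain ⟨i, c, rfl⟩ : ∃ i c, a = b i + c * h := ⟨_, _, hικ a⟩
    have := (hAm i c 0).2 (by have := (hA i c).1 ha; push_cast; omega)
    simpa using this
  · obtain ⟨i, c, rfl⟩ : ∃ i c, a = b i + c * h := ⟨_, _, hικ a⟩
    rw [show b i + c * h + h = b i + (c + 1) * h by ring, hA]
    have := (hA i c).1 ha
    omega
  · have hset : A \ ((fun a : ℤ => (h : ℤ) + a) '' A) = Set.range b := by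
      ext a
      obtain ⟨i, c, rfl⟩ : ∃ i c, a = b i + c * h := ⟨_, _, hικ a⟩
      constructor
      · rintro ⟨ha, hna⟩
        refine ⟨i, ?_⟩
        have h1 := (hA i c).1 ha
        have h2 : ¬ 0 ≤ c - 1 := fun hle => hna ⟨_, (hA i (c - 1)).2 hle, by ring⟩
        rw [show c = 0 by omega]
        ring
      · rintro ⟨j, hj⟩
        obtain ⟨rfl, hc⟩ := hinj j i 0 c (by rw [← hj]; ring)
        rw [← hc]
        refine ⟨(hA _ _).2 le_rfl, ?_⟩
        rintro ⟨a, ha, hEq⟩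
        have h1 : a = b j + (-1) * h := by
          simp only at hEq
          linarith
        rw [h1, hA] at ha
        omega
    rw [IsNormalized, hset, finsum_mem_range (fun i j e => (hinj i j 0 0 (by rw [e])).1),
      finsum_eq_sum_of_fintype, ← sum_emod_eq hinjβ]
    simp only [b]
    rw [Finset.sum_add_distrib, Finset.sum_const, Finset.card_univ, Fintype.card_fin, hs,
      nsmul_eq_mul, mul_neg, ← sub_eq_add_neg, Finset.mul_sum, ← Finset.sum_sub_distrib]
    refine Finset.sum_congr rfl fun i _ => ?_
    have := Int.mul_ediv_add_emod (β i) h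
    linarith
  · change φ a = ⊥ ↔ ¬ (0 ≤ κ a)
    simp only [φ]
    split_ifs with hc <;> simp [hc]
  · obtain ⟨i, c, rfl⟩ : ∃ i c, a = b i + c * h := ⟨_, _, hικ a⟩
    by_cases hc : 0 ≤ c
    · lift c to ℕ using hc
      rw [hseq, hφ, hφ]
      exact_mod_cast le_of_eq (add_assoc _ _ _)
    · rw [hφ' i c (by omega)]
      simp
  · obtain ⟨i, c, rfl⟩ : ∃ i c, a = b i + c * h := ⟨_, _, hικ a⟩
    have hc := (hA i c).1 ha
    lift c to ℕ using hc
    refine ⟨μ i + c, ⟨?_, fun n hn => ?_⟩, ?_, fun _ => ?_⟩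
    · exact (hAm i c (μ i + c)).2 (by push_cast; rfl)
    · have := (hAm i c n).1 hn
      exact_mod_cast this
    · rw [hφ]
    · rw [hφ]
  · refine ⟨fun l j => b l + (j : ℤ) * h, ⟨?_, ?_, ?_⟩, fun l j => ?_, fun l j _ => ?_,
      fun l j hne => ?_, Equiv.refl _, fun l => ?_⟩
    · rintro ⟨l, j⟩ -
      exact (hA l j).2 (by positivity)
    · rintro ⟨l, j⟩ - ⟨l', j'⟩ - e
      obtain ⟨rfl, h2⟩ := hinj _ _ _ _ e
      exact Prod.ext rfl (by exact_mod_cast h2)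
    · intro a ha
      obtain ⟨i, c, rfl⟩ : ∃ i c, a = b i + c * h := ⟨_, _, hικ a⟩
      have hc := (hA i c).1 ha
      lift c to ℕ using hc
      exact ⟨(i, c), Set.mem_univ _, rfl⟩
    · simp only
      rw [hφ, hφ]
      exact_mod_cast (add_assoc _ _ _).symm
    · exact (hseq l j).symm
    · refine absurd ?_ hne
      rw [hseq, hφ, hφ]
      exact_mod_cast (add_assoc _ _ _).symm
    · simpa using hφ l 0

end Cyclic

/-! ### Decomposition into sequences -/

section Decomposition

variable {h : ℕ} {φ : ℤ → WithBot ℕ}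

/-- Matching of level sets: the elements of level `e` are sent injectively to elements of level
`e + 1`, namely `a` to `a + h` if possible and to a larger element otherwise. The remaining elements
are matched by Hall's theorem, where only final segments have to be compared. -/
lemma exists_matching (hfin : ∀ e : ℕ, {a | φ a = e}.Finite)
    (hdom : ∀ (e : ℕ) (x : ℤ), ({a | φ a = e} ∩ Set.Ici x).ncard ≤
      ({a | φ a = (e + 1 : ℕ)} ∩ Set.Ici (x + h)).ncard) (e : ℕ) :
    ∃ s : ℤ → ℤ, Set.InjOn s {a | φ a = e} ∧ ∀ a, φ a = e → φ (s a) = (e + 1 : ℕ) ∧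
      (φ (a + h) = (e + 1 : ℕ) → s a = a + h) ∧ (φ (a + h) ≠ (e + 1 : ℕ) → a + h < s a) := by
  classical
  let F : ℕ → Finset ℤ := fun e => (hfin e).toFinset
  have hF : ∀ e a, a ∈ F e ↔ φ a = e := fun e a => by simp [F]
  -- `P` consists of the elements that cannot be sent to `a + h`, and `Q` of the possible targets of
  -- elements of `P`
  let P := (F e).filter fun a => φ (a + h) ≠ (e + 1 : ℕ)
  let Q := (F (e + 1)).filter fun c => φ (c - h) ≠ e
  -- on removing the pairs `(a, a + h)`, both sides of `hdom` decrease by the same number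
  have hcard : ∀ x : ℤ, (P.filter fun a => x ≤ a).card ≤ (Q.filter fun c => x + h ≤ c).card := by
    intro x
    have h1 : ((F e).filter fun a => x ≤ a).card ≤ ((F (e + 1)).filter fun c => x + h ≤ c).card := by
      have := hdom e x
      rw [← Set.ncard_coe_finset, ← Set.ncard_coe_finset]
      convert this using 2
      · ext a; simp [hF]
      · ext a; simp [hF]
    have h2 : ((F e).filter fun a => x ≤ a).card = (P.filter fun a => x ≤ a).card +
        ((F e).filter fun a => x ≤ a ∧ φ (a + h) = (e + 1 : ℕ)).card := by
      rw [← Finset.card_union_of_disjoint]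
      · congr 1
        ext a
        simp only [P, Finset.mem_filter, Finset.mem_union]
        tauto
      · rw [Finset.disjoint_left]
        intro a
        simp only [P, Finset.mem_filter]
        tauto
    have h3 : ((F (e + 1)).filter fun c => x + h ≤ c).card = (Q.filter fun c => x + h ≤ c).card +
        ((F (e + 1)).filter fun c => x + h ≤ c ∧ φ (c - h) = e).card := by
      rw [← Finset.card_union_of_disjoint]
      · congr 1
        ext a
        simp only [Q, Finset.mem_filter, Finset.mem_union]
        tauto
      · rw [Finset.disjoint_left]
        intro a
        simp only [Q, Finset.mem_filter]
        tauto
    have h4 : ((F e).filter fun a => x ≤ a ∧ φ (a + h) = (e + 1 : ℕ)).card =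
        ((F (e + 1)).filter fun c => x + h ≤ c ∧ φ (c - h) = e).card := by
      refine Finset.card_bij' (fun a _ => a + h) (fun c _ => c - h) ?_ ?_ ?_ ?_
      · intro a
        simp only [Finset.mem_filter, hF, add_sub_cancel_right]
        rintro ⟨h1, h2, h3⟩
        exact ⟨h3, by omega, h1⟩
      · intro a
        simp only [Finset.mem_filter, hF, sub_add_cancel]
        rintro ⟨h1, h2, h3⟩
        exact ⟨h3, by omega, h1⟩
      · intro a _; ring
      · intro a _; ring
    omega
  obtain ⟨f, hfinj, hf⟩ := (Finset.all_card_le_biUnion_card_iff_exists_injective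
    (fun a : P => Q.filter fun c => (a : ℤ) + h ≤ c)).1 (by
      -- the targets admissible for some element of `s` are those admissible for its minimum
      intro s
      rcases s.eq_empty_or_nonempty with rfl | hs
      · simp
      · obtain ⟨x, hx, hmin⟩ := Finset.exists_min_image s (fun a => (a : ℤ)) hs
        calc s.card = (s.map (Function.Embedding.subtype _)).card := (Finset.card_map _).symm
          _ ≤ (P.filter fun a => (x : ℤ) ≤ a).card := by
            refine Finset.card_le_card fun a ha => ?_
            obtain ⟨b, hb, rfl⟩ := Finset.mem_map.1 ha
            exact Finset.mem_filter.2 ⟨b.2, hmin b hb⟩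
          _ ≤ _ := hcard x
          _ ≤ _ := Finset.card_le_card (Finset.subset_biUnion_of_mem
            (fun a : P => Q.filter fun c => (a : ℤ) + h ≤ c) hx))
  have hP : ∀ a, a ∈ P ↔ φ a = e ∧ φ (a + h) ≠ (e + 1 : ℕ) := fun a => by simp [P, hF]
  have hQ : ∀ a : P, φ (f a) = (e + 1 : ℕ) ∧ φ (f a - h) ≠ e ∧ (a : ℤ) + h ≤ f a := fun a => by
    have := hf a
    simp only [Q, Finset.mem_filter, hF] at this
    exact ⟨this.1.1, this.1.2, this.2⟩
  refine ⟨fun a => if ha : a ∈ P then f ⟨a, ha⟩ else a + h, ?_, ?_⟩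
  · intro a ha b hb hab
    rw [Set.mem_ofPred_eq] at ha hb
    simp only at hab
    split_ifs at hab with h1 h2 h2
    · exact congrArg Subtype.val (hfinj hab)
    · exact absurd (by rw [hab, add_sub_cancel_right]; exact hb) (hQ ⟨a, h1⟩).2.1
    · exact absurd (by rw [← hab, add_sub_cancel_right]; exact ha) (hQ ⟨b, h2⟩).2.1
    · omega
  · intro a ha
    by_cases h1 : a ∈ P
    · simp only [dif_pos h1]
      have h2 := hQ ⟨a, h1⟩
      have h3 := ((hP a).1 h1).2
      refine ⟨h2.1, fun h4 => absurd h4 h3, fun _ => lt_of_le_of_ne h2.2.2 fun h4 => ?_⟩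
      rw [← h4] at h2
      exact h3 h2.1
    · simp only [dif_neg h1]
      have h2 : φ (a + h) = (e + 1 : ℕ) := by
        by_contra h2
        exact h1 ((hP a).2 ⟨ha, h2⟩)
      exact ⟨h2, by simp, fun h3 => absurd h2 h3⟩

/-- Numerical conditions that allow to decompose `A` into sequences. The matchings of consecutive
levels yield a successor map, and the counts `hcount` say how many sequences start in each level.
-/
lemma exists_decomposition {μ : Fin h → ℕ} (hfin : ∀ e : ℕ, {a | φ a = e}.Finite)
    (hcount : ∀ e : ℕ, {a | φ a = e}.ncard = (Finset.univ.filter fun i => μ i ≤ e).card)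
    (hdom : ∀ (e : ℕ) (x : ℤ), ({a | φ a = e} ∩ Set.Ici x).ncard ≤
      ({a | φ a = (e + 1 : ℕ)} ∩ Set.Ici (x + h)).ncard) :
    ∃ s : Fin h → ℕ → ℤ,
      Set.BijOn (fun p : Fin h × ℕ => s p.1 p.2) Set.univ {a | φ a ≠ ⊥} ∧
      (∀ l j, φ (s l (j + 1)) = φ (s l j) + 1) ∧
      (∀ l j, φ (s l j + h) = φ (s l j) + 1 → s l (j + 1) = s l j + h) ∧
      (∀ l j, φ (s l j + h) ≠ φ (s l j) + 1 → s l j + h < s l (j + 1)) ∧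
      ∃ π : Equiv.Perm (Fin h), ∀ l, φ (s l 0) = (μ (π l) : WithBot ℕ) := by
  classical
  choose σ hσinj hσ using exists_matching hfin hdom
  have hval : ∀ a, φ a ≠ ⊥ → ∃ e : ℕ, φ a = e := fun a ha => by
    obtain ⟨e, he⟩ := WithBot.ne_bot_iff_exists.1 ha
    exact ⟨e, he.symm⟩
  have hcast : ∀ e : ℕ, ((e + 1 : ℕ) : WithBot ℕ) = (e : WithBot ℕ) + 1 := fun e => by push_cast; rfl
  -- the level of an element
  let lv : ℤ → ℕ := fun a => (φ a).unbotD 0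
  have hlv : ∀ a e, φ a = (e : ℕ) → lv a = e := fun a e he => by
    simp only [lv]
    rw [he]
    rfl
  -- the successor of an element
  let S : ℤ → ℤ := fun a => σ (lv a) a
  have hS : ∀ a (e : ℕ), φ a = e → S a = σ e a := fun a e he => by
    simp only [S]
    rw [hlv a e he]
  have hSφ : ∀ a (e : ℕ), φ a = e → φ (S a) = (e + 1 : ℕ) := fun a e he => by
    rw [hS a e he]
    exact (hσ e a he).1
  have hSinj : ∀ a b, φ a ≠ ⊥ → φ b ≠ ⊥ → S a = S b → a = b := by
    intro a b ha hb hab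
    obtain ⟨e, he⟩ := hval a ha
    obtain ⟨e', he'⟩ := hval b hb
    have h1 := hSφ a e he
    rw [hab, hSφ b e' he'] at h1
    have h2 : e' = e := by
      have : e' + 1 = e + 1 := by exact_mod_cast h1
      omega
    subst h2
    rw [hS a e' he, hS b e' he'] at hab
    exact hσinj e' he he' hab
  -- the elements without predecessor, at which the sequences start
  let Q : Set ℤ := {a | φ a ≠ ⊥ ∧ ∀ b, φ b ≠ ⊥ → S b ≠ a}
  have hnb : ∀ a (e : ℕ), φ a = e → φ a ≠ ⊥ := fun a e he => by
    rw [he]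
    exact WithBot.natCast_ne_bot e
  have hQcount : ∀ e : ℕ, (Q ∩ {a | φ a = e}).ncard =
      (Finset.univ.filter fun i => μ i = e).card := by
    intro e
    rcases e with _ | e
    · have : Q ∩ {a | φ a = (0 : ℕ)} = {a | φ a = (0 : ℕ)} := by
        refine Set.inter_eq_right.2 fun a ha => ⟨hnb a 0 ha, fun b hb hba => ?_⟩
        obtain ⟨e, he⟩ := hval b hb
        have h1 := hSφ b e he
        rw [hba, (show φ a = _ from ha)] at h1
        have : 0 = e + 1 := by exact_mod_cast h1
        omega
      rw [this, hcount]
      simp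
    · have h1 : {a | φ a = (e + 1 : ℕ)} = S '' {a | φ a = e} ∪ (Q ∩ {a | φ a = (e + 1 : ℕ)}) := by
        ext a
        constructor
        · intro ha
          by_cases haQ : a ∈ Q
          · exact Or.inr ⟨haQ, ha⟩
          · left
            have : ∃ b, φ b ≠ ⊥ ∧ S b = a := by
              by_contra hcon
              push Not at hcon
              exact haQ ⟨hnb a _ ha, hcon⟩
            obtain ⟨b, hb, rfl⟩ := this
            obtain ⟨e', he'⟩ := hval b hb
            have h2 := hSφ b e' he'
            rw [(show φ (S b) = _ from ha)] at h2
            have h3 : e + 1 = e' + 1 := by exact_mod_cast h2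
            obtain rfl : e = e' := by omega
            exact ⟨b, he', rfl⟩
        · rintro (⟨b, hb, rfl⟩ | ha)
          · exact hSφ b e hb
          · exact ha.2
      have h2 : (S '' {a | φ a = e}).ncard = {a | φ a = e}.ncard :=
        Set.InjOn.ncard_image fun a ha b hb hab => hSinj a b (hnb a e ha) (hnb b e hb) hab
      have h3 := congrArg Set.ncard h1
      rw [Set.ncard_union_eq _ ((hfin e).image S) ((hfin (e + 1)).inter_of_right Q), h2, hcount,
        hcount] at h3
      · have h4 : (Finset.univ.filter fun i => μ i ≤ e + 1).card =
            (Finset.univ.filter fun i => μ i ≤ e).card +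
              (Finset.univ.filter fun i => μ i = e + 1).card := by
          rw [Finset.card_filter, Finset.card_filter, Finset.card_filter,
            ← Finset.sum_add_distrib]
          refine Finset.sum_congr rfl fun i _ => ?_
          split_ifs <;> omega
        omega
      · rw [Set.disjoint_left]
        rintro _ ⟨b, hb, rfl⟩ ⟨hQb, -⟩
        exact hQb.2 b (hnb b e hb) rfl
  have hfib : ∀ e : ℕ, Nat.card {x : Q // lv x = e} = (Q ∩ {a | φ a = e}).ncard := by
    intro e
    rw [← Nat.card_coe_set_eq]
    refine Nat.card_congr ⟨fun x => ⟨x.1, x.1.2, ?_⟩, fun x => ⟨⟨x, x.2.1⟩, hlv _ _ x.2.2⟩,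
      fun _ => rfl, fun _ => rfl⟩
    obtain ⟨e', he'⟩ := hval x.1 x.1.2.1
    have h1 := hlv _ _ he'
    rw [x.2] at h1
    rw [Set.mem_ofPred_eq, he', h1]
  have hfibfin : ∀ e : ℕ, Finite {x : Q // lv x = e} := by
    intro e
    have : Finite (Q ∩ {a | φ a = e} : Set ℤ) := (hfin e).inter_of_right Q
    refine Finite.of_injective (β := (Q ∩ {a | φ a = e} : Set ℤ)) (fun x => ⟨x.1, x.1.2, ?_⟩) ?_
    · obtain ⟨e', he'⟩ := hval x.1 x.1.2.1
      have h1 := hlv _ _ he'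
      rw [x.2] at h1
      rw [Set.mem_ofPred_eq, he', h1]
    · intro x y hxy
      exact Subtype.ext (Subtype.ext (congrArg (fun z : (Q ∩ {a | φ a = e} : Set ℤ) => (z : ℤ)) hxy))
  -- the starting points are indexed such that the `l`-th one has level `μ l`
  obtain ⟨E, hE⟩ := exists_equiv_of_natCard_fiber_eq μ (fun x : Q => lv x)
    (fun _ => inferInstance) hfibfin (fun e => by
      rw [hfib, hQcount, Nat.card_eq_fintype_card, Fintype.card_subtype])
  have hE0 : ∀ l, φ (E l) = (μ l : ℕ) := fun l => by
    obtain ⟨e, he⟩ := hval _ (E l).2.1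
    rw [he, ← hE l, hlv _ _ he]
  let s : Fin h → ℕ → ℤ := fun l j => S^[j] (E l)
  have hs : ∀ l j, s l (j + 1) = S (s l j) := fun l j => Function.iterate_succ_apply' S j _
  have hφs : ∀ l j, φ (s l j) = (μ l + j : ℕ) := by
    intro l j
    induction j with
    | zero => exact hE0 l
    | succ j ih => rw [hs, hSφ _ _ ih]; rfl
  refine ⟨s, ⟨?_, ?_, ?_⟩, fun l j => ?_, fun l j hlj => ?_, fun l j hlj => ?_, Equiv.refl _, hE0⟩
  · rintro ⟨l, j⟩ -
    exact hnb _ _ (hφs l j)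
  · have key : ∀ j j' l l', s l j = s l' j' → l = l' ∧ j = j' := by
      intro j
      induction j with
      | zero =>
        intro j' l l' e
        rcases j' with _ | j'
        · exact ⟨E.injective (Subtype.ext e), rfl⟩
        · exact absurd ((hs l' j').symm.trans e.symm) ((E l).2.2 _ (hnb _ _ (hφs l' j')))
      | succ j ih =>
        intro j' l l' e
        rcases j' with _ | j'
        · exact absurd ((hs l j).symm.trans e) ((E l').2.2 _ (hnb _ _ (hφs l j)))
        · rw [hs, hs] at e
          obtain ⟨h1, h2⟩ := ih j' l l' (hSinj _ _ (hnb _ _ (hφs l j)) (hnb _ _ (hφs l' j')) e)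
          exact ⟨h1, by rw [h2]⟩
    rintro ⟨l, j⟩ - ⟨l', j'⟩ - e
    obtain ⟨rfl, rfl⟩ := key _ _ _ _ e
    rfl
  · have key : ∀ e : ℕ, ∀ a, φ a = e → ∃ l j, s l j = a := by
      have hstart : ∀ a ∈ Q, ∃ l j, s l j = a := fun a ha =>
        ⟨E.symm ⟨a, ha⟩, 0, by simp [s]⟩
      intro e
      induction e with
      | zero =>
        intro a ha
        have h1 : a ∈ Q := by
          refine ⟨hnb a 0 ha, fun b hb hba => ?_⟩
          obtain ⟨e, he⟩ := hval b hb
          have h1 := hSφ b e he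
          rw [hba, ha] at h1
          have : 0 = e + 1 := by exact_mod_cast h1
          omega
        exact hstart a h1
      | succ e ih =>
        intro a ha
        by_cases haQ : a ∈ Q
        · exact hstart a haQ
        · have : ∃ b, φ b ≠ ⊥ ∧ S b = a := by
            by_contra hcon
            push Not at hcon
            exact haQ ⟨hnb a _ ha, hcon⟩
          obtain ⟨b, hb, rfl⟩ := this
          obtain ⟨e', he'⟩ := hval b hb
          have h2 := hSφ b e' he'
          rw [ha] at h2
          have h3 : e + 1 = e' + 1 := by exact_mod_cast h2
          obtain rfl : e = e' := by omega
          obtain ⟨l, j, rfl⟩ := ih b he'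
          exact ⟨l, j + 1, hs l j⟩
    intro a ha
    obtain ⟨e, he⟩ := hval a ha
    obtain ⟨l, j, hlj⟩ := key e a he
    exact ⟨(l, j), Set.mem_univ _, hlj⟩
  · rw [hφs, hφs, ← hcast]
    rfl
  · rw [hφs, ← hcast] at hlj
    rw [hs, hS _ _ (hφs l j)]
    exact (hσ _ _ (hφs l j)).2.1 hlj
  · rw [hφs, ← hcast] at hlj
    rw [hs, hS _ _ (hφs l j)]
    exact (hσ _ _ (hφs l j)).2.2 hlj

variable {m : ℕ} {μ : Fin h → ℕ} {A : Set ℤ}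

/-- The sequences of an extended semi-module determine the number of elements of each level. -/
lemma IsExtendedSemimodule.finite_and_ncard_lt (hp : IsExtendedSemimodule m h μ A φ) (e : ℕ) :
    {a | φ a ≠ ⊥ ∧ φ a < e}.Finite ∧ {a | φ a ≠ ⊥ ∧ φ a < e}.ncard = ∑ i, (e - μ i) := by
  obtain ⟨s, hs, hstep, -, -, π, hπ⟩ := hp.decomposition
  have hφs : ∀ l j, φ (s l j) = (μ (π l) + j : ℕ) := by
    intro l j
    induction j with
    | zero => exact hπ l
    | succ j ih =>
      rw [hstep, ih]
      push_cast
      rw [add_assoc]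
  have hset : {a | φ a ≠ ⊥ ∧ φ a < e} = (fun p : (Σ _ : Fin h, ℕ) => s p.1 p.2) ''
      ((Finset.univ.sigma fun l : Fin h => Finset.range (e - μ (π l)) :
        Finset (Σ _ : Fin h, ℕ)) : Set (Σ _ : Fin h, ℕ)) := by
    ext a
    constructor
    · rintro ⟨h1, h2⟩
      have ha : a ∈ A := by
        by_contra ha
        exact h1 ((hp.eq_bot_iff a).2 ha)
      obtain ⟨⟨l, j⟩, -, rfl⟩ := hs.surjOn ha
      refine ⟨⟨l, j⟩, ?_, rfl⟩
      simp only [hφs] at h2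
      have h3 : μ (π l) + j < e := by exact_mod_cast h2
      simp only [Finset.mem_coe, Finset.mem_sigma, Finset.mem_univ, Finset.mem_range, true_and]
      omega
    · rintro ⟨⟨l, j⟩, hlj, rfl⟩
      simp only [Finset.mem_coe, Finset.mem_sigma, Finset.mem_univ, Finset.mem_range,
        true_and] at hlj
      simp only [Set.mem_ofPred_eq, hφs]
      refine ⟨WithBot.natCast_ne_bot _, ?_⟩
      have : μ (π l) + j < e := by omega
      exact_mod_cast this
  rw [hset]
  refine ⟨(Finset.finite_toSet _).image _, ?_⟩
  rw [Set.ncard_image_of_injective, Set.ncard_coe_finset, Finset.card_sigma]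
  · simp only [Finset.card_range]
    exact Equiv.sum_comp π fun i => e - μ i
  · rintro ⟨l, j⟩ ⟨l', j'⟩ e
    have := hs.injOn (Set.mem_univ (l, j)) (Set.mem_univ (l', j')) e
    simp only [Prod.mk.injEq] at this
    obtain ⟨rfl, rfl⟩ := this
    rfl

end Decomposition

/-! ### Lattices and extended semi-modules -/

section Strata

variable {k K : Type*} [Field k] [Fintype k] [Field K] [Algebra k K] {m h : ℕ} [NeZero h]

lemma leadSet_inf_fil (V : Submodule K (NSpace K h)) (x : ℤ) :
    leadSet ((V ⊓ asSub (fil K h x) : Submodule K (NSpace K h)) : Set (NSpace K h)) =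
      leadSet (V : Set (NSpace K h)) ∩ Set.Ici x := by
  ext a
  constructor
  · rintro ⟨v, ⟨hv, hx⟩, ha⟩
    refine ⟨⟨v, hv, ha⟩, ?_⟩
    by_contra hlt
    exact ha.1 (hx a (not_le.1 hlt))
  · rintro ⟨⟨v, hv, ha⟩, hx⟩
    exact ⟨v, ⟨hv, fun i hi => ha.2 i (hi.trans_le hx)⟩, ha⟩

lemma fil_le_level {M : OSubmodule K h} {R R' : ℤ} {e : ℕ} (hR : fil K h R ≤ M) (h1 : R ≤ R')
    (h2 : R + e * h - m ≤ R') : asSub (fil K h R') ≤ level k m e (asSub M) := by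
  intro v hv
  refine ⟨hR (fil_anti h1 hv), hR fun i hi => ?_⟩
  rw [eCoeff_tbSigma, hv _ (by omega), zero_pow Fintype.card_ne_zero]

lemma exists_fil_le_level {M : OSubmodule K h} {R : ℤ} (e : ℕ) (hR : fil K h R ≤ M) :
    ∃ R', asSub (fil K h R') ≤ level k m e (asSub M) :=
  ⟨_, fil_le_level hR (le_max_left _ _) (le_max_right _ _)⟩

lemma level_le (e : ℕ) (V : Submodule K (NSpace K h)) : level k m e V ≤ V := fun _ hv => hv.1

lemma finite_leadSet_diff_level {M : OSubmodule K h} {a R : ℤ} (ha : M ≤ fil K h a)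
    (hR : fil K h R ≤ M) (e : ℕ) : (leadSet (M : Set (NSpace K h)) \
      leadSet (level k m e (asSub M) : Set (NSpace K h))).Finite := by
  obtain ⟨R', hR'⟩ := exists_fil_le_level (k := k) (m := m) e hR
  refine (Set.finite_Ico a R').subset ?_
  rintro b ⟨hb, hnb⟩
  constructor
  · have := leadSet_mono (S := (M : Set (NSpace K h))) (T := fil K h a) ha hb
    rwa [leadSet_fil] at this
  · by_contra hlt
    have : b ∈ leadSet (fil K h R' : Set (NSpace K h)) := by
      rw [leadSet_fil]
      exact not_lt.1 hlt
    exact hnb (leadSet_mono hR' this)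

lemma latticePhi_eq_iff {M : OSubmodule K h} {a₀ : ℤ} (hM : M ≤ fil K h a₀) (a : ℤ) (e : ℕ) :
    latticePhi k m M a = e ↔ a ∈ leadSet (level k m e (asSub M) : Set (NSpace K h)) \
      leadSet (level k m (e + 1) (asSub M) : Set (NSpace K h)) := by
  rw [Set.mem_sdiff, ← le_latticePhi_iff hM, ← le_latticePhi_iff hM]
  cases latticePhi k m M a with
  | bot =>
    exact iff_of_false (fun H => WithBot.natCast_ne_bot e H.symm)
      (fun H => WithBot.natCast_ne_bot e (le_bot_iff.1 H.1))
  | coe n =>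
    constructor
    · intro H
      have H' : n = e := WithBot.coe_injective H
      subst H'
      exact ⟨le_rfl, fun H2 => by
        have : n + 1 ≤ n := WithBot.coe_le_coe.1 H2
        omega⟩
    · rintro ⟨H1, H2⟩
      have h1 : e ≤ n := WithBot.coe_le_coe.1 H1
      have h2 : ¬ e + 1 ≤ n := fun H => H2 (WithBot.coe_le_coe.2 H)
      have : n = e := by omega
      rw [this]
      rfl

lemma latticePhi_ne_bot_iff {M : OSubmodule K h} {a₀ : ℤ} (hM : M ≤ fil K h a₀) (a : ℤ) :
    latticePhi k m M a ≠ ⊥ ↔ a ∈ leadSet (level k m 0 (asSub M) : Set (NSpace K h)) := by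
  rw [← le_latticePhi_iff hM]
  cases latticePhi k m M a with
  | bot => exact iff_of_false (fun H => H rfl) (fun H => WithBot.natCast_ne_bot 0 (le_bot_iff.1 H))
  | coe n => exact iff_of_true WithBot.coe_ne_bot (WithBot.coe_le_coe.2 (Nat.zero_le n))

/-- Multiplication by `t` embeds `L_e / L_{e+1}` into `L_{e+1} / L_{e+2}`, compatibly with the
filtration by leading indices. -/
lemma ncard_latticePhi_eq_le {M : OSubmodule K h} {a₀ R : ℤ} (hM : M ≤ fil K h a₀)
    (hR : fil K h R ≤ M) (e : ℕ) (x : ℤ) :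
    ({a | latticePhi k m M a = e} ∩ Set.Ici x).ncard ≤
      ({a | latticePhi k m M a = (e + 1 : ℕ)} ∩ Set.Ici (x + h)).ncard := by
  set W : Submodule K (NSpace K h) := level k m (e + 2) (asSub M) ⊓ asSub (fil K h (x + h)) with hW
  set V₁ : Submodule K (NSpace K h) := level k m e (asSub M) ⊓ asSub (fil K h x) with hV₁
  set V₂ : Submodule K (NSpace K h) := level k m (e + 1) (asSub M) ⊓ asSub (fil K h (x + h)) with hV₂
  let T : NSpace K h →ₗ[K] NSpace K h :=
    { toFun := fun v => (PowerSeries.X : PowerSeries K) • v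
      map_add' := fun v w => smul_add _ _ _
      map_smul' := fun c v => smul_comm _ _ _ }
  -- `f₁` is induced by multiplication by `t`, so its range is contained in that of `f₂`
  let f₁ : V₁ →ₗ[K] NSpace K h ⧸ W := W.mkQ ∘ₗ T ∘ₗ V₁.subtype
  let f₂ : V₂ →ₗ[K] NSpace K h ⧸ W := W.mkQ ∘ₗ V₂.subtype
  have hf₁ : ∀ v : V₁, f₁ v = 0 ↔ (PowerSeries.X : PowerSeries K) • (v : NSpace K h) ∈ W :=
    fun v => Submodule.Quotient.mk_eq_zero W
  have hf₂ : ∀ v : V₂, f₂ v = 0 ↔ (v : NSpace K h) ∈ W := fun v => Submodule.Quotient.mk_eq_zero W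
  have hXfil : ∀ v : NSpace K h, v ∈ fil K h x →
      (PowerSeries.X : PowerSeries K) • v ∈ fil K h (x + h) := by
    intro v hv i hi
    rw [eCoeff_X_smul]
    exact hv _ (by omega)
  have hmem : ∀ v : V₁, f₁ v = 0 ↔ (v : NSpace K h) ∈ level k m (e + 1) (asSub M) := by
    rintro ⟨v, ⟨hv1, hv2⟩, hv3⟩
    rw [hf₁]
    constructor
    · rintro ⟨⟨-, h2⟩, -⟩
      rw [tbSigma_X_smul] at h2
      exact ⟨hv1, h2⟩
    · rintro ⟨-, h2⟩
      refine ⟨⟨M.smul_mem _ hv1, ?_⟩, hXfil v hv3⟩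
      rw [tbSigma_X_smul]
      exact h2
  have hker₁ : kerSet V₁ f₁ =
      (level k m (e + 1) (asSub M) ⊓ asSub (fil K h x) : Submodule K (NSpace K h)) := by
    ext v
    constructor
    · rintro ⟨hv, h0⟩
      exact ⟨(hmem ⟨v, hv⟩).1 h0, hv.2⟩
    · rintro ⟨h1, h2⟩
      have hv : v ∈ V₁ := ⟨level_succ_le e M h1, h2⟩
      exact ⟨hv, (hmem ⟨v, hv⟩).2 h1⟩
  have hker₂ : kerSet V₂ f₂ = W := by
    ext v
    constructor
    · rintro ⟨hv, h0⟩
      exact (hf₂ ⟨v, hv⟩).1 h0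
    · intro h1
      have hv : v ∈ V₂ := ⟨level_succ_le (e + 1) M h1.1, h1.2⟩
      exact ⟨hv, (hf₂ ⟨v, hv⟩).2 h1⟩
  obtain ⟨R₁, hR₁⟩ := exists_fil_le_level (k := k) (m := m) (e + 1) hR
  obtain ⟨R₂, hR₂⟩ := exists_fil_le_level (k := k) (m := m) (e + 2) hR
  have h₁ := ncard_leadSet_diff V₁ f₁ (a := a₀) (R := R₁) (fun v hv => hM hv.1.1)
    (fun v hv => (hmem v).2 (hR₁ hv))
  have h₂ := ncard_leadSet_diff V₂ f₂ (a := a₀) (R := R₂) (fun v hv => hM hv.1.1)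
    (fun v hv => (hf₂ v).2 ⟨hR₂ hv, v.2.2⟩)
  have hset : ∀ (d : ℕ) (y : ℤ), {a | latticePhi k m M a = d} ∩ Set.Ici y =
      leadSet ((level k m d (asSub M) ⊓ asSub (fil K h y) : Submodule K (NSpace K h)) :
        Set (NSpace K h)) \ leadSet ((level k m (d + 1) (asSub M) ⊓ asSub (fil K h y) :
          Submodule K (NSpace K h)) : Set (NSpace K h)) := by
    intro d y
    rw [leadSet_inf_fil, leadSet_inf_fil]
    ext a
    rw [Set.mem_inter_iff, Set.mem_ofPred_eq, latticePhi_eq_iff hM]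
    simp only [Set.mem_sdiff, Set.mem_inter_iff]
    tauto
  rw [hset, hset, ← hker₁, ← hV₁, ← hV₂, ← hW, ← hker₂, h₁.2.2, h₂.2.2]
  have := h₂.2.1
  apply Submodule.finrank_mono
  rintro _ ⟨v, rfl⟩
  refine ⟨⟨(PowerSeries.X : PowerSeries K) • (v : NSpace K h),
    ⟨M.smul_mem _ v.2.1.1, ?_⟩, hXfil _ v.2.2⟩, rfl⟩
  rw [tbSigma_X_smul]
  exact v.2.1.2

lemma fil_le_of_Ici_subset {M : OSubmodule K h} {a R : ℤ} (hR : fil K h R ≤ M)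
    (ha : Set.Ici a ⊆ leadSet (M : Set (NSpace K h))) : fil K h a ≤ M := by
  have h1 : asSub (fil K h a) ⊓ asSub M ≤ asSub (fil K h a) := inf_le_left
  have h2 : asSub (fil K h a) ≤ asSub M := by
    refine (le_of_leadSet_subset h1 (R := R) (fun v hv hvR => ⟨hv, hR hvR⟩) ?_).trans inf_le_right
    rw [inf_comm, leadSet_inf_fil, Submodule.coe_restrictScalars, leadSet_fil]
    exact fun b hb => ⟨ha hb, hb⟩
  exact h2

/-- If the codimensions of the spaces `L_e(M)` are those prescribed by `μ`, then `M` defines an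
extended semi-module. -/
lemma isExtendedSemimodule_of_levelCodim [IsAlgClosed K] {μ : Fin h → ℕ} {M : OSubmodule K h}
    {a₀ R : ℤ} (hM : M ≤ fil K h a₀) (hR : fil K h R ≤ M)
    (hnorm : IsNormalized h (leadSet (M : Set (NSpace K h))))
    (hcod : ∀ e, levelCodim k m e (asSub M) = ∑ i, (e - μ i)) :
    IsExtendedSemimodule m h μ (latticeA M) (latticePhi k m M) := by
  have hh := natCast_h_pos (h := h)
  rw [latticeA_eq]
  have hfin := fun e => finite_leadSet_diff_level (k := k) (m := m) hM hR e
  -- `levelCodim 0 = 0` means that `M` is stable under `bσ`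
  have hstable : level k m 0 (asSub M) = asSub M := by
    refine le_antisymm (level_le _ _) ?_
    obtain ⟨R', hR'⟩ := exists_fil_le_level (k := k) (m := m) 0 hR
    refine le_of_leadSet_subset (level_le _ _) (R := R') (fun v _ hv => hR' hv) ?_
    have h0 := hcod 0
    rw [levelCodim, Finset.sum_eq_zero fun i _ => Nat.zero_sub _] at h0
    exact Set.sdiff_eq_empty.1 ((Set.ncard_eq_zero (hfin 0)).1 h0)
  have hbot : ∀ a, latticePhi k m M a ≠ ⊥ ↔ a ∈ leadSet (M : Set (NSpace K h)) := by
    intro a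
    rw [latticePhi_ne_bot_iff hM, hstable]
    rfl
  have hlead : ∀ {v : NSpace K h} {a : ℤ} {e : ℕ}, IsLead v a → tbSigma k m e v ∈ M →
      a + m - e * h ∈ leadSet (M : Set (NSpace K h)) :=
    fun hl hv => ⟨_, hv, (isLead_tbSigma k).2 hl⟩
  refine ⟨⟨bddBelow_leadSet hM, ?_, fun a => leadSet_add_h M⟩, hnorm, ?_, ?_, ?_, ?_⟩
  · rintro a ⟨v, hv, hl⟩
    have hv' : v ∈ level k m 0 (asSub M) := by rw [hstable]; exact hv
    simpa using hlead hl hv'.2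
  · intro a
    rw [← hbot, not_not]
  · intro a
    cases hφ : latticePhi k m M a with
    | bot => simp
    | coe n =>
      have h1 : a ∈ leadSet (level k m n (asSub M) : Set (NSpace K h)) :=
        (le_latticePhi_iff hM a n).1 (by rw [hφ]; exact le_rfl)
      obtain ⟨v, ⟨hv1, hv2⟩, hl⟩ := h1
      have h2 : ((n + 1 : ℕ) : WithBot ℕ) ≤ latticePhi k m M (a + h) :=
        (le_latticePhi_iff hM _ _).2 ⟨_, ⟨M.smul_mem _ hv1, by
          rw [tbSigma_X_smul]; exact hv2⟩, isLead_X_smul.2 hl⟩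
      exact h2
  · intro a ha
    obtain ⟨n₀, hn₀⟩ := WithBot.ne_bot_iff_exists.1 ((hbot a).2 ha)
    have hbdd := bddBelow_leadSet hM
    obtain ⟨B, hB⟩ := hbdd
    set S := {n : ℕ | a + m - n * h ∈ leadSet (M : Set (NSpace K h))} with hS
    have hle : ∀ e : ℕ, (e : WithBot ℕ) ≤ latticePhi k m M a → e ∈ S := by
      intro e he
      obtain ⟨v, ⟨-, hv2⟩, hl⟩ := (le_latticePhi_iff hM a e).1 he
      exact hlead hl hv2
    have hSfin : S.Finite := by
      refine (Set.finite_Iic (a + m - B).toNat).subset fun n hn => ?_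
      have h1 := hB hn
      have h2 : (n : ℤ) * 1 ≤ n * h := mul_le_mul_of_nonneg_left (by omega) (by positivity)
      rw [Set.mem_Iic]
      omega
    have hSne : S.Nonempty := ⟨n₀, hle n₀ hn₀.le⟩
    obtain ⟨n, hn⟩ : ∃ n, IsGreatest S n :=
      ⟨sSup S, Nat.sSup_mem hSne hSfin.bddAbove, fun x hx => le_csSup hSfin.bddAbove hx⟩
    refine ⟨n, hn, ?_, fun hall => ?_⟩
    · rw [← hn₀]
      exact WithBot.coe_le_coe.2 (hn.2 (hle n₀ hn₀.le))
    · refine le_antisymm ?_ ?_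
      · rw [← hn₀]
        exact WithBot.coe_le_coe.2 (hn.2 (hle n₀ hn₀.le))
      · rw [le_latticePhi_iff hM]
        -- lift a vector of `M` with leading index `a + m - n h`; its preimage lies in `M` since
        -- `M` contains everything from `a` on
        have hfa : fil K h a ≤ M := fil_le_of_Ici_subset hR fun b hb => hall b hb
        obtain ⟨w, hw, hl⟩ := hn.1
        obtain ⟨v, rfl⟩ := exists_tbSigma_eq (m := m) k n w
        have hl' := (isLead_tbSigma k).1 hl
        exact ⟨v, ⟨hfa fun i hi => hl'.2 i hi, hw⟩, hl'⟩
  · have hφfin : ∀ e : ℕ, {a | latticePhi k m M a = e}.Finite := by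
      intro e
      refine (hfin (e + 1)).subset fun a ha => ?_
      have := (latticePhi_eq_iff hM a e).1 ha
      exact ⟨leadSet_mono (level_le _ _) this.1, this.2⟩
    -- the number of elements of level `e` is `levelCodim (e + 1) - levelCodim e`
    have hcount : ∀ e : ℕ, {a | latticePhi k m M a = e}.ncard =
        (Finset.univ.filter fun i => μ i ≤ e).card := by
      intro e
      have h1 := card_filter_le_add_sum_tsub μ e
      rw [← hcod e, ← hcod (e + 1)] at h1
      have h2 : leadSet (asSub M : Set (NSpace K h)) \
          leadSet (level k m (e + 1) (asSub M) : Set (NSpace K h)) =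
          {a | latticePhi k m M a = e} ∪ (leadSet (asSub M : Set (NSpace K h)) \
            leadSet (level k m e (asSub M) : Set (NSpace K h))) := by
        ext a
        have h3 : a ∈ leadSet (level k m e (asSub M) : Set (NSpace K h)) →
            a ∈ leadSet (asSub M : Set (NSpace K h)) := fun h => leadSet_mono (level_le _ _) h
        have h4 : a ∈ leadSet (level k m (e + 1) (asSub M) : Set (NSpace K h)) →
            a ∈ leadSet (level k m e (asSub M) : Set (NSpace K h)) :=
          fun h => leadSet_mono (level_succ_le e M) h
        rw [Set.mem_union, Set.mem_ofPred_eq, latticePhi_eq_iff hM]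
        simp only [Set.mem_sdiff]
        tauto
      have h5 : Disjoint {a | latticePhi k m M a = e} (leadSet (asSub M : Set (NSpace K h)) \
            leadSet (level k m e (asSub M) : Set (NSpace K h))) := by
        rw [Set.disjoint_left]
        intro a ha hna
        exact hna.2 ((latticePhi_eq_iff hM a e).1 ha).1
      have h6 := congrArg Set.ncard h2
      rw [Set.ncard_union_eq h5 (hφfin e) (hfin e)] at h6
      simp only [levelCodim] at h1
      omega
    have := exists_decomposition hφfin hcount (ncard_latticePhi_eq_le hM hR)
    have hA : {a | latticePhi k m M a ≠ ⊥} = leadSet (M : Set (NSpace K h)) := Set.ext hbot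
    rwa [hA] at this

lemma le_of_sum_eq {μ : Fin h → ℕ} (hsum : ∑ i, μ i = m) (i : Fin h) : μ i ≤ m :=
  hsum ▸ Finset.single_le_sum (fun _ _ => Nat.zero_le _) (Finset.mem_univ i)

lemma isExtendedSemimodule_of_mem_adlv0 [IsAlgClosed K] {μ : Fin h → ℕ} {M : OSubmodule K h}
    (hM : M ∈ adlv0 k K m μ) :
    IsExtendedSemimodule m h μ (latticeA M) (latticePhi k m M) := by
  obtain ⟨⟨g, rfl, k₁, k₂, hg⟩, ⟨g', hg', hord⟩⟩ := hM
  obtain ⟨a, ha⟩ := exists_colSpan_le_fil g.val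
  obtain ⟨R, hR⟩ := exists_fil_le_colSpan g.isUnit
  refine isExtendedSemimodule_of_levelCodim (a₀ := a) (R := R) ha hR ?_
    (levelCodim_of_relativePosition hg)
  rw [← hg']
  exact (isNormalized_leadSet_iff g').2 hord

/-- A lattice in the sense of Mathlib is free, hence of the form `g M_0`. -/
lemma exists_latticeOf_eq {M : OSubmodule K h} (hM : M.IsLattice (LaurentSeries K)) :
    ∃ g : Matrix.GeneralLinearGroup (Fin h) (LaurentSeries K), latticeOf g = M := by
  have hfr : Module.finrank (PowerSeries K) M = h := by
    rw [Submodule.IsLattice.finrank_of_pi (LaurentSeries K) M, Fintype.card_fin]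
  let b : Module.Basis (Fin h) (PowerSeries K) M :=
    (Module.finBasis (PowerSeries K) M).reindex (finCongr hfr)
  let b' := b.extendOfIsLattice (LaurentSeries K)
  let g := (Pi.basisFun (LaurentSeries K) (Fin h)).toMatrix b'
  have hg : IsUnit g := by
    have := (Pi.basisFun (LaurentSeries K) (Fin h)).invertibleToMatrix b'
    exact isUnit_of_invertible g
  refine ⟨hg.unit, ?_⟩
  have hcol : hg.unit.val.col = fun j => (b j : NSpace K h) := by
    funext j i
    simp [g, b', Module.Basis.toMatrix_apply, Matrix.col]
  rw [latticeOf, hcol, Set.range_comp' (f := b) (g := Subtype.val), ← Submodule.coe_subtype,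
    Submodule.span_image, b.span_eq, Submodule.map_top, Submodule.range_subtype]

lemma isLattice_latticeOf (g : Matrix.GeneralLinearGroup (Fin h) (LaurentSeries K)) :
    (latticeOf g).IsLattice (LaurentSeries K) := by
  refine ⟨⟨(Set.finite_range g.val.col).toFinset, by rw [Set.Finite.coe_toFinset]; rfl⟩, ?_⟩
  rw [eq_top_iff]
  intro v _
  obtain ⟨y, rfl⟩ := exists_colSpan_eq g.isUnit v
  rw [Matrix.mulVec_eq_sum]
  refine Submodule.sum_mem _ fun i _ => ?_
  rw [op_smul_eq_smul]
  exact Submodule.smul_mem _ _ (Submodule.subset_span (Submodule.subset_span ⟨i, rfl⟩))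

lemma stratum_subset_adlv0 [IsAlgClosed K] {μ : Fin h → ℕ} (hsum : ∑ i, μ i = m) {A : Set ℤ}
    {φ : ℤ → WithBot ℕ} (hp : IsExtendedSemimodule m h μ A φ) :
    stratum k K m h A φ ⊆ adlv0 k K m μ := by
  rintro M ⟨hlat, rfl, rfl⟩
  obtain ⟨g, rfl⟩ := exists_latticeOf_eq hlat
  obtain ⟨a, ha⟩ := exists_colSpan_le_fil g.val
  rw [← latticeOf_eq_colSpan] at ha
  refine ⟨mem_adlv_of_levelCodim (le_of_sum_eq hsum) g fun e _ => ?_, g, rfl, ?_⟩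
  · rw [← (hp.finite_and_ncard_lt e).2, levelCodim]
    congr 1
    ext b
    have h1 : b ∈ leadSet (latticeOf g : Set (NSpace K h)) ↔ latticePhi k m (latticeOf g) b ≠ ⊥ := by
      rw [← latticeA_eq]
      exact hp.mem_iff
    rw [Set.mem_sdiff, ← le_latticePhi_iff ha, not_le]
    exact and_congr_left fun _ => h1
  · rw [← isNormalized_leadSet_iff, ← latticeA_eq]
    exact hp.normalized

lemma mem_stratum_of_mem_adlv0 {μ : Fin h → ℕ} {M : OSubmodule K h} (hM : M ∈ adlv0 k K m μ) :
    M ∈ stratum k K m h (latticeA M) (latticePhi k m M) := by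
  obtain ⟨⟨g, rfl, -⟩, -⟩ := hM
  exact ⟨isLattice_latticeOf g, rfl, rfl⟩

lemma le_fil_of_leadSet_subset {M : OSubmodule K h} {a : ℤ}
    (ha : leadSet (M : Set (NSpace K h)) ⊆ Set.Ici a) : M ≤ fil K h a := by
  intro v hv i hi
  by_cases h0 : v = 0
  · simp [h0]
  · obtain ⟨b, hb⟩ := exists_isLead h0
    exact hb.2 i (hi.trans_le (ha ⟨v, hv, hb⟩))

/-- The lattices in `X_μ(b)^0` are bounded: their sets of leading indices are normalized
semi-modules. -/
lemma adlv0_subset_window [IsAlgClosed K] (hmh : Nat.Coprime m h) (μ : Fin h → ℕ) :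
    adlv0 k K m μ ⊆ window K h (m + 1) := by
  intro M hM
  have hh := natCast_h_pos (h := h)
  have hb := (isExtendedSemimodule_of_mem_adlv0 hM).bounds hmh
  rw [latticeA_eq] at hb
  obtain ⟨⟨g, rfl, -⟩, -⟩ := hM
  obtain ⟨R, hR⟩ := exists_fil_le_colSpan g.isUnit
  rw [window, Set.mem_ofPred_eq, tLattice_eq_fil, tLattice_eq_fil]
  have hmul : ((m + 1 : ℕ) : ℤ) * h = h * m + h := by push_cast; ring
  constructor
  · rw [hmul]
    exact fil_le_of_Ici_subset hR hb.2
  · refine (le_fil_of_leadSet_subset hb.1).trans (fil_anti ?_)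
    rw [neg_mul, hmul]
    omega

end Strata

/-! ### Closed points of a projective space -/

section ProjectiveSpace

open MvPolynomial

variable {ι K : Type*} [Field K]

/-- The polynomials that vanish on the line through `p`. -/
def lineIdeal (p : ι → K) : Ideal (MvPolynomial ι K) :=
  RingHom.ker (aeval (fun i => Polynomial.C (p i) * Polynomial.X) : MvPolynomial ι K →ₐ[K] Polynomial K)

lemma eval_aeval_line (p : ι → K) (f : MvPolynomial ι K) (c : K) :
    Polynomial.eval c (aeval (fun i => Polynomial.C (p i) * Polynomial.X) f) = eval (c • p) f := by
  induction f using MvPolynomial.induction_on with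
  | C a => simp
  | add f g hf hg => simp [hf, hg]
  | mul_X f i hf => simp [hf, mul_comm c]

lemma mem_lineIdeal_iff [Infinite K] {p : ι → K} {f : MvPolynomial ι K} :
    f ∈ lineIdeal p ↔ ∀ c : K, eval (c • p) f = 0 := by
  rw [lineIdeal, RingHom.mem_ker]
  constructor
  · intro hf c
    rw [← eval_aeval_line]
    rw [show aeval (fun i => Polynomial.C (p i) * Polynomial.X) f = 0 from hf, Polynomial.eval_zero]
  · intro hf
    refine Polynomial.funext fun c => ?_
    rw [Polynomial.eval_zero, ← hf c, ← eval_aeval_line]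

lemma eval_smul_of_isHomogeneous {F : MvPolynomial ι K} {n : ℕ} (hF : F.IsHomogeneous n) (c : K)
    (p : ι → K) : eval (c • p) F = c ^ n * eval p F := by
  rw [eval_eq, eval_eq, Finset.mul_sum]
  refine Finset.sum_congr rfl fun d hd => ?_
  have hdeg : d.degree = n := by
    rw [Finsupp.degree_eq_weight_one]
    exact hF (mem_support_iff.1 hd)
  have : ∏ i ∈ d.support, (c • p) i ^ d i = c ^ n * ∏ i ∈ d.support, p i ^ d i := by
    rw [← hdeg, Finsupp.degree_apply, ← Finset.prod_pow_eq_pow_sum, ← Finset.prod_mul_distrib]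
    exact Finset.prod_congr rfl fun i _ => by rw [Pi.smul_apply, smul_eq_mul, mul_pow]
  rw [this]
  ring

lemma eval_smul_eq_sum (f : MvPolynomial ι K) (c : K) (p : ι → K) :
    eval (c • p) f =
      ∑ n ∈ Finset.range (f.totalDegree + 1), c ^ n * eval p (homogeneousComponent n f) := by
  conv_lhs => rw [← sum_homogeneousComponent f, map_sum]
  exact Finset.sum_congr rfl fun n _ =>
    eval_smul_of_isHomogeneous (homogeneousComponent_isHomogeneous n f) c p

lemma mem_lineIdeal_iff_homogeneousComponent [Infinite K] {p : ι → K} {f : MvPolynomial ι K} :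
    f ∈ lineIdeal p ↔ ∀ n, eval p (homogeneousComponent n f) = 0 := by
  constructor
  · intro hf n
    have hpoly : ∑ i ∈ Finset.range (f.totalDegree + 1),
        Polynomial.C (eval p (homogeneousComponent i f)) * Polynomial.X ^ i = 0 := by
      refine Polynomial.funext fun c => ?_
      rw [Polynomial.eval_zero, ← mem_lineIdeal_iff.1 hf c, eval_smul_eq_sum,
        Polynomial.eval_finsetSum]
      refine Finset.sum_congr rfl fun i _ => ?_
      rw [Polynomial.eval_mul, Polynomial.eval_C, Polynomial.eval_pow, Polynomial.eval_X, mul_comm]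
    by_cases hn : n < f.totalDegree + 1
    · have := congrArg (fun g => Polynomial.coeff g n) hpoly
      simpa [Polynomial.coeff_C_mul, Polynomial.coeff_X_pow, hn] using this
    · rw [homogeneousComponent_eq_zero _ _ (by omega), map_zero]
  · intro hf
    rw [mem_lineIdeal_iff]
    intro c
    rw [eval_smul_eq_sum]
    exact Finset.sum_eq_zero fun n _ => by rw [hf, mul_zero]

lemma IsHomogeneous.mem_lineIdeal_iff' [Infinite K] {p : ι → K} {F : MvPolynomial ι K} {n : ℕ}
    (hF : F.IsHomogeneous n) : F ∈ lineIdeal p ↔ eval p F = 0 := by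
  rw [mem_lineIdeal_iff]
  constructor
  · intro H
    simpa using H 1
  · intro H c
    rw [eval_smul_of_isHomogeneous hF, H, mul_zero]

lemma decompose_eq_homogeneousComponent (f : MvPolynomial ι K) (n : ℕ) :
    (DirectSum.decompose (homogeneousSubmodule ι K) f n : MvPolynomial ι K) =
      homogeneousComponent n f :=
  decomposition.decompose'_apply f n

lemma isHomogeneous_lineIdeal [Infinite K] (p : ι → K) :
    (lineIdeal p).IsHomogeneous (homogeneousSubmodule ι K) := by
  intro n f hf
  rw [decompose_eq_homogeneousComponent]
  rw [IsHomogeneous.mem_lineIdeal_iff' (homogeneousComponent_isHomogeneous n f)]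
  exact mem_lineIdeal_iff_homogeneousComponent.1 hf n

/-- The point of the projective space with homogeneous coordinates `p`. -/
def projPoint [Infinite K] (p : ι → K) (hp : p ≠ 0) :
    ProjectiveSpectrum (homogeneousSubmodule ι K) where
  asHomogeneousIdeal := ⟨lineIdeal p, isHomogeneous_lineIdeal p⟩
  isPrime := RingHom.ker_isPrime _
  not_irrelevant_le := by
    intro hle
    obtain ⟨i, hi⟩ := Function.ne_iff.1 hp
    have h1 : (X i : MvPolynomial ι K) ∈ lineIdeal p :=
      hle (HomogeneousIdeal.mem_irrelevant_of_mem _ zero_lt_one (isHomogeneous_X K i))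
    rw [IsHomogeneous.mem_lineIdeal_iff' (isHomogeneous_X K i), eval_X] at h1
    exact hi h1

lemma mem_projPoint [Infinite K] {p : ι → K} {hp : p ≠ 0} {f : MvPolynomial ι K} :
    f ∈ (projPoint p hp).asHomogeneousIdeal ↔ f ∈ lineIdeal p := Iff.rfl

lemma lineIdeal_smul [Infinite K] {c : K} (hc : c ≠ 0) (p : ι → K) :
    lineIdeal (c • p) = lineIdeal p := by
  ext f
  rw [mem_lineIdeal_iff, mem_lineIdeal_iff]
  constructor
  · intro H d
    have := H (d * c⁻¹)
    rwa [smul_smul, inv_mul_cancel_right₀ hc] at this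
  · intro H d
    rw [smul_smul]
    exact H _

lemma exists_eq_smul_of_lineIdeal_le [Infinite K] {p p' : ι → K} (hp : p ≠ 0)
    (hle : lineIdeal p ≤ lineIdeal p') : ∃ c : K, p' = c • p := by
  obtain ⟨j, hj⟩ := Function.ne_iff.1 hp
  refine ⟨p' j / p j, funext fun i => ?_⟩
  have h1 : (C (p j) * X i - C (p i) * X j : MvPolynomial ι K).IsHomogeneous 1 := by
    simpa using ((isHomogeneous_X K i).C_mul (p j)).sub ((isHomogeneous_X K j).C_mul (p i))
  have h2 : (C (p j) * X i - C (p i) * X j : MvPolynomial ι K) ∈ lineIdeal p := by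
    rw [IsHomogeneous.mem_lineIdeal_iff' h1]
    simp [mul_comm]
  have h3 := (IsHomogeneous.mem_lineIdeal_iff' h1).1 (hle h2)
  simp only [map_sub, map_mul, eval_C, eval_X] at h3
  have hj' : p j ≠ 0 := hj
  rw [Pi.smul_apply, smul_eq_mul]
  field_simp
  linear_combination h3

variable [Finite ι] [IsAlgClosed K]

/-- By Hilbert's Nullstellensatz every point of the projective space specializes to a rational
point. -/
lemma exists_le_projPoint (x : ProjectiveSpectrum (homogeneousSubmodule ι K)) :
    ∃ (p : ι → K) (hp : p ≠ 0), x ≤ projPoint p hp := by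
  obtain ⟨f, hf, hfx⟩ := SetLike.not_le_iff_exists.1 x.not_irrelevant_le
  have h1 := IsPrime.vanishingIdeal_zeroLocus (K := K) x.asHomogeneousIdeal.toIdeal
  have h2 : f ∉ vanishingIdeal K (zeroLocus K x.asHomogeneousIdeal.toIdeal) := by
    rw [h1]
    exact hfx
  rw [mem_vanishingIdeal_iff] at h2
  push Not at h2
  obtain ⟨p, hp, hfp⟩ := h2
  rw [mem_zeroLocus_iff] at hp
  refine ⟨p, ?_, fun g hg => ?_⟩
  · rintro rfl
    apply hfp
    have h3 : homogeneousComponent 0 f = 0 := by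
      rw [← decompose_eq_homogeneousComponent]
      exact hf
    rw [homogeneousComponent_zero, C_eq_zero] at h3
    rw [aeval_zero, ← constantCoeff_eq] at *
    simp [h3]
  · rw [mem_projPoint, mem_lineIdeal_iff_homogeneousComponent]
    intro n
    exact hp _ (homogeneousComponent_mem_of_mem x.asHomogeneousIdeal.isHomogeneous hg n)

lemma projPoint_eq_of_le {p p' : ι → K} (hp : p ≠ 0) (hp' : p' ≠ 0)
    {x : ProjectiveSpectrum (homogeneousSubmodule ι K)} (h1 : projPoint p hp ≤ x)
    (h2 : x ≤ projPoint p' hp') : x = projPoint p hp := by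
  have h3 : lineIdeal p ≤ lineIdeal p' := fun f hf => h2 (h1 hf)
  obtain ⟨c, rfl⟩ := exists_eq_smul_of_lineIdeal_le hp h3
  have hc : c ≠ 0 := by
    rintro rfl
    simp at hp'
  refine le_antisymm (fun f hf => ?_) h1
  have := h2 hf
  rwa [mem_projPoint, lineIdeal_smul hc] at this

lemma closedPoints_projectiveSpectrum :
    closedPoints (ProjectiveSpectrum (homogeneousSubmodule ι K)) =
      Set.range fun p : {p : ι → K // p ≠ 0} => projPoint p.1 p.2 := by
  ext x
  rw [mem_closedPoints_iff]
  constructor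
  · intro hx
    obtain ⟨p, hp, hle⟩ := exists_le_projPoint x
    rw [ProjectiveSpectrum.le_iff_mem_closure, hx.closure_eq] at hle
    exact ⟨⟨p, hp⟩, hle⟩
  · rintro ⟨p, rfl⟩
    refine isClosed_of_closure_subset fun y hy => ?_
    rw [← ProjectiveSpectrum.le_iff_mem_closure] at hy
    obtain ⟨p', hp', hle⟩ := exists_le_projPoint y
    exact projPoint_eq_of_le _ _ hy hle

/-- Nonzero vectors of coordinates, with the topology induced by the Zariski topology of the
projective space. Conditions on lattices are imposed on such vectors and then transferred to
closed points. -/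
def CoordVec (ι K : Type*) [Field K] : Type _ := {p : ι → K // p ≠ 0}

/-- The point with given coordinates. -/
def CoordVec.toProj (p : CoordVec ι K) : ProjectiveSpectrum (homogeneousSubmodule ι K) :=
  projPoint p.1 p.2

instance : TopologicalSpace (CoordVec ι K) := TopologicalSpace.induced CoordVec.toProj inferInstance

lemma isInducing_toProj : Topology.IsInducing (CoordVec.toProj (ι := ι) (K := K)) := ⟨rfl⟩

lemma isOpen_eval_ne_zero {F : MvPolynomial ι K} {n : ℕ} (hF : F.IsHomogeneous n) :
    IsOpen {p : CoordVec ι K | eval p.1 F ≠ 0} := by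
  have h1 := (ProjectiveSpectrum.isOpen_basicOpen (homogeneousSubmodule ι K) (a := F)).preimage
    isInducing_toProj.continuous
  convert h1 using 1
  ext p
  exact (IsHomogeneous.mem_lineIdeal_iff' hF).symm.not

/-- A regular function on the chart `p i ≠ 0` has an open non-vanishing locus. -/
lemma isOpen_eval_div_ne_zero (i : ι) (f : MvPolynomial ι K) :
    IsOpen {p : CoordVec ι K | p.1 i ≠ 0 ∧ eval ((p.1 i)⁻¹ • p.1) f ≠ 0} := by
  -- the homogenization of `f`, multiplied by `X i` so as to vanish where `p i = 0`
  let G : MvPolynomial ι K := ∑ n ∈ Finset.range (f.totalDegree + 1),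
    X i ^ (f.totalDegree + 1 - n) * homogeneousComponent n f
  have hG : G.IsHomogeneous (f.totalDegree + 1) := by
    refine IsHomogeneous.sum _ _ _ fun n hn => ?_
    have h1 := ((isHomogeneous_X K i).pow (f.totalDegree + 1 - n)).mul
      (homogeneousComponent_isHomogeneous n f)
    have h2 := Finset.mem_range.1 hn
    rwa [one_mul, Nat.sub_add_cancel h2.le] at h1
  convert isOpen_eval_ne_zero hG using 1
  ext p
  have hev : p.1 i ≠ 0 → eval p.1 G = p.1 i ^ (f.totalDegree + 1) * eval ((p.1 i)⁻¹ • p.1) f := by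
    intro hp
    rw [eval_smul_eq_sum, Finset.mul_sum, map_sum]
    refine Finset.sum_congr rfl fun n hn => ?_
    have h2 := Finset.mem_range.1 hn
    rw [map_mul, map_pow, eval_X, ← mul_assoc]
    congr 1
    rw [pow_sub₀ _ hp h2.le, inv_pow]
  rw [Set.mem_ofPred_eq, Set.mem_ofPred_eq]
  by_cases hp : p.1 i = 0
  · refine iff_of_false (fun H => H.1 hp) (fun H => H ?_)
    rw [map_sum]
    refine Finset.sum_eq_zero fun n hn => ?_
    have h2 := Finset.mem_range.1 hn
    rw [map_mul, map_pow, eval_X, hp, zero_pow (by omega), zero_mul]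
  · rw [hev hp, mul_ne_zero_iff]
    exact ⟨fun H => ⟨pow_ne_zero _ H.1, H.2⟩, fun H => ⟨hp, H.2⟩⟩

end ProjectiveSpace

/-! ### Minors and charts of the Grassmannian -/

section Minors

variable {K : Type*} [Field K] {α β : Type*}

lemma exists_linearIndependent_row_comp [Finite α] [Fintype β] (A : Matrix α β K) {r : ℕ}
    (hr : r ≤ A.rank) : ∃ f : Fin r → α, LinearIndependent K (A.submatrix f id).row := by
  obtain ⟨v, hv, -, hli⟩ := Submodule.exists_fun_fin_finrank_span_eq K (Set.range A.row)
  choose f hf using hv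
  rw [Matrix.rank_eq_finrank_span_row] at hr
  refine ⟨fun i => f (Fin.castLE hr i), ?_⟩
  have h1 : (A.submatrix (fun i => f (Fin.castLE hr i)) id).row = v ∘ Fin.castLE hr := by
    funext i
    exact hf _
  rw [h1]
  exact hli.comp _ (Fin.castLE_injective hr)

lemma exists_det_submatrix_ne_zero_of_row [Fintype β] {r : ℕ} (A : Matrix (Fin r) β K)
    (hA : LinearIndependent K A.row) : ∃ g : Fin r → β, (A.submatrix id g).det ≠ 0 := by
  have h1 : A.transpose.rank = r := by
    rw [Matrix.rank_transpose, hA.rank_matrix, Fintype.card_fin]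
  obtain ⟨g, hg⟩ := exists_linearIndependent_row_comp A.transpose h1.ge
  refine ⟨g, ?_⟩
  have h2 := Matrix.linearIndependent_rows_iff_isUnit.1 hg
  rw [← Matrix.transpose_submatrix, Matrix.isUnit_transpose, Matrix.isUnit_iff_isUnit_det,
    isUnit_iff_ne_zero] at h2
  exact h2

lemma linearIndependent_row_of_submatrix [Fintype β] {r : ℕ} {A : Matrix (Fin r) β K}
    {γ : Type*} {g : γ → β} (hA : LinearIndependent K (A.submatrix id g).row) :
    LinearIndependent K A.row :=
  LinearIndependent.of_comp (LinearMap.funLeft K K g) hA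

lemma le_rank_iff_exists_det_ne_zero [Finite α] [Fintype β] (A : Matrix α β K) (r : ℕ) :
    r ≤ A.rank ↔ ∃ (f : Fin r → α) (g : Fin r → β), (A.submatrix f g).det ≠ 0 := by
  constructor
  · intro hr
    obtain ⟨f, hf⟩ := exists_linearIndependent_row_comp A hr
    obtain ⟨g, hg⟩ := exists_det_submatrix_ne_zero_of_row _ hf
    exact ⟨f, g, hg⟩
  · rintro ⟨f, g, hfg⟩
    have h1 : IsUnit (A.submatrix f g) := by
      rw [Matrix.isUnit_iff_isUnit_det, isUnit_iff_ne_zero]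
      exact hfg
    have h2 := (Matrix.linearIndependent_rows_iff_isUnit.2 h1).rank_matrix
    rw [Fintype.card_fin] at h2
    exact h2.symm.le.trans (Matrix.rank_submatrix_le A f g)

end Minors

section Charts

open MvPolynomial

variable {K : Type*} [Field K] {d : ℕ}

instance : Finite (PluckerIndex d) := DFunLike.finite _

/-- Every maximal minor is a Plücker coordinate up to sign, or zero. -/
lemma exists_det_submatrix_eq (K : Type*) [Field K] (τ : Fin d → Fin (2 * d)) :
    ∃ (s : K) (J : PluckerIndex d), ∀ w : Matrix (Fin d) (Fin (2 * d)) K,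
      (w.submatrix id τ).det = s * pluckerCoords w J := by
  by_cases hτ : Function.Injective τ
  · have hmono : StrictMono (τ ∘ Tuple.sort τ) :=
      (Tuple.monotone_sort τ).strictMono_of_injective (hτ.comp (Equiv.injective _))
    refine ⟨((Equiv.Perm.sign (Tuple.sort τ) : ℤ) : K), OrderEmbedding.ofStrictMono _ hmono,
      fun w => ?_⟩
    have h1 := Matrix.det_permute' (Tuple.sort τ) (w.submatrix id τ)
    rw [Matrix.submatrix_submatrix] at h1
    have h2 : pluckerCoords w (OrderEmbedding.ofStrictMono _ hmono) =
        (w.submatrix (id ∘ id) (τ ∘ Tuple.sort τ)).det := rfl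
    rw [h2, h1, ← mul_assoc]
    rcases Int.units_eq_one_or (Equiv.Perm.sign (Tuple.sort τ)) with h | h <;> simp [h]
  · refine ⟨0, Fin.castLEOrderEmb (by omega), fun w => ?_⟩
    rw [Function.Injective] at hτ
    push Not at hτ
    obtain ⟨i, j, hij, hne⟩ := hτ
    rw [zero_mul]
    exact Matrix.det_zero_of_column_eq hne fun l => by simp [hij]

/-- The sign and the Plücker index belonging to a tuple of columns. -/
def tupleSign (K : Type*) [Field K] (τ : Fin d → Fin (2 * d)) : K :=
  (exists_det_submatrix_eq K τ).choose

/-- The Plücker index obtained by sorting a tuple of columns. -/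
def tupleIndex (K : Type*) [Field K] (τ : Fin d → Fin (2 * d)) : PluckerIndex d :=
  (exists_det_submatrix_eq K τ).choose_spec.choose

lemma det_submatrix_eq (τ : Fin d → Fin (2 * d)) (w : Matrix (Fin d) (Fin (2 * d)) K) :
    (w.submatrix id τ).det = tupleSign K τ * pluckerCoords w (tupleIndex K τ) :=
  (exists_det_submatrix_eq K τ).choose_spec.choose_spec w

/-- The universal matrix over the chart `J`: by Cramer's rule the matrix with rows in the subspace
and with `J`-th minor the identity has Plücker coordinates as entries. -/
def chartPoly (K : Type*) [Field K] (J : PluckerIndex d) :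
    Matrix (Fin d) (Fin (2 * d)) (MvPolynomial (PluckerIndex d) K) :=
  Matrix.of fun i c =>
    C (tupleSign K (Function.update J i c)) * X (tupleIndex K (Function.update J i c))

/-- The value of `chartPoly` at a vector of Plücker coordinates. -/
def chartMat (J : PluckerIndex d) (p : PluckerIndex d → K) : Matrix (Fin d) (Fin (2 * d)) K :=
  (chartPoly K J).map (eval ((p J)⁻¹ • p))

lemma pluckerCoords_mul (g : Matrix (Fin d) (Fin d) K) (w : Matrix (Fin d) (Fin (2 * d)) K) :
    pluckerCoords (g * w) = g.det • pluckerCoords w := by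
  funext J
  rw [pluckerCoords, Pi.smul_apply, smul_eq_mul, pluckerCoords, ← Matrix.det_mul]
  rfl

lemma chartMat_eq {J : PluckerIndex d} {p : PluckerIndex d → K} (hJ : p J ≠ 0)
    {w : Matrix (Fin d) (Fin (2 * d)) K} {c : K} (hp : p = c • pluckerCoords w) :
    (w.submatrix id J).det ≠ 0 ∧ chartMat J p = (w.submatrix id J)⁻¹ * w := by
  have hJ' : p J = c * (w.submatrix id J).det := by
    rw [hp, Pi.smul_apply, smul_eq_mul]
    rfl
  have hc : c ≠ 0 := fun h0 => hJ (by rw [hJ', h0, zero_mul])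
  have hdet : (w.submatrix id J).det ≠ 0 := fun h0 => hJ (by rw [hJ', h0, mul_zero])
  refine ⟨hdet, Matrix.ext fun i a => ?_⟩
  have h1 : ((w.submatrix id J)⁻¹ * w) i a =
      (w.submatrix id J).det⁻¹ * (w.submatrix id (Function.update J i a)).det := by
    have h2 : w.submatrix id (Function.update J i a) =
        (w.submatrix id J).updateCol i (w.col a) := by
      refine Matrix.ext fun r s => ?_
      by_cases hs : s = i
      · subst hs
        simp [Matrix.col]
      · simp [hs, Function.update_of_ne, Matrix.updateCol_ne]
    rw [h2, ← Matrix.cramer_apply, Matrix.cramer_eq_adjugate_mulVec, Matrix.inv_def,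
      Ring.inverse_eq_inv', Matrix.smul_mul, Matrix.smul_apply, smul_eq_mul]
    rfl
  rw [h1, det_submatrix_eq (Function.update J i a)]
  simp only [chartMat, chartPoly, Matrix.map_apply, Matrix.of_apply, map_mul, eval_C, eval_X,
    Pi.smul_apply, smul_eq_mul]
  rw [hJ', hp, Pi.smul_apply, smul_eq_mul]
  field_simp

/-- The row space of a matrix. -/
abbrev rowSpan {β : Type*} (w : Matrix (Fin d) β K) : Submodule K (β → K) :=
  Submodule.span K (Set.range w.row)

lemma mem_rowSpan {β : Type*} {w : Matrix (Fin d) β K} {x : β → K} :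
    x ∈ rowSpan w ↔ ∃ y, x = Matrix.vecMul y w := by
  rw [rowSpan, Submodule.mem_span_range_iff_exists_fun]
  refine exists_congr fun y => ?_
  rw [Matrix.vecMul_eq_sum]
  exact eq_comm

lemma rowSpan_mul_of_isUnit {β : Type*} {g : Matrix (Fin d) (Fin d) K} (hg : IsUnit g)
    (w : Matrix (Fin d) β K) : rowSpan (g * w) = rowSpan w := by
  ext x
  rw [mem_rowSpan, mem_rowSpan]
  constructor
  · rintro ⟨y, rfl⟩
    exact ⟨Matrix.vecMul y g, by rw [Matrix.vecMul_vecMul]⟩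
  · rintro ⟨y, rfl⟩
    refine ⟨Matrix.vecMul y g⁻¹, ?_⟩
    rw [Matrix.vecMul_vecMul, ← Matrix.mul_assoc, Matrix.nonsing_inv_mul, Matrix.one_mul]
    exact (Matrix.isUnit_iff_isUnit_det g).1 hg

lemma mem_rowSpan_iff_of_submatrix_eq_one {β : Type*} {W : Matrix (Fin d) β K} {J : Fin d → β}
    (hW : W.submatrix id J = 1) {x : β → K} :
    x ∈ rowSpan W ↔ x = Matrix.vecMul (fun l => x (J l)) W := by
  rw [mem_rowSpan]
  constructor
  · rintro ⟨y, rfl⟩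
    congr 1
    have h1 : (fun l => Matrix.vecMul y W (J l)) = Matrix.vecMul y (W.submatrix id J) := rfl
    rw [h1, hW, Matrix.vecMul_one]
  · exact fun h => ⟨_, h⟩

/-- On the chart `J` a point of the Grassmannian is given by `chartMat J p`. -/
lemma chartMat_spec {J : PluckerIndex d} {p : PluckerIndex d → K} (hJ : p J ≠ 0)
    {w : Matrix (Fin d) (Fin (2 * d)) K} {c : K} (hp : p = c • pluckerCoords w) :
    (chartMat J p).submatrix id J = 1 ∧ rowSpan (chartMat J p) = rowSpan w ∧
      pluckerCoords (chartMat J p) = (p J)⁻¹ • p := by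
  obtain ⟨hdet, hW⟩ := chartMat_eq hJ hp
  have hu : IsUnit (w.submatrix id J).det := isUnit_iff_ne_zero.2 hdet
  have hu' : IsUnit (w.submatrix id J)⁻¹ :=
    (Matrix.isUnit_nonsing_inv_iff).2 ((Matrix.isUnit_iff_isUnit_det _).2 hu)
  have hc : c ≠ 0 := fun h0 => hJ (by rw [hp, h0, zero_smul, Pi.zero_apply])
  refine ⟨?_, ?_, ?_⟩
  · rw [hW]
    exact Matrix.nonsing_inv_mul _ hu
  · rw [hW, rowSpan_mul_of_isUnit hu']
  · rw [hW, pluckerCoords_mul, Matrix.det_nonsing_inv, Ring.inverse_eq_inv']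
    have h1 : p J = c * (w.submatrix id J).det := by
      rw [hp, Pi.smul_apply, smul_eq_mul]
      rfl
    rw [h1, hp, smul_smul, mul_inv_rev, inv_mul_cancel_right₀ hc]

lemma linearIndependent_row_of_pluckerCoords {w : Matrix (Fin d) (Fin (2 * d)) K}
    {J : PluckerIndex d} (hw : pluckerCoords w J ≠ 0) : LinearIndependent K w.row :=
  linearIndependent_row_of_submatrix (g := J) (Matrix.linearIndependent_rows_iff_isUnit.2
    ((Matrix.isUnit_iff_isUnit_det _).2 (isUnit_iff_ne_zero.2 hw)))

lemma exists_pluckerCoords_ne_zero {w : Matrix (Fin d) (Fin (2 * d)) K}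
    (hw : LinearIndependent K w.row) : ∃ J, pluckerCoords w J ≠ 0 := by
  obtain ⟨g, hg⟩ := exists_det_submatrix_ne_zero_of_row w hw
  rw [det_submatrix_eq] at hg
  exact ⟨_, right_ne_zero_of_mul hg⟩

variable [IsAlgClosed K]

/-- The rank of a matrix of regular functions on a chart is lower semicontinuous. -/
lemma isOpen_chart_le_rank {α β : Type*} [Finite α] [Fintype β] (J : PluckerIndex d)
    (A : Matrix α β (MvPolynomial (PluckerIndex d) K)) (r : ℕ) :
    IsOpen {p : CoordVec (PluckerIndex d) K |
      p.1 J ≠ 0 ∧ r ≤ (A.map (eval ((p.1 J)⁻¹ • p.1))).rank} := by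
  have h1 : {p : CoordVec (PluckerIndex d) K |
      p.1 J ≠ 0 ∧ r ≤ (A.map (eval ((p.1 J)⁻¹ • p.1))).rank} =
      ⋃ (f : Fin r → α) (g : Fin r → β), {p : CoordVec (PluckerIndex d) K |
        p.1 J ≠ 0 ∧ eval ((p.1 J)⁻¹ • p.1) (A.submatrix f g).det ≠ 0} := by
    ext p
    simp only [Set.mem_iUnion, Set.mem_ofPred_eq, le_rank_iff_exists_det_ne_zero, RingHom.map_det,
      exists_and_left]
    rfl
  rw [h1]
  exact isOpen_iUnion fun f => isOpen_iUnion fun g => isOpen_eval_div_ne_zero J _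

/-- The vectors of Plücker coordinates of points of the Grassmannian. -/
def grassCone (K : Type*) [Field K] (d : ℕ) : Set (CoordVec (PluckerIndex d) K) :=
  {p | ∃ (w : Matrix (Fin d) (Fin (2 * d)) K) (c : K), p.1 = c • pluckerCoords w}

/-- Being a point of the Grassmannian is the closed condition that `chartMat J p` has the Plücker
coordinates `p`, up to the factor `p J`. -/
lemma isClosed_grassCone : IsClosed (grassCone K d) := by
  rw [← isOpen_compl_iff]
  have h1 : (grassCone K d)ᶜ = ⋃ (J : PluckerIndex d) (J' : PluckerIndex d),
      {p : CoordVec (PluckerIndex d) K | p.1 J ≠ 0 ∧ eval ((p.1 J)⁻¹ • p.1)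
        (((chartPoly K J).submatrix id J').det - X J') ≠ 0} := by
    have hev : ∀ (J J' : PluckerIndex d) (p : CoordVec (PluckerIndex d) K),
        eval ((p.1 J)⁻¹ • p.1) (((chartPoly K J).submatrix id J').det - X J') =
          pluckerCoords (chartMat J p.1) J' - ((p.1 J)⁻¹ • p.1) J' := by
      intro J J' p
      rw [map_sub, eval_X, RingHom.map_det]
      rfl
    ext p
    simp only [Set.mem_iUnion, Set.mem_ofPred_eq, Set.mem_compl_iff, hev, sub_ne_zero]
    constructor
    · intro hp
      obtain ⟨J, hJ⟩ := Function.ne_iff.1 p.2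
      by_contra hcon
      push Not at hcon
      refine hp ⟨chartMat J p.1, p.1 J, ?_⟩
      rw [funext (hcon J · hJ), smul_smul, mul_inv_cancel₀ hJ, one_smul]
    · rintro ⟨J, J', hJ, hne⟩ ⟨w, c, hp⟩
      exact hne (congrFun (chartMat_spec hJ hp).2.2 J')
  rw [h1]
  exact isOpen_iUnion fun J => isOpen_iUnion fun J' => isOpen_eval_div_ne_zero J _

end Charts

/-! ### Lattices in the window and points of the Grassmannian -/

section Window

variable {K : Type*} [Field K] {h : ℕ} [NeZero h] {n : ℕ}

/-- `windowCoords` as a linear map. -/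
def windowₗ (K : Type*) [Field K] (h : ℕ) [NeZero h] (n : ℕ) :
    NSpace K h →ₗ[K] (Fin (2 * (n * h)) → K) where
  toFun := windowCoords n
  map_add' v w := funext fun j => by simp [windowCoords]
  map_smul' c v := funext fun j => by simp [windowCoords]

@[simp] lemma windowₗ_apply (v : NSpace K h) : windowₗ K h n v = windowCoords n v := rfl

lemma mem_window_iff {M : OSubmodule K h} :
    M ∈ window K h n ↔ fil K h (n * h) ≤ M ∧ M ≤ fil K h (-(n * h)) := by
  rw [window, Set.mem_ofPred_eq, tLattice_eq_fil, tLattice_eq_fil, neg_mul]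

lemma mem_fil_iff_windowCoords {v : NSpace K h} (hv : v ∈ fil K h (-(n * h))) :
    v ∈ fil K h (n * h) ↔ windowCoords n v = 0 := by
  constructor
  · intro H
    funext j
    have h2 : ((j : ℕ) : ℤ) < 2 * (n * h) := by exact_mod_cast j.2
    exact H _ (by linarith)
  · intro H i hi
    by_cases hlt : i < -(n * h)
    · exact hv i hlt
    · have h1 : 0 ≤ i + n * h := by omega
      have h2 : (i + n * h).toNat < 2 * (n * h) := by
        zify
        rw [Int.toNat_of_nonneg h1]
        omega
      have := congrFun H ⟨(i + n * h).toNat, h2⟩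
      simp only [windowCoords, Pi.zero_apply, Int.toNat_of_nonneg h1] at this
      rwa [add_sub_cancel_right] at this

/-- Extension of a vector of window coordinates by zero. -/
def coeffExt {R : Type*} [CommRing R] {d : ℕ} (x : Fin (2 * d) → R) (i : ℤ) : R :=
  if hi : 0 ≤ i + d ∧ i < d then x ⟨(i + d).toNat, by omega⟩ else 0

lemma coeffExt_map {R R' : Type*} [CommRing R] [CommRing R'] (f : R →+* R') {d : ℕ}
    (x : Fin (2 * d) → R) (i : ℤ) : coeffExt (fun j => f (x j)) i = f (coeffExt x i) := by
  unfold coeffExt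
  split_ifs <;> simp

lemma coeffExt_sub {R : Type*} [CommRing R] {d : ℕ} (x : Fin (2 * d) → R) (j : Fin (2 * d)) :
    coeffExt x (((j : ℕ) : ℤ) - d) = x j := by
  have := j.2
  rw [coeffExt, dif_pos (by omega)]
  congr 1
  apply Fin.ext
  simp

lemma exists_windowCoords_eq (x : Fin (2 * (n * h)) → K) :
    ∃ v ∈ fil K h (-(n * h)), windowCoords n v = x ∧ ∀ i, eCoeff v i = coeffExt x i := by
  obtain ⟨v, hv⟩ := exists_eCoeff (h := h) (coeffExt x) (-(n * h)) (fun i hi => by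
    rw [coeffExt, dif_neg]
    push_cast
    omega)
  refine ⟨v, fun i hi => ?_, funext fun j => ?_, hv⟩
  · rw [hv, coeffExt, dif_neg]
    push_cast
    omega
  · rw [windowCoords, hv]
    have := coeffExt_sub x j
    push_cast at this
    exact this

lemma mem_iff_of_isFrame {M : OSubmodule K h} (hM : M ∈ window K h n)
    {w : Matrix (Fin (n * h)) (Fin (2 * (n * h))) K}
    (hw : (rowSpan w : Set (Fin (2 * (n * h)) → K)) = windowCoords n '' (M : Set (NSpace K h)))
    {v : NSpace K h} : v ∈ M ↔ v ∈ fil K h (-(n * h)) ∧ windowCoords n v ∈ rowSpan w := by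
  obtain ⟨hM1, hM2⟩ := mem_window_iff.1 hM
  rw [← SetLike.mem_coe (p := rowSpan w), hw]
  constructor
  · exact fun hv => ⟨hM2 hv, v, hv, rfl⟩
  · rintro ⟨hv, v', hv', he⟩
    have h1 : v - v' ∈ fil K h (n * h) := by
      rw [mem_fil_iff_windowCoords (Submodule.sub_mem _ hv (hM2 hv')), ← windowₗ_apply, map_sub,
        windowₗ_apply, windowₗ_apply, he, sub_self]
    have h2 := M.add_mem (hM1 h1) hv'
    rwa [sub_add_cancel] at h2

lemma eq_of_rowSpan_eq {M M' : OSubmodule K h} (hM : M ∈ window K h n) (hM' : M' ∈ window K h n)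
    {w w' : Matrix (Fin (n * h)) (Fin (2 * (n * h))) K}
    (hw : (rowSpan w : Set (Fin (2 * (n * h)) → K)) = windowCoords n '' (M : Set (NSpace K h)))
    (hw' : (rowSpan w' : Set (Fin (2 * (n * h)) → K)) = windowCoords n '' (M' : Set (NSpace K h)))
    (he : rowSpan w = rowSpan w') : M = M' := by
  ext v
  rw [mem_iff_of_isFrame hM hw, mem_iff_of_isFrame hM' hw', he]

/-- The dimension of `M / t ^ n M_0` is given by the volume of `M`. -/
lemma finrank_map_windowₗ {g : Matrix.GeneralLinearGroup (Fin h) (LaurentSeries K)}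
    (hg : latticeOf g ∈ window K h n) :
    FiniteDimensional K ((asSub (latticeOf g)).map (windowₗ K h n)) ∧
    (Module.finrank K ((asSub (latticeOf g)).map (windowₗ K h n)) : ℤ) =
      n * h - g.val.det.order := by
  obtain ⟨h1, h2⟩ := mem_window_iff.1 hg
  let V := asSub (latticeOf g)
  let f : V →ₗ[K] (Fin (2 * (n * h)) → K) := windowₗ K h n ∘ₗ V.subtype
  have hf : ∀ v : V, f v = 0 ↔ (v : NSpace K h) ∈ fil K h (n * h) := fun v =>
    (mem_fil_iff_windowCoords (h2 v.2)).symm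
  have hker : kerSet V f = fil K h (n * h) := by
    ext v
    constructor
    · rintro ⟨hv, h0⟩
      exact (hf ⟨v, hv⟩).1 h0
    · exact fun hv => ⟨h1 hv, (hf ⟨v, h1 hv⟩).2 hv⟩
  have h3 := ncard_leadSet_diff V f (a := -(n * h)) (R := n * h) (fun v hv => h2 hv)
    (fun v hv => (hf v).2 hv)
  have hrange : LinearMap.range f = V.map (windowₗ K h n) := by
    rw [LinearMap.range_comp, Submodule.range_subtype]
  rw [hker, leadSet_fil, hrange] at h3
  refine ⟨h3.2.1, ?_⟩
  rw [← h3.2.2, ← ncard_leadSet_diff_Ici g h1]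
  rfl

lemma isLattice_fil (c : ℤ) : (fil K h (c * h)).IsLattice (LaurentSeries K) := by
  rw [← colSpan_tDiag_const]
  exact isLattice_latticeOf (isUnit_tDiag (K := K) fun _ : Fin h => c).unit

/-- The shift on window coordinates that corresponds to multiplication by `t`. -/
def shiftVec {R : Type*} [CommRing R] (h : ℕ) {d : ℕ} (x : Fin (2 * d) → R) (j : Fin (2 * d)) : R :=
  if h ≤ (j : ℕ) then x ⟨j - h, (Nat.sub_le _ _).trans_lt j.2⟩ else 0

lemma windowCoords_X_smul {v : NSpace K h} (hv : v ∈ fil K h (-(n * h))) :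
    windowCoords n ((PowerSeries.X : PowerSeries K) • v) = shiftVec h (windowCoords n v) := by
  funext j
  rw [windowCoords, eCoeff_X_smul, shiftVec]
  split_ifs with hj
  · simp only [windowCoords]
    congr 1
    push_cast [hj]
    ring
  · exact hv _ (by omega)

/-- The lattice that corresponds to a subspace stable under multiplication by `t`. -/
def latticeOfStable (w : Matrix (Fin (n * h)) (Fin (2 * (n * h))) K)
    (hw : ∀ x ∈ rowSpan w, shiftVec h x ∈ rowSpan w) : OSubmodule K h where
  carrier := {v | v ∈ fil K h (-(n * h)) ∧ windowCoords n v ∈ rowSpan w}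
  add_mem' := fun {v v'} hv hv' => ⟨Submodule.add_mem _ hv.1 hv'.1, by
    rw [← windowₗ_apply, map_add]
    exact Submodule.add_mem _ hv.2 hv'.2⟩
  zero_mem' := ⟨Submodule.zero_mem _, by
    rw [← windowₗ_apply, map_zero]
    exact Submodule.zero_mem _⟩
  smul_mem' := by
    have hh := natCast_h_pos (h := h)
    -- power series act through their first `2 n` coefficients
    have key : ∀ (N : ℕ) (f : PowerSeries K) (v : NSpace K h), v ∈ fil K h (-(n * h)) →
        windowCoords n v ∈ rowSpan w → v ∈ fil K h (n * h - N * h) →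
        windowCoords n (f • v) ∈ rowSpan w := by
      intro N
      induction N with
      | zero =>
        intro f v hv _ hvN
        have h1 : f • v ∈ fil K h (n * h) := Submodule.smul_mem _ _ (by simpa using hvN)
        rw [(mem_fil_iff_windowCoords (Submodule.smul_mem _ _ hv)).1 h1]
        exact Submodule.zero_mem _
      | succ N ih =>
        intro f v hv hvw hvN
        rw [PowerSeries.eq_X_mul_shift_add_const f, add_smul, mul_comm PowerSeries.X, mul_smul,
          C_smul, ← windowₗ_apply, map_add, map_smul (windowₗ K h n) (PowerSeries.constantCoeff f)]
        refine Submodule.add_mem _ (ih _ _ (Submodule.smul_mem _ _ hv) ?_ fun i hi => ?_)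
          (Submodule.smul_mem _ _ hvw)
        · rw [windowCoords_X_smul hv]
          exact hw _ hvw
        · rw [eCoeff_X_smul]
          refine hvN _ ?_
          push_cast
          linarith
    rintro f v ⟨hv, hvw⟩
    refine ⟨Submodule.smul_mem _ _ hv, key (2 * n) f v hv hvw ?_⟩
    refine fil_anti ?_ hv
    push_cast
    linarith

/-- A subspace of dimension `n h` that is stable under `t` belongs to a lattice of volume `0`. -/
lemma latticeOfStable_spec {w : Matrix (Fin (n * h)) (Fin (2 * (n * h))) K}
    (hli : LinearIndependent K w.row) (hw : ∀ x ∈ rowSpan w, shiftVec h x ∈ rowSpan w) :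
    latticeOfStable w hw ∈ grassmannian0 K h ∩ window K h n ∧
      IsFrame n (latticeOfStable w hw) w := by
  set M := latticeOfStable w hw with hM
  have hmem : ∀ v, v ∈ M ↔ v ∈ fil K h (-(n * h)) ∧ windowCoords n v ∈ rowSpan w :=
    fun v => Iff.rfl
  have hle : M ≤ fil K h (-(n * h)) := fun v hv => hv.1
  have hge : fil K h (n * h) ≤ M := by
    intro v hv
    have hv' : v ∈ fil K h (-(n * h)) := fil_anti (by
      have : (0 : ℤ) ≤ n * h := by positivity
      omega) hv
    refine ⟨hv', ?_⟩
    rw [(mem_fil_iff_windowCoords hv').1 hv]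
    exact Submodule.zero_mem _
  have hwin : M ∈ window K h n := mem_window_iff.2 ⟨hge, hle⟩
  have himg : (rowSpan w : Set (Fin (2 * (n * h)) → K)) =
      windowCoords n '' (M : Set (NSpace K h)) := by
    ext x
    constructor
    · intro hx
      obtain ⟨v, hv, rfl, -⟩ := exists_windowCoords_eq x
      exact ⟨v, ⟨hv, hx⟩, rfl⟩
    · rintro ⟨v, hv, rfl⟩
      exact hv.2
  have hfg : M.FG := by
    have h1 := isLattice_fil (K := K) (h := h) (-n)
    rw [neg_mul] at h1
    have h2 : IsNoetherian (PowerSeries K) (fil K h (-(n * h))) := inferInstance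
    have h3 := isNoetherian_of_le hle
    exact (Module.Finite.iff_fg).1 inferInstance
  have hlat : M.IsLattice (LaurentSeries K) := by
    have := isLattice_fil (K := K) (h := h) n
    exact Submodule.IsLattice.of_le_of_isLattice_of_fg _ hge hfg
  obtain ⟨g, hg⟩ := exists_latticeOf_eq hlat
  refine ⟨⟨⟨g, hg, ?_⟩, hwin⟩, hli, himg⟩
  obtain ⟨-, hfr⟩ := finrank_map_windowₗ (g := g) (n := n) (by rw [hg]; exact hwin)
  have hmap : (asSub (latticeOf g)).map (windowₗ K h n) = rowSpan w := by
    rw [hg]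
    exact SetLike.coe_injective himg.symm
  rw [hmap, finrank_span_eq_card hli, Fintype.card_fin] at hfr
  push_cast at hfr
  linarith

/-- The vectors of Plücker coordinates of a set of lattices. -/
def pluckerSet (n : ℕ) (S : Set (OSubmodule K h)) : Set (CoordVec (PluckerIndex (n * h)) K) :=
  {p | ∃ M ∈ S, ∃ w, IsFrame n M w ∧ ∃ c : K, p.1 = c • pluckerCoords w}

/-- A lattice in the window is determined by its Plücker coordinates, up to a scalar. -/
lemma eq_of_coords {M M' : OSubmodule K h} (hM : M ∈ window K h n) (hM' : M' ∈ window K h n)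
    {w w' : Matrix (Fin (n * h)) (Fin (2 * (n * h))) K} (hw : IsFrame n M w)
    (hw' : IsFrame n M' w') {p : CoordVec (PluckerIndex (n * h)) K} {c c' : K}
    (hp : p.1 = c • pluckerCoords w) (hp' : p.1 = c' • pluckerCoords w') : M = M' := by
  obtain ⟨J, hJ⟩ := Function.ne_iff.1 p.2
  exact eq_of_rowSpan_eq hM hM' hw.2 hw'.2
    ((chartMat_spec hJ hp).2.1.symm.trans (chartMat_spec hJ hp').2.1)

variable [IsAlgClosed K]

/-- The points of the Grassmannian that come from lattices are those stable under `t`, and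
stability under `t` is a closed condition: the residue of a shifted row modulo the row space has
to vanish. -/
lemma isClosed_pluckerSet_grassmannian0 (K : Type*) [Field K] [IsAlgClosed K] (h : ℕ) [NeZero h]
    (n : ℕ) : IsClosed (pluckerSet n (grassmannian0 K h ∩ window K h n)) := by
  classical
  -- the `j`-th coordinate of the shift of the `l`-th row, reduced modulo the rows of `A`
  let stab : ∀ {R : Type _} [CommRing R], PluckerIndex (n * h) →
      Matrix (Fin (n * h)) (Fin (2 * (n * h))) R → Fin (n * h) → Fin (2 * (n * h)) → R :=
    fun J A l j => shiftVec h (A l) j - ∑ l', shiftVec h (A l) (J l') * A l' j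
  have hmap : ∀ (J : PluckerIndex (n * h)) (p : CoordVec (PluckerIndex (n * h)) K) l j,
      MvPolynomial.eval ((p.1 J)⁻¹ • p.1) (stab J (chartPoly K J) l j) =
        stab J (chartMat J p.1) l j := by
    intro J p l j
    have hs : ∀ j', MvPolynomial.eval ((p.1 J)⁻¹ • p.1) (shiftVec h (chartPoly K J l) j') =
        shiftVec h (chartMat J p.1 l) j' := by
      intro j'
      unfold shiftVec
      split_ifs
      · rfl
      · exact map_zero _
    simp only [stab, map_sub, map_sum, map_mul, hs]
    rfl
  have hset : pluckerSet n (grassmannian0 K h ∩ window K h n) = grassCone K (n * h) ∩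
      (⋃ (J : PluckerIndex (n * h)) (l : Fin (n * h)) (j : Fin (2 * (n * h))),
        {p : CoordVec (PluckerIndex (n * h)) K | p.1 J ≠ 0 ∧
          MvPolynomial.eval ((p.1 J)⁻¹ • p.1) (stab J (chartPoly K J) l j) ≠ 0})ᶜ := by
    ext p
    simp only [hmap, Set.mem_inter_iff, Set.mem_compl_iff, Set.mem_iUnion, Set.mem_ofPred_eq,
      not_exists, not_and, not_not]
    constructor
    · rintro ⟨M, hM, w, hw, c, hp⟩
      refine ⟨⟨w, c, hp⟩, fun J l j hJ => ?_⟩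
      obtain ⟨hW1, hW2, -⟩ := chartMat_spec hJ hp
      have himg : (rowSpan (chartMat J p.1) : Set (Fin (2 * (n * h)) → K)) =
          windowCoords n '' (M : Set (NSpace K h)) := by rw [hW2]; exact hw.2
      have hl : chartMat J p.1 l ∈ (rowSpan (chartMat J p.1) : Set (Fin (2 * (n * h)) → K)) :=
        Submodule.subset_span ⟨l, rfl⟩
      rw [himg] at hl
      obtain ⟨v, hv, hvl⟩ := hl
      have h1 : shiftVec h (chartMat J p.1 l) ∈ rowSpan (chartMat J p.1) := by
        rw [← hvl, ← windowCoords_X_smul ((mem_window_iff.1 hM.2).2 hv), ← SetLike.mem_coe, himg]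
        exact ⟨_, M.smul_mem _ hv, rfl⟩
      have h2 := congrFun ((mem_rowSpan_iff_of_submatrix_eq_one hW1).1 h1) j
      simp only [stab]
      rw [h2, sub_eq_zero]
      rfl
    · rintro ⟨⟨w, c, hp⟩, hst⟩
      obtain ⟨J, hJ⟩ := Function.ne_iff.1 p.2
      obtain ⟨hW1, hW2, hW3⟩ := chartMat_spec hJ hp
      have hJ0 : p.1 J ≠ 0 := hJ
      have hrow : ∀ l, shiftVec h (chartMat J p.1 l) ∈ rowSpan (chartMat J p.1) := by
        intro l
        rw [mem_rowSpan_iff_of_submatrix_eq_one hW1]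
        funext j
        exact sub_eq_zero.1 (hst J l j hJ)
      have hstable : ∀ x ∈ rowSpan (chartMat J p.1), shiftVec h x ∈ rowSpan (chartMat J p.1) := by
        intro x hx
        induction hx using Submodule.span_induction with
        | mem x hx =>
          obtain ⟨l, rfl⟩ := hx
          exact hrow l
        | zero =>
          have : shiftVec h (0 : Fin (2 * (n * h)) → K) = 0 := funext fun j => by simp [shiftVec]
          rw [this]
          exact Submodule.zero_mem _
        | add x y _ _ hx hy =>
          have : shiftVec h (x + y) = shiftVec h x + shiftVec h y := funext fun j => by
            simp only [shiftVec, Pi.add_apply]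
            split_ifs <;> simp
          rw [this]
          exact Submodule.add_mem _ hx hy
        | smul a x _ hx =>
          have : shiftVec h (a • x) = a • shiftVec h x := funext fun j => by
            simp only [shiftVec, Pi.smul_apply]
            split_ifs <;> simp
          rw [this]
          exact Submodule.smul_mem _ _ hx
      have hli : LinearIndependent K (chartMat J p.1).row := by
        refine linearIndependent_row_of_pluckerCoords (J := J) ?_
        rw [hW3, Pi.smul_apply, smul_eq_mul, inv_mul_cancel₀ hJ0]
        exact one_ne_zero
      obtain ⟨h1, h2⟩ := latticeOfStable_spec hli hstable
      refine ⟨_, h1, _, h2, p.1 J, ?_⟩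
      rw [hW3, smul_smul, mul_inv_cancel₀ hJ0, one_smul]
  rw [hset]
  refine isClosed_grassCone.inter (IsOpen.isClosed_compl ?_)
  exact isOpen_iUnion fun J => isOpen_iUnion fun l => isOpen_iUnion fun j =>
    isOpen_eval_div_ne_zero J _

end Window

/-! ### Semicontinuity of the numerical invariants -/

section Semicontinuity

variable (k : Type*) {K : Type*} [Field k] [Fintype k] [Field K] [Algebra k K] (m : ℕ) {h : ℕ}
  [NeZero h]

/-- The number of leading indices of `M` that are smaller than `a` or not attained on `L_e(M)`. -/
def filCodim (e : ℕ) (a : ℤ) (M : OSubmodule K h) : ℕ :=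
  (leadSet (M : Set (NSpace K h)) \ leadSet ((level k m e (asSub M) ⊓ asSub (fil K h a) :
    Submodule K (NSpace K h)) : Set (NSpace K h))).ncard

/-- The indices of the conditions that describe `L_e(M) ∩ fil a` inside `M`. -/
abbrev CondIndex (h n e : ℕ) (a : ℤ) : Type :=
  Finset.Ico (-(n * h : ℤ)) a ⊕ Finset.Ico (-(n * h : ℤ) - e * h) (-(n * h : ℤ)) ⊕
    Fin (2 * (n * h))

/-- The conditions on the coefficients `c` of a vector `u` that express that the coefficients of `u`
with index less than `a` vanish and that `t ^ (-e) b u` lies in the lattice with normalized frame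
`W`. -/
def condVec {R : Type*} [CommRing R] (h n m e : ℕ) (a : ℤ) (J : Fin (n * h) → Fin (2 * (n * h)))
    (W : Matrix (Fin (n * h)) (Fin (2 * (n * h))) R) (c : ℤ → R) : CondIndex h n e a → R :=
  Sum.elim (fun x => c x) (Sum.elim (fun x => c (x + e * h - m)) fun j =>
    c (((j : ℕ) : ℤ) - n * h + e * h - m) -
      ∑ l, c (((J l : ℕ) : ℤ) - n * h + e * h - m) * W l j)

/-- The coefficients of generators of the Frobenius twist of a lattice with frame `W`, modulo
vectors with large leading index. -/
def twistGen {R : Type*} [CommRing R] (q h n : ℕ) (b : ℤ)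
    (W : Matrix (Fin (n * h)) (Fin (2 * (n * h))) R) :
    Fin (n * h) ⊕ Finset.Ico (n * h : ℤ) b → ℤ → R :=
  Sum.elim (fun l => coeffExt fun j => W l j ^ q) fun x i => if i = x then 1 else 0

/-- The matrix of the conditions `condVec`, evaluated on the generators `twistGen`. -/
def condMat {R : Type*} [CommRing R] (q h n m e : ℕ) (a : ℤ)
    (J : Fin (n * h) → Fin (2 * (n * h))) (W : Matrix (Fin (n * h)) (Fin (2 * (n * h))) R) :
    Matrix (Fin (n * h) ⊕ Finset.Ico (n * h : ℤ) (max a (n * h + e * h))) (CondIndex h n e a) R :=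
  Matrix.of fun r => condVec h n m e a J W (twistGen q h n _ W r)

lemma condMat_map {R R' : Type*} [CommRing R] [CommRing R'] (f : R →+* R') (q h n m e : ℕ) (a : ℤ)
    (J : Fin (n * h) → Fin (2 * (n * h))) (W : Matrix (Fin (n * h)) (Fin (2 * (n * h))) R) :
    (condMat q h n m e a J W).map f = condMat q h n m e a J (W.map f) := by
  have h1 : ∀ r i, f (twistGen q h n (max a (n * h + e * h)) W r i) =
      twistGen q h n (max a (n * h + e * h)) (W.map f) r i := by
    rintro (l | x) i
    · simp only [twistGen, Sum.elim_inl, ← coeffExt_map, map_pow]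
      rfl
    · simp only [twistGen, Sum.elim_inr]
      split_ifs <;> simp
  refine Matrix.ext fun r s => ?_
  rcases s with x | x | j
  · simp [condMat, condVec, h1]
  · simp [condMat, condVec, h1]
  · simp [condMat, condVec, h1]

/-- The conditions as a linear map on `N`. -/
def condₗ (n e : ℕ) (a : ℤ) (J : Fin (n * h) → Fin (2 * (n * h)))
    (W : Matrix (Fin (n * h)) (Fin (2 * (n * h))) K) :
    NSpace K h →ₗ[K] (CondIndex h n e a → K) where
  toFun v := condVec h n m e a J W (eCoeff v)
  map_add' v w := by
    funext s
    rcases s with x | x | j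
    · simp [condVec]
    · simp [condVec]
    · simp only [condVec, Sum.elim_inr, eCoeff_add, add_mul, Finset.sum_add_distrib, Pi.add_apply]
      ring
  map_smul' c v := by
    funext s
    rcases s with x | x | j
    · simp [condVec]
    · simp [condVec]
    · simp only [condVec, Sum.elim_inr, eCoeff_smul, mul_assoc, ← Finset.mul_sum, Pi.smul_apply,
        smul_eq_mul, RingHom.id_apply]
      ring

/-- The Frobenius twist of a lattice with frame `W` has the frame `W ^ q` (entrywise). -/
lemma windowCoords_tbSigma_mem_iff [IsAlgClosed K] {n : ℕ}
    {W : Matrix (Fin (n * h)) (Fin (2 * (n * h))) K} (v : NSpace K h) :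
    windowCoords n (tbSigma k 0 0 v) ∈ rowSpan (W.map (· ^ Fintype.card k)) ↔
      windowCoords n v ∈ rowSpan W := by
  have hq : Fintype.card k ≠ 0 := Fintype.card_ne_zero
  have hfr : ∀ j, windowCoords n (tbSigma k 0 0 v) j = windowCoords n v j ^ Fintype.card k := by
    intro j
    simp [windowCoords]
  have hsum : ∀ y j, Matrix.vecMul (fun l => y l ^ Fintype.card k) (W.map (· ^ Fintype.card k)) j =
      Matrix.vecMul y W j ^ Fintype.card k := by
    intro y j
    rw [Matrix.vecMul_eq_sum, Matrix.vecMul_eq_sum, Finset.sum_apply, Finset.sum_apply,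
      sum_pow_card]
    exact Finset.sum_congr rfl fun l _ => by simp [mul_pow]
  rw [mem_rowSpan, mem_rowSpan]
  constructor
  · rintro ⟨y, hy⟩
    choose r hr using exists_pow_card_eq (K := K) k
    refine ⟨fun l => r (y l), funext fun j => ?_⟩
    have h1 := congrFun hy j
    have h2 : y = fun l => r (y l) ^ Fintype.card k := funext fun l => (hr _).symm
    rw [hfr, h2, hsum] at h1
    rw [← sub_eq_zero, ← pow_eq_zero_iff hq, sub_pow_card, h1, sub_self]
  · rintro ⟨y, hy⟩
    refine ⟨fun l => y l ^ Fintype.card k, funext fun j => ?_⟩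
    rw [hfr, hsum, hy]

lemma leadSet_image_tbSigma (S : Set (NSpace K h)) :
    leadSet (tbSigma k 0 0 '' S) = leadSet S := by
  ext a
  have h1 : ∀ v : NSpace K h, IsLead (tbSigma k 0 0 v) a ↔ IsLead v a := by
    intro v
    have := isLead_tbSigma k (m := 0) (e := 0) (v := v) (a := a)
    simpa using this
  constructor
  · rintro ⟨_, ⟨v, hv, rfl⟩, hl⟩
    exact ⟨v, hv, (h1 v).1 hl⟩
  · rintro ⟨v, hv, hl⟩
    exact ⟨_, ⟨v, hv, rfl⟩, (h1 v).2 hl⟩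

/-- The number `filCodim` is the rank of a matrix whose entries are polynomials in those of a
normalized frame `W`. To avoid `q`-th roots, the conditions are evaluated on the Frobenius twist
of `M`, which has the frame `W ^ q` (entrywise). -/
lemma filCodim_eq_rank [IsAlgClosed K] {n : ℕ} {M : OSubmodule K h} (hM : M ∈ window K h n)
    {W : Matrix (Fin (n * h)) (Fin (2 * (n * h))) K} {J : Fin (n * h) → Fin (2 * (n * h))}
    (hJ : W.submatrix id J = 1)
    (hW : (rowSpan W : Set (Fin (2 * (n * h)) → K)) = windowCoords n '' (M : Set (NSpace K h)))
    (e : ℕ) (a : ℤ) :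
    filCodim k m e a M = (condMat (Fintype.card k) h n m e a J W).rank := by
  have hq : Fintype.card k ≠ 0 := Fintype.card_ne_zero
  have hnh : (0 : ℤ) ≤ n * h := by positivity
  have heh : (0 : ℤ) ≤ e * h := by positivity
  have hmemM := fun v => mem_iff_of_isFrame hM hW (v := v)
  set Wq := W.map (· ^ Fintype.card k) with hWq
  -- the Frobenius twist `V` of `M`
  let V : Submodule K (NSpace K h) :=
    asSub (fil K h (-(n * h))) ⊓ (rowSpan Wq).comap (windowₗ K h n)
  have hmemV : ∀ v, v ∈ V ↔ v ∈ fil K h (-(n * h)) ∧ windowCoords n v ∈ rowSpan Wq :=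
    fun v => Iff.rfl
  have htwist : ∀ v, tbSigma k 0 0 v ∈ V ↔ v ∈ M := by
    intro v
    rw [hmemV, hmemM, windowCoords_tbSigma_mem_iff]
    refine and_congr_left fun _ => forall₂_congr fun i hi => ?_
    rw [eCoeff_tbSigma, pow_eq_zero_iff hq]
    simp
  have hVimg : (V : Set (NSpace K h)) = tbSigma k 0 0 '' (M : Set (NSpace K h)) := by
    ext u
    constructor
    · intro hu
      obtain ⟨v, rfl⟩ := exists_tbSigma_eq (m := 0) k 0 u
      exact ⟨v, (htwist v).1 hu, rfl⟩
    · rintro ⟨v, hv, rfl⟩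
      exact (htwist v).2 hv
  have hcoef : ∀ (v : NSpace K h) (i : ℤ),
      eCoeff (tbSigma k 0 0 v) (i + e * h - m) = eCoeff (tbSigma k m e v) i := by
    intro v i
    simp
  have hcond : ∀ v ∈ M, condₗ m n e a J W (tbSigma k 0 0 v) = 0 ↔
      v ∈ level k m e (asSub M) ⊓ asSub (fil K h a) := by
    intro v hv
    have h1 : condₗ m n e a J W (tbSigma k 0 0 v) = 0 ↔
        (∀ x ∈ Finset.Ico (-(n * h : ℤ)) a, eCoeff v x = 0) ∧
        (∀ x ∈ Finset.Ico (-(n * h : ℤ) - e * h) (-(n * h : ℤ)), eCoeff (tbSigma k m e v) x = 0) ∧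
        windowCoords n (tbSigma k m e v) =
          Matrix.vecMul (fun l => windowCoords n (tbSigma k m e v) (J l)) W := by
      rw [funext_iff]
      change (∀ s, condVec h n m e a J W (eCoeff (tbSigma k 0 0 v)) s = 0) ↔ _
      simp only [condVec, hcoef, Sum.forall, Sum.elim_inl, Sum.elim_inr, Subtype.forall, sub_eq_zero]
      refine and_congr (forall₂_congr fun x _ => ?_) (and_congr_right fun _ => ?_)
      · rw [eCoeff_tbSigma, pow_eq_zero_iff hq]
        simp
      · rw [funext_iff]
        refine forall_congr' fun j => ?_
        rw [Matrix.vecMul_eq_sum, Finset.sum_apply]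
        rfl
    rw [h1, ← mem_rowSpan_iff_of_submatrix_eq_one hJ]
    have hvfil := ((hmemM v).1 hv).1
    constructor
    · rintro ⟨h2, h3, h4⟩
      refine ⟨⟨hv, (hmemM _).2 ⟨fun i hi => ?_, h4⟩⟩, fun i hi => ?_⟩
      · by_cases hi' : -(n * h : ℤ) - e * h ≤ i
        · exact h3 i (Finset.mem_Ico.2 ⟨hi', hi⟩)
        · rw [eCoeff_tbSigma, hvfil _ (by omega), zero_pow hq]
      · by_cases hi' : -(n * h : ℤ) ≤ i
        · exact h2 i (Finset.mem_Ico.2 ⟨hi', hi⟩)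
        · exact hvfil i (by omega)
    · rintro ⟨⟨-, h2⟩, h3⟩
      obtain ⟨h4, h5⟩ := (hmemM _).1 h2
      exact ⟨fun x hx => h3 x (Finset.mem_Ico.1 hx).2,
        fun x hx => h4 x (Finset.mem_Ico.1 hx).2, h5⟩
  let f : V →ₗ[K] (CondIndex h n e a → K) := condₗ m n e a J W ∘ₗ V.subtype
  have hker : kerSet V f = tbSigma k 0 0 '' ((level k m e (asSub M) ⊓ asSub (fil K h a) :
      Submodule K (NSpace K h)) : Set (NSpace K h)) := by
    ext u
    constructor
    · rintro ⟨hu, h0⟩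
      obtain ⟨v, rfl⟩ := exists_tbSigma_eq (m := 0) k 0 u
      exact ⟨v, (hcond v ((htwist v).1 hu)).1 h0, rfl⟩
    · rintro ⟨v, hv, rfl⟩
      have hvM : v ∈ M := hv.1.1
      exact ⟨(htwist v).2 hvM, (hcond v hvM).2 hv⟩
  set b : ℤ := max a (n * h + e * h) with hb
  have hba : a ≤ b := le_max_left _ _
  have hbn : (n * h + e * h : ℤ) ≤ b := le_max_right _ _
  have hkill : ∀ v : NSpace K h, (∀ i < b, eCoeff v i = 0) → condₗ m n e a J W v = 0 := by
    intro v hv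
    funext s
    change condVec h n m e a J W (eCoeff v) s = 0
    have hj : ∀ j : Fin (2 * (n * h)), eCoeff v (((j : ℕ) : ℤ) - n * h + e * h - m) = 0 := by
      intro j
      have : ((j : ℕ) : ℤ) < 2 * (n * h) := by exact_mod_cast j.2
      exact hv _ (by linarith)
    rcases s with x | x | j
    · exact hv _ ((Finset.mem_Ico.1 x.2).2.trans_le hba)
    · have := (Finset.mem_Ico.1 x.2).2
      exact hv _ (by linarith)
    · simp only [condVec, Sum.elim_inr, hj, zero_mul, Finset.sum_const_zero, sub_zero]
  obtain ⟨-, -, hrank⟩ := ncard_leadSet_diff V f (a := -(n * h)) (R := b) (fun v hv => hv.1)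
    (fun v hv => hkill v hv)
  have hlead : filCodim k m e a M = (leadSet (V : Set (NSpace K h)) \ leadSet (kerSet V f)).ncard := by
    rw [hVimg, hker, leadSet_image_tbSigma, leadSet_image_tbSigma]
    rfl
  rw [hlead, hrank, Matrix.rank_eq_finrank_span_row]
  suffices hspan : LinearMap.range f =
      Submodule.span K (Set.range (condMat (Fintype.card k) h n m e a J W).row) by rw [hspan]
  -- generators of `V` modulo vectors killed by the conditions
  have hgen : ∀ r, ∃ u ∈ V, eCoeff u = twistGen (Fintype.card k) h n b W r := by
    rintro (l | x)
    · obtain ⟨u, hu1, hu2, hu3⟩ := exists_windowCoords_eq (K := K) (h := h) (n := n)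
        fun j => W l j ^ Fintype.card k
      refine ⟨u, ⟨hu1, ?_⟩, funext hu3⟩
      change windowCoords n u ∈ rowSpan Wq
      rw [hu2]
      exact Submodule.subset_span ⟨l, rfl⟩
    · have hx := (Finset.mem_Ico.1 x.2).1
      have h1 : eVec K h x ∈ fil K h (n * h) := fun i hi =>
        (exists_isLead_eVec (x : ℤ)).2 i (by linarith)
      have h2 : eVec K h x ∈ fil K h (-(n * h)) := fil_anti (by linarith) h1
      refine ⟨eVec K h x, ⟨h2, ?_⟩, funext fun i => ?_⟩
      · change windowCoords n (eVec K h x) ∈ rowSpan Wq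
        rw [(mem_fil_iff_windowCoords h2).1 h1]
        exact Submodule.zero_mem _
      · exact eCoeff_eVec _ _
  choose u huV hu using hgen
  have hrow : ∀ r, (condMat (Fintype.card k) h n m e a J W).row r = condₗ m n e a J W (u r) := by
    intro r
    change _ = condVec h n m e a J W (eCoeff (u r))
    rw [hu]
    rfl
  apply le_antisymm
  · rintro _ ⟨⟨v, hv⟩, rfl⟩
    change condₗ m n e a J W v ∈ _
    have hrowmem : ∀ r, condₗ m n e a J W (u r) ∈
        Submodule.span K (Set.range (condMat (Fintype.card k) h n m e a J W).row) := fun r =>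
      Submodule.subset_span ⟨r, hrow r⟩
    obtain ⟨y, hy⟩ := mem_rowSpan.1 ((hmemV v).1 hv).2
    set v₁ := v - ∑ l, y l • u (Sum.inl l) with hv₁
    have hv₁V : v₁ ∈ V := V.sub_mem hv (V.sum_mem fun l _ => V.smul_mem _ (huV _))
    have hv₁fil : v₁ ∈ fil K h (n * h) := by
      rw [mem_fil_iff_windowCoords hv₁V.1]
      have hul : ∀ l, windowCoords n (u (Sum.inl l)) = Wq l := by
        intro l
        funext j
        rw [windowCoords, hu]
        have := coeffExt_sub (fun j => W l j ^ Fintype.card k) j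
        push_cast at this
        exact this
      rw [← windowₗ_apply, hv₁, map_sub, map_sum, windowₗ_apply, hy, Matrix.vecMul_eq_sum]
      simp only [map_smul, windowₗ_apply, hul]
      exact sub_self _
    set v₂ := v₁ - ∑ x : Finset.Ico (n * h : ℤ) b, eCoeff v₁ x • u (Sum.inr x) with hv₂
    have hv₂0 : condₗ m n e a J W v₂ = 0 := by
      refine hkill _ fun i hi => ?_
      rw [hv₂, eCoeff_sub, eCoeff_sum]
      simp only [eCoeff_smul, hu, twistGen, Sum.elim_inr]
      by_cases hin : n * h ≤ i
      · rw [Finset.sum_eq_single (⟨i, Finset.mem_Ico.2 ⟨hin, hi⟩⟩ :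
          {x // x ∈ Finset.Ico (n * h : ℤ) b})]
        · simp
        · intro x _ hx
          rw [if_neg fun he => hx (Subtype.ext he.symm), mul_zero]
        · exact fun hx => absurd (Finset.mem_univ _) hx
      · rw [hv₁fil i (by omega), zero_sub, neg_eq_zero]
        refine Finset.sum_eq_zero fun x _ => ?_
        have hx := (Finset.mem_Ico.1 x.2).1
        rw [if_neg (by omega), mul_zero]
    have hv' : v = v₂ + ∑ x : Finset.Ico (n * h : ℤ) b, eCoeff v₁ x • u (Sum.inr x) + ∑ l, y l • u (Sum.inl l) := by
      rw [hv₂, hv₁]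
      abel
    rw [hv', map_add, map_add, hv₂0, zero_add, map_sum, map_sum]
    refine Submodule.add_mem _ (Submodule.sum_mem _ fun x _ => ?_)
      (Submodule.sum_mem _ fun l _ => ?_)
    · rw [map_smul]
      exact Submodule.smul_mem _ _ (hrowmem _)
    · rw [map_smul]
      exact Submodule.smul_mem _ _ (hrowmem _)
  · rw [Submodule.span_le]
    rintro _ ⟨r, rfl⟩
    exact ⟨⟨u r, huV r⟩, (hrow r).symm⟩

/-- The loci of lattices with prescribed values of finitely many numbers `filCodim` are locally
closed, since these numbers are ranks. -/
lemma isLocallyClosed_pluckerSet [IsAlgClosed K] (n : ℕ) (F : Finset (ℕ × ℤ)) (c : ℕ × ℤ → ℕ) :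
    IsLocallyClosed (pluckerSet n {M : OSubmodule K h | M ∈ grassmannian0 K h ∩ window K h n ∧
      ∀ x ∈ F, filCodim k m x.1 x.2 M = c x}) := by
  let U : ℕ × ℤ → ℕ → Set (CoordVec (PluckerIndex (n * h)) K) := fun x r =>
    ⋃ J : PluckerIndex (n * h), {p | p.1 J ≠ 0 ∧ r ≤
      ((condMat (Fintype.card k) h n m x.1 x.2 J (chartPoly K J)).map
        (MvPolynomial.eval ((p.1 J)⁻¹ • p.1))).rank}
  have hU : ∀ x r, IsOpen (U x r) := fun x r =>
    isOpen_iUnion fun J => isOpen_chart_le_rank J _ r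
  have hUmem : ∀ (x : ℕ × ℤ) (r : ℕ) (M : OSubmodule K h), M ∈ window K h n → ∀ w, IsFrame n M w →
      ∀ (p : CoordVec (PluckerIndex (n * h)) K) (a : K), p.1 = a • pluckerCoords w →
        (p ∈ U x r ↔ r ≤ filCodim k m x.1 x.2 M) := by
    intro x r M hM w hw p a hp
    have h1 : ∀ J, p.1 J ≠ 0 → ((condMat (Fintype.card k) h n m x.1 x.2 J (chartPoly K J)).map
        (MvPolynomial.eval ((p.1 J)⁻¹ • p.1))).rank = filCodim k m x.1 x.2 M := by
      intro J hJ
      obtain ⟨hW1, hW2, -⟩ := chartMat_spec hJ hp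
      rw [filCodim_eq_rank k m hM hW1 (by rw [hW2]; exact hw.2), condMat_map]
      rfl
    simp only [U, Set.mem_iUnion, Set.mem_ofPred_eq]
    constructor
    · rintro ⟨J, hJ, hr⟩
      rwa [h1 J hJ] at hr
    · intro hr
      obtain ⟨J, hJ⟩ := Function.ne_iff.1 p.2
      exact ⟨J, hJ, by rwa [h1 J hJ]⟩
  have hset : pluckerSet n {M : OSubmodule K h | M ∈ grassmannian0 K h ∩ window K h n ∧
      ∀ x ∈ F, filCodim k m x.1 x.2 M = c x} =
      pluckerSet n (grassmannian0 K h ∩ window K h n) ∩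
        ⋂ x ∈ F, (U x (c x) ∩ (U x (c x + 1))ᶜ) := by
    ext p
    simp only [Set.mem_inter_iff, Set.mem_iInter, Set.mem_compl_iff]
    constructor
    · rintro ⟨M, ⟨hM, hF⟩, w, hw, a, hp⟩
      refine ⟨⟨M, hM, w, hw, a, hp⟩, fun x hx => ?_⟩
      rw [hUmem x _ M hM.2 w hw p a hp, hUmem x _ M hM.2 w hw p a hp, hF x hx]
      omega
    · rintro ⟨⟨M, hM, w, hw, a, hp⟩, hF⟩
      refine ⟨M, ⟨hM, fun x hx => ?_⟩, w, hw, a, hp⟩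
      have := hF x hx
      rw [hUmem x _ M hM.2 w hw p a hp, hUmem x _ M hM.2 w hw p a hp] at this
      omega
  rw [hset]
  refine (isClosed_pluckerSet_grassmannian0 K h n).isLocallyClosed.inter ?_
  have hopen : ∀ s : Finset (ℕ × ℤ), IsLocallyClosed (⋂ x ∈ s, (U x (c x) ∩ (U x (c x + 1))ᶜ)) := by
    intro s
    classical
    induction s using Finset.induction_on with
    | empty => simpa using isOpen_univ.isLocallyClosed
    | insert x s _ ih =>
      rw [Finset.set_biInter_insert]
      exact ((hU _ _).isLocallyClosed.inter (hU _ _).isClosed_compl.isLocallyClosed).inter ih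
  exact hopen F

end Semicontinuity

/-! ### Chains of points in Jacobson spaces -/

section Chains

/-- `p` is the first term of a strict chain of length `n` in `P`. -/
def HasChain {α : Type*} [Preorder α] (P : α → Prop) : ℕ → α → Prop
  | 0, p => P p
  | n + 1, p => P p ∧ ∃ p', p < p' ∧ HasChain P n p'

lemma HasChain.head {α : Type*} [Preorder α] {P : α → Prop} {n : ℕ} {p : α}
    (hc : HasChain P n p) : P p := by
  cases n with
  | zero => exact hc
  | succ n => exact hc.1

lemma HasChain.map {α β : Type*} [Preorder α] [Preorder β] {P : α → Prop} {Q : β → Prop}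
    {f : α → β} (hf : ∀ a b, P a → P b → a < b → f a < f b) (hPQ : ∀ a, P a → Q (f a)) {n : ℕ}
    {p : α} (hc : HasChain P n p) : HasChain Q n (f p) := by
  induction n generalizing p with
  | zero => exact hPQ p hc
  | succ n ih =>
    obtain ⟨hp, p', hlt, hc'⟩ := hc
    exact ⟨hPQ p hp, f p', hf p p' hp hc'.head hlt, ih hc'⟩

lemma HasChain.exists_ltSeries {α : Type*} [Preorder α] {P : α → Prop} {n : ℕ} {p : α}
    (hc : HasChain P n p) : ∃ s : LTSeries α, s.length = n ∧ s.head = p := by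
  induction n generalizing p with
  | zero => exact ⟨RelSeries.singleton _ p, rfl, rfl⟩
  | succ n ih =>
    obtain ⟨-, p', hlt, hc'⟩ := hc
    obtain ⟨s, hs, hh⟩ := ih hc'
    exact ⟨s.cons p (by rw [hh]; exact hlt), by simp [hs], by simp⟩

lemma HasChain.le_krullDim {α : Type*} [Preorder α] {P : α → Prop} {n : ℕ} {p : α}
    (hc : HasChain P n p) : (n : WithBot ℕ∞) ≤ Order.krullDim α := by
  obtain ⟨s, rfl, -⟩ := hc.exists_ltSeries
  exact le_iSup (fun s : LTSeries α => (s.length : WithBot ℕ∞)) s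

/-- All terms of a chain lie above the first one. -/
lemma HasChain.and_le {α : Type*} [Preorder α] {P : α → Prop} {n : ℕ} {p : α}
    (hc : HasChain P n p) : HasChain (fun q => P q ∧ p ≤ q) n p := by
  induction n generalizing p with
  | zero => exact ⟨hc, le_rfl⟩
  | succ n ih =>
    obtain ⟨hp, p', hlt, hc'⟩ := hc
    exact ⟨⟨hp, le_rfl⟩, p', hlt, (ih hc').map (f := id) (fun _ _ _ _ h => h)
      fun q hq => ⟨hq.1, hlt.le.trans hq.2⟩⟩

lemma hasChain_ltSeries {α : Type*} [Preorder α] (s : LTSeries α) :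
    HasChain (· ≤ s.last) s.length s.head := by
  have key : ∀ (n : ℕ) (s : LTSeries α), s.length = n → HasChain (· ≤ s.last) n s.head := by
    intro n
    induction n with
    | zero => exact fun s _ => s.head_le_last
    | succ n ih =>
      intro s hs
      have hne : s.length ≠ 0 := by omega
      have h1 := ih (s.tail hne) (by simp [hs])
      rw [RelSeries.last_tail] at h1
      refine ⟨s.head_le_last, _, ?_, h1⟩
      rw [RelSeries.head_tail]
      refine s.strictMono ?_
      rw [Fin.lt_def, Fin.val_one', Nat.mod_eq_of_lt (by omega)]
      exact one_pos
  exact key _ s rfl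

/-- Strictly between `0` and a prime of height at least two of a Noetherian domain there is a
prime that does not contain a given nonzero element. -/
lemma exists_prime_notMem_of_isDomain {A : Type*} [CommRing A] [IsDomain A] [IsNoetherianRing A]
    {f : A} (hf : f ≠ 0) {P q₀ : Ideal A} [P.IsPrime] [q₀.IsPrime] (h0 : q₀ ≠ ⊥) (hlt : q₀ < P) :
    ∃ q : Ideal A, q.IsPrime ∧ q ≠ ⊥ ∧ q < P ∧ f ∉ q := by
  -- primes of height at most one contain no prime other than `0` and themselves
  have height_two : ∀ {I J : Ideal A} [I.IsPrime] [J.IsPrime], I ≠ ⊥ → I < J → ¬ J.height ≤ 1 := by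
    intro I J _ _ hI hIJ hle
    have h1 := Ideal.height_add_one_le_of_lt_of_isPrime (bot_lt_iff_ne_bot.2 hI)
    have h2 := Ideal.height_add_one_le_of_lt_of_isPrime hIJ
    have h3 : (1 : ℕ∞) ≤ I.height := le_trans le_add_self h1
    have h4 : (2 : ℕ∞) ≤ 1 := by
      calc (2 : ℕ∞) = 1 + 1 := by norm_num
        _ ≤ I.height + 1 := by gcongr
        _ ≤ J.height := h2
        _ ≤ 1 := hle
    exact absurd h4 (by norm_num)
  have hS := Ideal.finite_minimalPrimes_of_isNoetherianRing A (Ideal.span {f})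
  have hprime : ∀ i ∈ insert ⊥ (Ideal.span {f}).minimalPrimes, i.IsPrime := by
    rintro i (rfl | hi)
    · exact Ideal.isPrime_bot
    · exact hi.1.1
  -- by prime avoidance `P` has an element `y` outside all minimal primes of `(f)` and `0`; by
  -- Krull's principal ideal theorem a minimal prime of `(y)` below `P` does the job
  have havoid : ¬ (P : Set A) ⊆ ⋃ i ∈ insert ⊥ (Ideal.span {f}).minimalPrimes, (i : Set A) := by
    intro hsub
    obtain ⟨i, hi, hPi⟩ := (Ideal.subset_union_prime_finite (f := fun i : Ideal A => i)
      (hS.insert ⊥) ⊥ ⊥ (fun i hi _ _ => hprime i hi)).1 hsub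
    rcases hi with rfl | hi
    · exact absurd (hlt.trans_le hPi) (not_lt_bot)
    · have := hprime i (Or.inr hi)
      exact height_two h0 (hlt.trans_le hPi)
        (Ideal.height_le_one_of_isPrincipal_of_mem_minimalPrimes _ i hi)
  obtain ⟨y, hyP, hy⟩ := Set.not_subset.1 havoid
  simp only [Set.mem_iUnion, not_exists, SetLike.mem_coe] at hy
  have hy0 : y ≠ 0 := fun h => hy ⊥ (Or.inl rfl) (by simp [h])
  obtain ⟨q, hq, hqP⟩ := Ideal.exists_minimalPrimes_le (I := Ideal.span {y}) (J := P)
    ((Ideal.span_singleton_le_iff_mem _).2 hyP)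
  have hqp : q.IsPrime := hq.1.1
  have hyq : y ∈ q := hq.1.2 (Ideal.mem_span_singleton_self y)
  have hq1 := Ideal.height_le_one_of_isPrincipal_of_mem_minimalPrimes _ q hq
  refine ⟨q, hqp, fun h => hy0 (by simpa [h] using hyq), lt_of_le_of_ne hqP ?_, fun hfq => ?_⟩
  · rintro rfl
    exact height_two h0 hlt hq1
  · obtain ⟨Q, hQ, hQq⟩ := Ideal.exists_minimalPrimes_le (I := Ideal.span {f}) (J := q)
      ((Ideal.span_singleton_le_iff_mem _).2 hfq)
    have hQp : Q.IsPrime := hQ.1.1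
    have hfQ : f ∈ Q := hQ.1.2 (Ideal.mem_span_singleton_self f)
    rcases hQq.lt_or_eq with h | rfl
    · exact height_two (fun h => hf (by simpa [h] using hfQ)) h hq1
    · exact hy Q (Or.inr hQ) hyq

/-- Between two primes of a Noetherian ring that are not neighbours there is one that does not
contain a given element, provided that the smaller one does not contain it. -/
lemma exists_prime_notMem {R : Type*} [CommRing R] [IsNoetherianRing R] {f : R}
    {p p' p'' : PrimeSpectrum R} (hp : f ∉ p.asIdeal) (h1 : p < p') (h2 : p' < p'') :
    ∃ q : PrimeSpectrum R, p < q ∧ q < p'' ∧ f ∉ q.asIdeal := by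
  let π := Ideal.Quotient.mk p.asIdeal
  have hsurj : Function.Surjective π := Ideal.Quotient.mk_surjective
  have hcm : ∀ r : PrimeSpectrum R, p ≤ r → (r.asIdeal.map π).comap π = r.asIdeal := by
    intro r hr
    rw [Ideal.comap_map_of_surjective π hsurj, ← RingHom.ker_eq_comap_bot, Ideal.mk_ker]
    exact sup_eq_left.2 hr
  have hpr : ∀ r : PrimeSpectrum R, p ≤ r → (r.asIdeal.map π).IsPrime := fun r hr =>
    Ideal.map_isPrime_of_surjective hsurj (by rw [Ideal.mk_ker]; exact hr)
  have := hpr p' h1.le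
  have := hpr p'' (h1.trans h2).le
  have hbot : (⊥ : Ideal (R ⧸ p.asIdeal)).comap π = p.asIdeal := by
    rw [← RingHom.ker_eq_comap_bot, Ideal.mk_ker]
  obtain ⟨q, hq, hq0, hqP, hfq⟩ := exists_prime_notMem_of_isDomain (f := π f)
    (P := p''.asIdeal.map π) (q₀ := p'.asIdeal.map π)
    (fun h => hp (Ideal.Quotient.eq_zero_iff_mem.1 h))
    (fun h => h1.ne (PrimeSpectrum.ext (by rw [← hcm p' h1.le, h, hbot])))
    (lt_of_le_of_ne (Ideal.map_mono h2.le) fun h => h2.ne (PrimeSpectrum.ext (by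
      rw [← hcm p' h1.le, h, hcm p'' (h1.trans h2).le])))
  have hinj := Ideal.comap_injective_of_surjective π hsurj
  refine ⟨⟨q.comap π, inferInstance⟩, lt_of_le_of_ne ?_ fun h => hq0 (hinj ?_),
    lt_of_le_of_ne ?_ fun h => hqP.ne (hinj ?_), hfq⟩
  · change p.asIdeal ≤ q.comap π
    exact hbot.symm.le.trans (Ideal.comap_mono bot_le)
  · exact (congrArg PrimeSpectrum.asIdeal h).symm.trans hbot.symm
  · change q.comap π ≤ p''.asIdeal
    exact (Ideal.comap_mono hqP.le).trans (hcm p'' (h1.trans h2).le).le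
  · rw [hcm p'' (h1.trans h2).le, ← h]

/-- In a Noetherian Jacobson ring a chain of primes may be moved, with fixed first term, into the
open set `D(f)`: the intermediate terms are replaced one after the other by
`exists_prime_notMem`, and the last one by a suitable maximal ideal. -/
lemma hasChain_notMem {R : Type*} [CommRing R] [IsNoetherianRing R] [IsJacobsonRing R] (f : R)
    {n : ℕ} {p : PrimeSpectrum R} (hp : f ∉ p.asIdeal) (hc : HasChain (fun _ => True) n p) :
    HasChain (fun q : PrimeSpectrum R => f ∉ q.asIdeal) n p := by
  induction n generalizing p with
  | zero => exact hp
  | succ n ih =>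
    obtain ⟨-, p', hlt, hc'⟩ := hc
    rcases n with _ | n
    · refine ⟨hp, ?_⟩
      have hjac := IsJacobsonRing.out (R := R) (inferInstance) p.2.isRadical
      have hnm : ¬ p.asIdeal.IsMaximal := fun hmax => by
        have := hmax.eq_of_le p'.2.ne_top hlt.le
        exact hlt.ne (PrimeSpectrum.ext this)
      rw [← hjac, Ideal.jacobson, Submodule.mem_sInf] at hp
      push Not at hp
      obtain ⟨M, ⟨hM1, hM2⟩, hfM⟩ := hp
      refine ⟨⟨M, hM2.isPrime⟩, lt_of_le_of_ne hM1 fun he => hnm ?_, hfM⟩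
      rw [he]
      exact hM2
    · obtain ⟨-, p'', hlt', hc''⟩ := hc'
      obtain ⟨q, h1, h2, h3⟩ := exists_prime_notMem hp hlt hlt'
      exact ⟨hp, q, h1, ih h3 ⟨trivial, p'', h2, hc''⟩⟩

end Chains

/-! ### Strata are locally closed -/

section StrataLocallyClosed

/-- The number of `x ∈ A` with `x < a` or `φ x < e`. For a lattice `M` with `A(M) = A` and
`φ(M) = φ` this is the codimension of `L_e(M) ∩ fil a` in `M`. -/
def phiCodim (A : Set ℤ) (φ : ℤ → WithBot ℕ) (e : ℕ) (a : ℤ) : ℕ :=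
  {x | x ∈ A ∧ (x < a ∨ φ x < e)}.ncard

/-- The passage from `a` to `a + 1` increases `phiCodim` by one if `φ a ≥ e`, and not at all
otherwise. -/
lemma IsExtendedSemimodule.le_iff_phiCodim_ne {m h : ℕ} [NeZero h] {μ : Fin h → ℕ} {A : Set ℤ}
    {φ : ℤ → WithBot ℕ} (hp : IsExtendedSemimodule m h μ A φ) (e : ℕ) (a : ℤ) :
    (e : WithBot ℕ) ≤ φ a ↔ phiCodim A φ e (a + 1) ≠ phiCodim A φ e a := by
  have hfin : {x | x ∈ A ∧ (x < a ∨ φ x < e)}.Finite := by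
    obtain ⟨b, hb⟩ := hp.semimodule.bddBelow
    refine ((Set.finite_Ico b a).union (hp.finite_and_ncard_lt e).1).subset ?_
    rintro x ⟨hx, hxa | hxe⟩
    · exact Or.inl ⟨hb hx, hxa⟩
    · exact Or.inr ⟨hp.mem_iff.1 hx, hxe⟩
  by_cases hle : (e : WithBot ℕ) ≤ φ a
  · refine iff_of_true hle ?_
    have ha : a ∈ A := hp.mem_iff.2 fun h => WithBot.natCast_ne_bot e (le_bot_iff.1 (h ▸ hle))
    have h1 : {x | x ∈ A ∧ (x < a + 1 ∨ φ x < e)} = insert a {x | x ∈ A ∧ (x < a ∨ φ x < e)} := by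
      ext x
      simp only [Set.mem_ofPred_eq, Set.mem_insert_iff, Int.lt_add_one_iff, le_iff_lt_or_eq]
      constructor
      · rintro ⟨h2, (h3 | h3) | h3⟩
        · exact Or.inr ⟨h2, Or.inl h3⟩
        · exact Or.inl h3
        · exact Or.inr ⟨h2, Or.inr h3⟩
      · rintro (rfl | ⟨h2, h3 | h3⟩)
        · exact ⟨ha, Or.inl (Or.inr rfl)⟩
        · exact ⟨h2, Or.inl (Or.inl h3)⟩
        · exact ⟨h2, Or.inr h3⟩
    rw [phiCodim, phiCodim, h1, Set.ncard_insert_of_notMem _ hfin]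
    · omega
    · rintro ⟨-, h2 | h2⟩
      · exact lt_irrefl a h2
      · exact absurd hle (not_le.2 h2)
  · refine iff_of_false hle fun H => H ?_
    rw [phiCodim, phiCodim]
    congr 1
    ext x
    simp only [Set.mem_ofPred_eq, Int.lt_add_one_iff, le_iff_lt_or_eq]
    refine and_congr_right fun _ => ⟨?_, fun h3 => h3.imp_left Or.inl⟩
    rintro ((h3 | rfl) | h3)
    · exact Or.inl h3
    · exact Or.inr (not_le.1 hle)
    · exact Or.inr h3

/-- An extended semi-module is determined by the numbers `phiCodim`. -/
lemma IsExtendedSemimodule.exists_phiCodim_ne {m h : ℕ} [NeZero h] {μ : Fin h → ℕ}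
    {p p' : Set ℤ × (ℤ → WithBot ℕ)} (hp : IsExtendedSemimodule m h μ p.1 p.2)
    (hp' : IsExtendedSemimodule m h μ p'.1 p'.2) (hne : p ≠ p') :
    ∃ x : ℕ × ℤ, phiCodim p.1 p.2 x.1 x.2 ≠ phiCodim p'.1 p'.2 x.1 x.2 := by
  by_contra H
  push Not at H
  have h1 : ∀ (e : ℕ) a, (e : WithBot ℕ) ≤ p.2 a ↔ (e : WithBot ℕ) ≤ p'.2 a := fun e a => by
    rw [hp.le_iff_phiCodim_ne, hp'.le_iff_phiCodim_ne, H (e, a), H (e, a + 1)]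
  have h2 : ∀ {x y : WithBot ℕ}, (∀ e : ℕ, (e : WithBot ℕ) ≤ x ↔ (e : WithBot ℕ) ≤ y) → x ≤ y := by
    intro x y hxy
    cases x with
    | bot => exact bot_le
    | coe n => exact (hxy n).1 le_rfl
  have h3 : p.2 = p'.2 := funext fun a =>
    le_antisymm (h2 fun e => h1 e a) (h2 fun e => (h1 e a).symm)
  refine hne (Prod.ext (Set.ext fun a => ?_) h3)
  rw [hp.mem_iff, hp'.mem_iff, h3]

variable {k K : Type*} [Field k] [Fintype k] [Field K] [Algebra k K] {m h : ℕ} [NeZero h]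

lemma filCodim_eq_phiCodim {M : OSubmodule K h} {a₀ : ℤ} (hM : M ≤ fil K h a₀) (e : ℕ) (a : ℤ) :
    filCodim k m e a M = phiCodim (latticeA M) (latticePhi k m M) e a := by
  rw [filCodim, phiCodim, latticeA_eq, leadSet_inf_fil]
  congr 1
  ext x
  rw [Set.mem_sdiff, Set.mem_inter_iff, ← le_latticePhi_iff hM, Set.mem_Ici, Set.mem_ofPred_eq,
    not_and_or, not_le, not_le, or_comm]

lemma filCodim_eq_levelCodim {M : OSubmodule K h} {a : ℤ} (hM : M ≤ fil K h a) (e : ℕ) :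
    filCodim k m e a M = levelCodim k m e (asSub M) := by
  have h1 : level k m e (asSub M) ≤ asSub (fil K h a) := fun v hv => hM (level_le e _ hv)
  rw [filCodim, levelCodim, inf_eq_left.2 h1]
  rfl

variable [IsAlgClosed K]

/-- The condition on the relative position in terms of `filCodim`; for small `a` the numbers
`filCodim e a` do not depend on `a`. -/
lemma mem_adlv0_iff_filCodim {μ : Fin h → ℕ} (hsum : ∑ i, μ i = m) {n : ℕ} {M : OSubmodule K h}
    (hM : M ∈ grassmannian0 K h ∩ window K h n) {a : ℤ} (ha : a ≤ -(n * h)) :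
    M ∈ adlv0 k K m μ ↔ ∀ e ≤ m + 1, filCodim k m e a M = ∑ i, (e - μ i) := by
  have hfil : M ≤ fil K h a := (mem_window_iff.1 hM.2).2.trans (fil_anti ha)
  constructor
  · rintro ⟨⟨g, rfl, k₁, k₂, hg⟩, -⟩ e _
    rw [filCodim_eq_levelCodim hfil, levelCodim_of_relativePosition hg]
  · intro H
    obtain ⟨g, rfl, hord⟩ := hM.1
    exact ⟨mem_adlv_of_levelCodim (le_of_sum_eq hsum) g fun e he => by
      rw [← filCodim_eq_levelCodim hfil, H e he], hM.1⟩

lemma isLocallyClosed_pluckerSet_adlv0 {μ : Fin h → ℕ} (hsum : ∑ i, μ i = m) {n : ℕ}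
    (hn : adlv0 k K m μ ⊆ window K h n) : IsLocallyClosed (pluckerSet n (adlv0 k K m μ)) := by
  classical
  convert isLocallyClosed_pluckerSet k m n
    ((Finset.range (m + 2)).image fun e => (e, (-(n * h) : ℤ))) (fun x => ∑ i, (x.1 - μ i)) using 2
  ext M
  have hiff : (∀ x ∈ (Finset.range (m + 2)).image fun e => (e, (-(n * h) : ℤ)),
      filCodim k m x.1 x.2 M = ∑ i, (x.1 - μ i)) ↔
      ∀ e ≤ m + 1, filCodim k m e (-(n * h)) M = ∑ i, (e - μ i) := by
    simp [Nat.lt_succ_iff]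
  rw [Set.mem_ofPred_eq, hiff]
  constructor
  · intro hM
    exact ⟨⟨hM.2, hn hM⟩, (mem_adlv0_iff_filCodim hsum ⟨hM.2, hn hM⟩ le_rfl).1 hM⟩
  · rintro ⟨hM, H⟩
    exact (mem_adlv0_iff_filCodim hsum hM le_rfl).2 H

/-- A stratum is cut out in `X_μ(b)^0` by the values of finitely many numbers `filCodim`, because
it has to be distinguished from finitely many others only. -/
lemma isLocallyClosed_pluckerSet_stratum (hmh : Nat.Coprime m h) {μ : Fin h → ℕ}
    (hsum : ∑ i, μ i = m) {n : ℕ} (hn : adlv0 k K m μ ⊆ window K h n)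
    {p : Set ℤ × (ℤ → WithBot ℕ)} (hp : IsExtendedSemimodule m h μ p.1 p.2) :
    IsLocallyClosed (pluckerSet n (stratum k K m h p.1 p.2)) := by
  classical
  -- finitely many indices separate `p` from the other extended semi-modules
  have hsep : ∀ p' : Set ℤ × (ℤ → WithBot ℕ), ∃ x : ℕ × ℤ,
      IsExtendedSemimodule m h μ p'.1 p'.2 → p ≠ p' →
        phiCodim p.1 p.2 x.1 x.2 ≠ phiCodim p'.1 p'.2 x.1 x.2 := by
    intro p'
    by_cases H : IsExtendedSemimodule m h μ p'.1 p'.2 ∧ p ≠ p'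
    · obtain ⟨x, hx⟩ := hp.exists_phiCodim_ne H.1 H.2
      exact ⟨x, fun _ _ => hx⟩
    · exact ⟨(0, 0), fun h1 h2 => absurd ⟨h1, h2⟩ H⟩
  choose x hx using hsep
  -- a common lower bound for the leading indices of lattices in the window and for `p.1`
  set a : ℤ := -(n * h) - h * m with ha
  have hh := natCast_h_pos (h := h)
  have hna : a ≤ -(n * h) := by
    have : (0 : ℤ) ≤ h * m := by positivity
    omega
  have hma : a ≤ -(h * m) := by
    have : (0 : ℤ) ≤ n * h := by positivity
    omega
  convert isLocallyClosed_pluckerSet k m n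
    (((Finset.range (m + 2)).image fun e => (e, a)) ∪
      (finite_isExtendedSemimodule hmh μ).toFinset.image x)
    (fun y => phiCodim p.1 p.2 y.1 y.2) using 2
  ext M
  constructor
  · intro hM
    have hM0 := stratum_subset_adlv0 hsum hp hM
    refine ⟨⟨hM0.2, hn hM0⟩, fun y _ => ?_⟩
    rw [filCodim_eq_phiCodim (mem_window_iff.1 (hn hM0)).2, hM.2.1, hM.2.2]
  · rintro ⟨hM, H⟩
    have hM0 : M ∈ adlv0 k K m μ := by
      refine (mem_adlv0_iff_filCodim hsum hM hna).2 fun e he => ?_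
      rw [H (e, a) (Finset.mem_union_left _ (Finset.mem_image_of_mem _ (Finset.mem_range.2 (by
        omega)))), ← (hp.finite_and_ncard_lt e).2, phiCodim]
      congr 1
      ext b
      simp only [Set.mem_ofPred_eq, ← hp.mem_iff]
      refine and_congr_right fun hb => or_iff_right fun hba => ?_
      have := (hp.bounds hmh).1 hb
      rw [Set.mem_Ici] at this
      omega
    have hM' := isExtendedSemimodule_of_mem_adlv0 hM0
    have heq : p = (latticeA M, latticePhi k m M) := by
      by_contra hne
      have h1 := hx (latticeA M, latticePhi k m M) hM' hne
      refine h1 ((H _ (Finset.mem_union_right _ (Finset.mem_image_of_mem _ ?_))).symm.trans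
        (filCodim_eq_phiCodim (mem_window_iff.1 hM.2).2 _ _))
      exact (Set.Finite.mem_toFinset _).2 hM'
    rw [heq]
    exact mem_stratum_of_mem_adlv0 hM0

end StrataLocallyClosed

/-! ### Locally closed subsets and reduced subschemes -/

section Subschemes

/-- In a Jacobson space, inclusions between finite unions of locally closed sets may be tested on
closed points. -/
lemma subset_biUnion_of_inter_closedPoints_subset {Y ι : Type*} [TopologicalSpace Y]
    [JacobsonSpace Y] (s : Finset ι) {T : Set Y} {T' : ι → Set Y} (hT : IsLocallyClosed T)
    (hT' : ∀ i, IsLocallyClosed (T' i)) (hsub : T ∩ closedPoints Y ⊆ ⋃ i ∈ s, T' i) :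
    T ⊆ ⋃ i ∈ s, T' i := by
  classical
  induction s using Finset.induction_on generalizing T with
  | empty =>
    intro x hx
    obtain ⟨y, hy⟩ := nonempty_inter_closedPoints ⟨x, hx⟩ hT
    simpa using hsub hy
  | insert i s _ ih =>
    obtain ⟨U, C, hU, hC, hUC⟩ := hT' i
    rw [Finset.set_biUnion_insert] at hsub ⊢
    -- the complement of `T' i` is a union of two locally closed sets
    have key : ∀ W : Set Y, IsLocallyClosed W → Disjoint W (T' i) → T ∩ W ⊆ ⋃ i ∈ s, T' i := by
      refine fun W hW hd => ih (hT.inter hW) ?_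
      rintro x ⟨⟨hx1, hx2⟩, hx3⟩
      exact (hsub ⟨hx1, hx3⟩).resolve_left fun h => Set.disjoint_left.1 hd hx2 h
    intro x hx
    by_cases hxi : x ∈ T' i
    · exact Or.inl hxi
    · right
      rw [hUC, Set.mem_inter_iff, not_and_or] at hxi
      rcases hxi with hxi | hxi
      · refine key Uᶜ hU.isClosed_compl.isLocallyClosed ?_ ⟨hx, hxi⟩
        rw [hUC]
        exact Set.disjoint_left.2 fun y hy h => hy h.1
      · refine key Cᶜ hC.isOpen_compl.isLocallyClosed ?_ ⟨hx, hxi⟩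
        rw [hUC]
        exact Set.disjoint_left.2 fun y hy h => hy h.2

lemma isReduced_subscheme_vanishingIdeal {X : Scheme} (Z : TopologicalSpace.Closeds X) :
    IsReduced (Scheme.IdealSheafData.vanishingIdeal Z).subscheme := by
  have hquot : ∀ U : X.affineOpens, IsReduced (Spec (.of <|
      Γ(X, U.1) ⧸ (Scheme.IdealSheafData.vanishingIdeal Z).ideal U)) := by
    intro U
    have hrad : ((Scheme.IdealSheafData.vanishingIdeal Z).ideal U).IsRadical := by
      rw [Scheme.IdealSheafData.vanishingIdeal_ideal]
      exact PrimeSpectrum.isRadical_vanishingIdeal _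
    have : _root_.IsReduced (Γ(X, U.1) ⧸ (Scheme.IdealSheafData.vanishingIdeal Z).ideal U) :=
      (Ideal.isRadical_iff_quotient_reduced _).1 hrad
    infer_instance
  have : ∀ U, IsReduced ((Scheme.IdealSheafData.vanishingIdeal Z).subschemeCover.openCover.X U) :=
    hquot
  exact IsReduced.of_openCover _ (Scheme.IdealSheafData.vanishingIdeal Z).subschemeCover.openCover

/-- Every locally closed subset of a scheme is the underlying set of a reduced subscheme. -/
lemma exists_reduced_isImmersion (X : Scheme) {T : Set X} (hT : IsLocallyClosed T) :
    ∃ (Z : Scheme) (i : Z ⟶ X), IsReduced Z ∧ IsImmersion i ∧ Set.range i = T := by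
  obtain ⟨U, C, hU, hC, rfl⟩ := hT
  let U' : X.Opens := ⟨U, hU⟩
  let C' : TopologicalSpace.Closeds U' := ⟨U'.ι ⁻¹' C, hC.preimage U'.ι.continuous⟩
  refine ⟨_, (Scheme.IdealSheafData.vanishingIdeal C').subschemeι ≫ U'.ι,
    isReduced_subscheme_vanishingIdeal C', inferInstance, ?_⟩
  rw [Scheme.Hom.comp_base, TopCat.coe_comp, Set.range_comp, Scheme.IdealSheafData.range_subschemeι,
    Scheme.IdealSheafData.coe_support_vanishingIdeal]
  change U'.ι '' (U'.ι ⁻¹' C) = _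
  rw [Set.image_preimage_eq_inter_range, Scheme.Opens.range_ι, Set.inter_comm]
  rfl

end Subschemes

section PluckerSpace

variable {K : Type*} [Field K] [IsAlgClosed K] {h : ℕ} [NeZero h] {n : ℕ}

lemma jacobsonSpace_and_isLocallyNoetherian_Proj {F A : Type*} [Field F] [CommRing A] [Algebra F A]
    [Algebra.FiniteType F A] (𝒜 : ℕ → Submodule F A) [GradedAlgebra 𝒜]
    (h0 : ∀ f ∈ 𝒜 0, ∃ c : F, algebraMap F A c = f) :
    JacobsonSpace (Proj 𝒜) ∧ IsLocallyNoetherian (Proj 𝒜) := by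
  let e : F →+* 𝒜 0 := algebraMap F (𝒜 0)
  have he : Function.Surjective e := fun ⟨f, hf⟩ => by
    obtain ⟨c, rfl⟩ := h0 f hf
    exact ⟨c, rfl⟩
  have h1 : IsNoetherianRing (𝒜 0) := isNoetherianRing_of_surjective F (𝒜 0) e he
  have h2 : IsJacobsonRing (𝒜 0) := isJacobsonRing_of_surjective ⟨e, he⟩
  have : IsScalarTower F (𝒜 0) A := ⟨fun a b c => smul_mul_assoc a (b : A) c⟩
  have h3 : Algebra.FiniteType (𝒜 0) A := Algebra.FiniteType.of_restrictScalars_finiteType F (𝒜 0) A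
  have h5 : IsLocallyNoetherian (Spec (.of (𝒜 0))) := inferInstance
  exact ⟨LocallyOfFiniteType.jacobsonSpace (Proj.toSpecZero 𝒜),
    LocallyOfFiniteType.isLocallyNoetherian (Proj.toSpecZero 𝒜)⟩

lemma jacobsonSpace_and_isLocallyNoetherian_pluckerSpace (K : Type*) [Field K] (d : ℕ) :
    JacobsonSpace (pluckerSpace K d) ∧ IsLocallyNoetherian (pluckerSpace K d) :=
  jacobsonSpace_and_isLocallyNoetherian_Proj _ fun f hf =>
    ⟨MvPolynomial.coeff 0 f, (MvPolynomial.totalDegree_eq_zero_iff_eq_C.1 (Nat.le_zero.1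
      (MvPolynomial.IsHomogeneous.totalDegree_le hf))).symm⟩

lemma isPluckerPoint_iff {M : OSubmodule K h} {x : pluckerSpace K (n * h)} :
    IsPluckerPoint n M x ↔ ∃ w, IsFrame n M w ∧
      ∃ hw : pluckerCoords w ≠ 0, x = projPoint (pluckerCoords w) hw := by
  refine exists_congr fun w => and_congr_right fun hw => ?_
  have hne : pluckerCoords w ≠ 0 := by
    obtain ⟨J, hJ⟩ := exists_pluckerCoords_ne_zero hw.1
    exact fun h0 => hJ (congrFun h0 J)
  constructor
  · intro H
    refine ⟨hne, ?_⟩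
    apply ProjectiveSpectrum.ext
    apply HomogeneousIdeal.ext
    ext f
    exact (H f).trans mem_lineIdeal_iff.symm
  · rintro ⟨_, rfl⟩ f
    exact mem_lineIdeal_iff

/-- A lattice is determined by its Plücker point. -/
lemma IsPluckerPoint.eq {M M' : OSubmodule K h} (hM : M ∈ window K h n) (hM' : M' ∈ window K h n)
    {x : pluckerSpace K (n * h)} (hx : IsPluckerPoint n M x) (hx' : IsPluckerPoint n M' x) :
    M = M' := by
  obtain ⟨w, hw, hne, rfl⟩ := isPluckerPoint_iff.1 hx
  obtain ⟨w', hw', hne', heq⟩ := isPluckerPoint_iff.1 hx'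
  have hle : lineIdeal (pluckerCoords w') ≤ lineIdeal (pluckerCoords w) := by
    intro f hf
    have : f ∈ (projPoint (pluckerCoords w) hne).asHomogeneousIdeal := by
      rw [heq]
      exact hf
    exact this
  obtain ⟨c, hc⟩ := exists_eq_smul_of_lineIdeal_le hne' hle
  exact eq_of_coords hM hM' hw hw' (p := ⟨pluckerCoords w, hne⟩) (one_smul K _).symm hc

/-- A locally closed condition on Plücker coordinates defines a locally closed subset of the
projective space. -/
lemma exists_isLocallyClosed_inter_closedPoints_eq {S : Set (OSubmodule K h)}
    (hS : IsLocallyClosed (pluckerSet n S)) :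
    ∃ T : Set (pluckerSpace K (n * h)), IsLocallyClosed T ∧
      T ∩ closedPoints (pluckerSpace K (n * h)) = {x | ∃ M ∈ S, IsPluckerPoint n M x} := by
  obtain ⟨T, hT, hTS⟩ := isInducing_toProj.isLocallyClosed_iff.1 hS
  refine ⟨T, hT, ?_⟩
  have hcl : closedPoints (pluckerSpace K (n * h)) =
      Set.range (CoordVec.toProj (ι := PluckerIndex (n * h)) (K := K)) :=
    closedPoints_projectiveSpectrum
  rw [hcl]
  ext x
  constructor
  · rintro ⟨hx, p, rfl⟩
    have hp : p ∈ pluckerSet n S := by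
      rw [← hTS]
      exact hx
    obtain ⟨M, hM, w, hw, c, hc⟩ := hp
    have hc0 : c ≠ 0 := by
      rintro rfl
      exact p.2 (by rw [hc, zero_smul])
    have hne : pluckerCoords w ≠ 0 := fun h0 => p.2 (by rw [hc, h0, smul_zero])
    refine ⟨M, hM, isPluckerPoint_iff.2 ⟨w, hw, hne, ?_⟩⟩
    apply ProjectiveSpectrum.ext
    apply HomogeneousIdeal.ext
    change lineIdeal p.1 = lineIdeal (pluckerCoords w)
    rw [hc, lineIdeal_smul hc0]
  · rintro ⟨M, hM, hx⟩
    obtain ⟨w, hw, hne, rfl⟩ := isPluckerPoint_iff.1 hx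
    refine ⟨?_, ⟨⟨pluckerCoords w, hne⟩, rfl⟩⟩
    have : (⟨pluckerCoords w, hne⟩ : CoordVec _ K) ∈ CoordVec.toProj ⁻¹' T := by
      rw [hTS]
      exact ⟨M, hM, w, hw, 1, (one_smul K _).symm⟩
    exact this

end PluckerSpace

/-! ### Dimensions of locally closed decompositions -/

section Dimension

open TopologicalSpace in
/-- Let a locally Noetherian Jacobson scheme be the union of locally closed subsets. Every chain of
irreducible closed subsets yields one of the same length in one of the subsets: the subset that
contains the generic point of the largest term contains a neighbourhood of it in its closure. -/
lemma exists_le_topologicalKrullDim {X : Scheme} [IsLocallyNoetherian X] [JacobsonSpace X]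
    {ι : Type*} {S : ι → Type*} [∀ p, TopologicalSpace (S p)] {i : ∀ p, S p → X}
    (hi : ∀ p, Topology.IsEmbedding (i p)) (hlc : ∀ p, IsLocallyClosed (Set.range (i p)))
    (hcov : (⋃ p, Set.range (i p)) = Set.univ) (s : LTSeries (IrreducibleCloseds X)ᵒᵈ) :
    ∃ p, (s.length : WithBot ℕ∞) ≤ topologicalKrullDim (S p) := by
  classical
  -- an affine neighbourhood of a point of the smallest term meets all terms
  obtain ⟨x, hx⟩ : ∃ x, x ∈ (OrderDual.ofDual s.last : IrreducibleCloseds X).carrier :=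
    (OrderDual.ofDual s.last).2.nonempty
  obtain ⟨V, hV, hxV, -⟩ := exists_isAffineOpen_mem_and_subset (x := x) (U := ⊤) trivial
  have hR : IsNoetherianRing Γ(X, V) := IsLocallyNoetherian.component_noetherian ⟨V, hV⟩
  have hopen := hV.fromSpec.isOpenEmbedding
  have hJ : JacobsonSpace (PrimeSpectrum Γ(X, V)) := JacobsonSpace.of_isOpenEmbedding hopen
  have hJR : IsJacobsonRing Γ(X, V) := PrimeSpectrum.isJacobsonRing_iff_jacobsonSpace.2 hJ
  let g : PrimeSpectrum Γ(X, V) → X := hV.fromSpec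
  have hg : Topology.IsOpenEmbedding g := hopen
  have hgr : Set.range g = (V : Set X) := hV.range_fromSpec
  obtain ⟨P₀, -⟩ : x ∈ Set.range g := by
    rw [hgr]
    exact hxV
  have hex : ∀ Z : (IrreducibleCloseds X)ᵒᵈ, ∃ P : PrimeSpectrum Γ(X, V),
      Z ≤ s.last → closure {g P} = (OrderDual.ofDual Z : IrreducibleCloseds X).carrier := by
    intro Z
    by_cases hZ : Z ≤ s.last
    · have hirr := (OrderDual.ofDual Z).2
      have hcl := (OrderDual.ofDual Z).3
      have hgen := hirr.isGenericPoint_genericPoint hcl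
      have hxZ : x ∈ (OrderDual.ofDual Z : IrreducibleCloseds X).carrier := hZ hx
      have hspec : hirr.genericPoint ⤳ x := hgen.specializes hxZ
      have hmem : hirr.genericPoint ∈ (V : Set X) := hspec.mem_open V.2 hxV
      rw [← hgr] at hmem
      obtain ⟨P, hP⟩ := hmem
      exact ⟨P, fun _ => by rw [hP]; exact hgen⟩
    · exact ⟨P₀, fun h => absurd h hZ⟩
  -- the generic points of the terms, as primes of the affine neighbourhood
  choose P hP using hex
  have hspec : ∀ q q' : PrimeSpectrum Γ(X, V), q ≤ q' ↔ closure {g q'} ⊆ closure {g q} := by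
    intro q q'
    rw [PrimeSpectrum.le_iff_specializes, ← hg.isInducing.specializes_iff,
      specializes_iff_closure_subset]
  have hchain : HasChain (fun _ => True) s.length (P s.head) := by
    refine (hasChain_ltSeries s).map (fun Z Z' hZ hZ' hlt => ?_) fun _ _ => trivial
    have h1 : P Z ≤ P Z' := by
      rw [hspec, hP Z hZ, hP Z' hZ']
      exact hlt.le
    refine lt_of_le_of_ne h1 fun he => hlt.not_ge ?_
    have h2 := (hspec _ _).1 he.ge
    rw [hP Z hZ, hP Z' hZ'] at h2
    exact h2
  obtain ⟨p, hp⟩ : ∃ p, g (P s.head) ∈ Set.range (i p) := by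
    have : g (P s.head) ∈ ⋃ p, Set.range (i p) := by rw [hcov]; trivial
    exact Set.mem_iUnion.1 this
  refine ⟨p, ?_⟩
  obtain ⟨U, C, hU, hC, hUC⟩ := hlc p
  rw [hUC] at hp
  obtain ⟨_, ⟨f, rfl⟩, hf, hfU⟩ := PrimeSpectrum.isTopologicalBasis_basic_opens.exists_subset_of_mem_open
    (show P s.head ∈ g ⁻¹' U from hp.1) (hU.preimage hg.continuous)
  -- the primes above the generic point of the largest term that do not contain `f` lie in `S p`
  have hlift : ∀ q : PrimeSpectrum Γ(X, V), ∃ y : S p,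
      f ∉ q.asIdeal ∧ P s.head ≤ q → i p y = g q := by
    intro q
    by_cases hq : f ∉ q.asIdeal ∧ P s.head ≤ q
    · have : g q ∈ Set.range (i p) := by
        rw [hUC]
        refine ⟨hfU hq.1, ?_⟩
        have h1 := (hspec _ _).1 hq.2 (subset_closure rfl)
        exact hC.closure_subset_iff.2 (Set.singleton_subset_iff.2 hp.2) h1
      obtain ⟨y, hy⟩ := this
      exact ⟨y, fun _ => hy⟩
    · rw [← hUC] at hp
      obtain ⟨y, -⟩ := hp
      exact ⟨y, fun h => absurd h hq⟩
  choose y hy using hlift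
  have hchain' := (hasChain_notMem f hf hchain).and_le
  have hfinal : HasChain (fun _ => True) s.length
      (OrderDual.toDual (⟨closure {y (P s.head)}, isIrreducible_singleton.closure,
        isClosed_closure⟩ : IrreducibleCloseds (S p))) := by
    refine hchain'.map (f := fun q => OrderDual.toDual (⟨closure {y q},
      isIrreducible_singleton.closure, isClosed_closure⟩ : IrreducibleCloseds (S p)))
      (fun q q' hq hq' hlt => ?_) fun _ _ => trivial
    have hcl : ∀ q q', f ∉ q.asIdeal ∧ P s.head ≤ q → f ∉ q'.asIdeal ∧ P s.head ≤ q' →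
        (q ≤ q' ↔ closure {y q'} ⊆ closure {y q}) := by
      intro q q' hq hq'
      rw [← specializes_iff_closure_subset, ← (hi p).isInducing.specializes_iff, hy q hq, hy q' hq',
        specializes_iff_closure_subset, hspec]
    have h1 := (hcl q q' hq hq').1 hlt.le
    exact lt_of_le_not_ge h1 fun h2 => hlt.not_ge ((hcl q' q hq' hq).2 h2)
  have := hfinal.le_krullDim
  rwa [Order.krullDim_orderDual] at this

/-- The dimension of a scheme is the largest dimension of the members of a finite locally closed
decomposition. -/
lemma isGreatest_topologicalKrullDim {X : Scheme} [IsLocallyNoetherian X] [JacobsonSpace X]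
    {ι : Type*} [Finite ι] [Nonempty ι] {S : ι → Type*} [∀ p, TopologicalSpace (S p)]
    {i : ∀ p, S p → X} (hi : ∀ p, Topology.IsEmbedding (i p))
    (hlc : ∀ p, IsLocallyClosed (Set.range (i p))) (hcov : (⋃ p, Set.range (i p)) = Set.univ) :
    IsGreatest (Set.range fun p => topologicalKrullDim (S p)) (topologicalKrullDim X) := by
  obtain ⟨p, hp⟩ := Finite.exists_max fun p => topologicalKrullDim (S p)
  refine ⟨⟨p, le_antisymm (hi p).isInducing.topologicalKrullDim_le ?_⟩, ?_⟩
  · rw [topologicalKrullDim, ← Order.krullDim_orderDual]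
    refine iSup_le fun s => ?_
    obtain ⟨p', hp'⟩ := exists_le_topologicalKrullDim hi hlc hcov s
    exact hp'.trans (hp p')
  · rintro _ ⟨p, rfl⟩
    exact (hi p).isInducing.topologicalKrullDim_le

end Dimension

/-! ### The decomposition of `X_μ(b)^0` -/

section Decomposition

variable {k K : Type*} [Field k] [Fintype k] [Field K] [Algebra k K] {m h : ℕ} [NeZero h]

/-- Inclusions of sets of lattices carry over to the locally closed subsets of the projective
space with the corresponding closed points. -/
lemma subset_of_inter_closedPoints [IsAlgClosed K] {n : ℕ} {S S' : Set (OSubmodule K h)}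
    {T T' : Set (pluckerSpace K (n * h))} (hT : IsLocallyClosed T) (hT' : IsLocallyClosed T')
    (hTS : T ∩ closedPoints (pluckerSpace K (n * h)) = {x | ∃ M ∈ S, IsPluckerPoint n M x})
    (hTS' : T' ∩ closedPoints (pluckerSpace K (n * h)) = {x | ∃ M ∈ S', IsPluckerPoint n M x})
    (hsub : S ⊆ S') : T ⊆ T' := by
  have := (jacobsonSpace_and_isLocallyNoetherian_pluckerSpace K (n * h)).1
  have h1 := subset_biUnion_of_inter_closedPoints_subset {()} (T' := fun _ => T') hT (fun _ => hT') (by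
    rw [hTS]
    rintro x ⟨M, hM, hx⟩
    have h2 : x ∈ T' ∩ closedPoints (pluckerSpace K (n * h)) := by
      rw [hTS']
      exact ⟨M, hsub hM, hx⟩
    exact Set.mem_iUnion₂.2 ⟨(), Finset.mem_singleton_self _, h2.1⟩)
  intro x hx
  obtain ⟨-, -, hx'⟩ := Set.mem_iUnion₂.1 (h1 hx)
  exact hx'

/-- The reduced scheme `X_μ(b)^0` inside a projective space, and its decomposition. All assertions
about the underlying sets are checked on closed points. -/
lemma exists_scheme_decomposition [IsAlgClosed K] (hmh : Nat.Coprime m h) {μ : Fin h → ℕ}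
    (hsum : ∑ i, μ i = m) {n : ℕ} (hn : adlv0 k K m μ ⊆ window K h n) :
    ∃ (X : Scheme) (j : X ⟶ pluckerSpace K (n * h)), IsReducedSubscheme n (adlv0 k K m μ) j ∧
      ∃ (S : {p : Set ℤ × (ℤ → WithBot ℕ) // IsExtendedSemimodule m h μ p.1 p.2} → Scheme)
        (i : ∀ p, S p ⟶ X),
        (∀ p, IsImmersion (i p) ∧
          IsReducedSubscheme n (stratum k K m h p.1.1 p.1.2) (i p ≫ j)) ∧
        _root_.Pairwise (fun p p' => Disjoint (Set.range (i p)) (Set.range (i p'))) ∧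
        (⋃ p, Set.range (i p)) = Set.univ ∧
        IsGreatest (Set.range fun p => topologicalKrullDim (S p)) (topologicalKrullDim X) := by
  obtain ⟨hJ, hN⟩ := jacobsonSpace_and_isLocallyNoetherian_pluckerSpace K (n * h)
  have hfin : Finite {p : Set ℤ × (ℤ → WithBot ℕ) // IsExtendedSemimodule m h μ p.1 p.2} :=
    (finite_isExtendedSemimodule hmh μ).to_subtype
  have hsub : ∀ p : {p : Set ℤ × (ℤ → WithBot ℕ) // IsExtendedSemimodule m h μ p.1 p.2},
      stratum k K m h p.1.1 p.1.2 ⊆ adlv0 k K m μ := fun p => stratum_subset_adlv0 hsum p.2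
  obtain ⟨T, hT, hTcl⟩ := exists_isLocallyClosed_inter_closedPoints_eq
    (isLocallyClosed_pluckerSet_adlv0 hsum hn)
  have hTp := fun p : {p : Set ℤ × (ℤ → WithBot ℕ) // IsExtendedSemimodule m h μ p.1 p.2} =>
    exists_isLocallyClosed_inter_closedPoints_eq
      (isLocallyClosed_pluckerSet_stratum (k := k) (K := K) hmh hsum hn p.2)
  choose T' hT' hTcl' using hTp
  have hTsub : ∀ p, T' p ⊆ T := fun p =>
    subset_of_inter_closedPoints (hT' p) hT (hTcl' p) hTcl (hsub p)
  have hTcov : T ⊆ ⋃ p, T' p := by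
    have := Fintype.ofFinite
      {p : Set ℤ × (ℤ → WithBot ℕ) // IsExtendedSemimodule m h μ p.1 p.2}
    have h1 := subset_biUnion_of_inter_closedPoints_subset Finset.univ hT hT' (by
      rw [hTcl]
      rintro x ⟨M, hM, hx⟩
      refine Set.mem_iUnion₂.2 ⟨⟨(latticeA M, latticePhi k m M),
        isExtendedSemimodule_of_mem_adlv0 hM⟩, Finset.mem_univ _, ?_⟩
      refine Set.mem_of_mem_inter_left (b := closedPoints (pluckerSpace K (n * h))) ?_
      rw [hTcl']
      exact ⟨M, mem_stratum_of_mem_adlv0 hM, hx⟩)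
    simpa using h1
  have hTdisj : ∀ p p', p ≠ p' → Disjoint (T' p) (T' p') := by
    intro p p' hpp'
    rw [Set.disjoint_iff_inter_eq_empty]
    by_contra hne
    obtain ⟨x, ⟨hx1, hx2⟩, hx3⟩ := nonempty_inter_closedPoints (Set.nonempty_iff_ne_empty.2 hne)
      ((hT' p).inter (hT' p'))
    have h1 : x ∈ T' p ∩ closedPoints (pluckerSpace K (n * h)) := ⟨hx1, hx3⟩
    have h2 : x ∈ T' p' ∩ closedPoints (pluckerSpace K (n * h)) := ⟨hx2, hx3⟩
    rw [hTcl'] at h1 h2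
    obtain ⟨M, hM, hMx⟩ := h1
    obtain ⟨M', hM', hMx'⟩ := h2
    obtain rfl := hMx.eq (hn (hsub p hM)) (hn (hsub p' hM')) hMx'
    exact hpp' (Subtype.ext (Prod.ext (hM.2.1.symm.trans hM'.2.1) (hM.2.2.symm.trans hM'.2.2)))
  obtain ⟨X, j, hXred, hj, hjT⟩ := exists_reduced_isImmersion (pluckerSpace K (n * h)) hT
  have hlc : ∀ p, IsLocallyClosed (j ⁻¹' T' p) := fun p => (hT' p).preimage j.continuous
  choose S i hSred hi hiT using fun p => exists_reduced_isImmersion X (hlc p)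
  have hcov : (⋃ p, Set.range (i p)) = Set.univ := by
    refine Set.eq_univ_of_forall fun x => ?_
    have hx : j x ∈ T := by
      rw [← hjT]
      exact ⟨x, rfl⟩
    obtain ⟨p, hp⟩ := Set.mem_iUnion.1 (hTcov hx)
    refine Set.mem_iUnion.2 ⟨p, ?_⟩
    rw [hiT]
    exact hp
  refine ⟨X, j, ⟨hXred, hj, hn, by rw [hjT, hTcl]⟩, S, i, fun p => ⟨hi p, ⟨hSred p, ?_, ?_, ?_⟩⟩,
    fun p p' hpp' => ?_, hcov, ?_⟩
  · have := hi p
    infer_instance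
  · exact (hsub p).trans hn
  · have hr : Set.range (i p ≫ j) = T' p := by
      rw [Scheme.Hom.comp_base, TopCat.coe_comp, Set.range_comp, hiT,
        Set.image_preimage_eq_inter_range, hjT]
      exact Set.inter_eq_left.2 (hTsub p)
    rw [hr, hTcl']
  · change Disjoint (Set.range (i p)) (Set.range (i p'))
    rw [hiT, hiT]
    exact (hTdisj p p' hpp').preimage j
  · have : JacobsonSpace X := LocallyOfFiniteType.jacobsonSpace j
    have : IsLocallyNoetherian X := LocallyOfFiniteType.isLocallyNoetherian j
    have : Nonempty {p : Set ℤ × (ℤ → WithBot ℕ) // IsExtendedSemimodule m h μ p.1 p.2} := by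
      obtain ⟨A, φ, hp⟩ := exists_isExtendedSemimodule hmh hsum
      exact ⟨⟨(A, φ), hp⟩⟩
    exact isGreatest_topologicalKrullDim (i := fun p => i p) (fun p => (hi p).isEmbedding)
      (fun p => by rw [hiT]; exact hlc p) hcov

end Decomposition

end AffineDL

end

theorem mainTheorem5 {k : Type*} [Field k] [Fintype k] {K : Type*} [Field K] [Algebra k K]
    [IsAlgClosure k K] (m h : ℕ) [NeZero h] (hmh : Nat.Coprime m h)
    (μ : Fin h → ℕ) (hμ : Monotone μ) (hsum : ∑ i, μ i = m) :
    -- the strata lie in `X_μ(b)^0`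
    (∀ A φ, AffineDL.IsExtendedSemimodule m h μ A φ →
      AffineDL.stratum k K m h A φ ⊆ AffineDL.adlv0 k K m μ) ∧
    -- there are finitely many of them
    {p : Set ℤ × (ℤ → WithBot ℕ) | AffineDL.IsExtendedSemimodule m h μ p.1 p.2}.Finite ∧
    -- they are disjoint and cover `X_μ(b)^0`
    {p : Set ℤ × (ℤ → WithBot ℕ) | AffineDL.IsExtendedSemimodule m h μ p.1 p.2}.PairwiseDisjoint
      (fun p => AffineDL.stratum k K m h p.1 p.2) ∧
    (⋃ p ∈ {p : Set ℤ × (ℤ → WithBot ℕ) | AffineDL.IsExtendedSemimodule m h μ p.1 p.2},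
      AffineDL.stratum k K m h p.1 p.2) = AffineDL.adlv0 k K m μ ∧
    -- the same holds for the reduced schemes, and the strata are locally closed subschemes
    (∃ n : ℕ, AffineDL.adlv0 k K m μ ⊆ AffineDL.window K h n) ∧
    ∀ n : ℕ, AffineDL.adlv0 k K m μ ⊆ AffineDL.window K h n →
      ∃ (X : Scheme) (j : X ⟶ AffineDL.pluckerSpace K (n * h)),
        AffineDL.IsReducedSubscheme n (AffineDL.adlv0 k K m μ) j ∧
        ∃ (S : {p : Set ℤ × (ℤ → WithBot ℕ) // AffineDL.IsExtendedSemimodule m h μ p.1 p.2} →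
              Scheme)
          (i : ∀ p, S p ⟶ X),
          (∀ p, IsImmersion (i p) ∧
            AffineDL.IsReducedSubscheme n (AffineDL.stratum k K m h p.1.1 p.1.2) (i p ≫ j)) ∧
          _root_.Pairwise (fun p p' => Disjoint (Set.range (i p)) (Set.range (i p'))) ∧
          (⋃ p, Set.range (i p)) = Set.univ ∧
          IsGreatest (Set.range fun p => topologicalKrullDim (S p)) (topologicalKrullDim X) := by
  have hK : IsAlgClosed K := IsAlgClosure.isAlgClosed k
  refine ⟨fun A φ hp => AffineDL.stratum_subset_adlv0 hsum hp,
    AffineDL.finite_isExtendedSemimodule hmh μ, ?_, ?_,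
    ⟨m + 1, AffineDL.adlv0_subset_window hmh μ⟩,
    fun n hn => AffineDL.exists_scheme_decomposition hmh hsum hn⟩
  · refine fun p _ p' _ hpp' => Set.disjoint_left.2 fun M hM hM' => hpp' ?_
    exact Prod.ext (hM.2.1.symm.trans hM'.2.1) (hM.2.2.symm.trans hM'.2.2)
  · refine subset_antisymm (Set.iUnion₂_subset fun p hp => AffineDL.stratum_subset_adlv0 hsum hp)
      fun M hM => ?_
    exact Set.mem_iUnion₂.2 ⟨(AffineDL.latticeA M, AffineDL.latticePhi k m M),
      AffineDL.isExtendedSemimodule_of_mem_adlv0 hM, AffineDL.mem_stratum_of_mem_adlv0 hM⟩
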